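/- Let $n,m\ge 1$ and let $\vec v=\vec v(l)\in\mathbb R^{n-1}$ (the horizontal field) and $\overleftarrow v=\overleftarrow v(l)\in\mathbb R^{m-1}$ (the vertical field) be the flow variables. Work with real differential polynomials in $(\vec v,\overleftarrow v)$, let $D$ be the total derivative with respect to the arclength $l$, and let $D^{-1}$ be its formal inverse on total derivatives, with integration constant $0$. Functionals are taken modulo total derivatives, vector fields are characteristics of evolution equations, and their commutator is the commutator of the evolutionary derivations. With $(A\wedge B)_{ij}=A_iB_j-B_iA_j$ and $(A\rfloor M)_j=\sum_iA_iM_{ij}$ define $$h\mathcal J=D+D^{-1}(\vec v\,\cdot\,)\,\vec v,\qquad h\mathcal H=D+\vec v\rfloor D^{-1}(\vec v\,\wedge\,\cdot\,),\qquad h\mathfrak R=h\mathcal H\circ h\mathcal J,$$ let $v\mathcal J,v\mathcal H,v\mathfrak R$ be given by the same formulas with $\overleftarrow v$ in place of $\vec v$, and put $\mathcal J=(h\mathcal J,v\mathcal J)$, $\mathcal H=(h\mathcal H,v\mathcal H)$, $\mathfrak R=(h\mathfrak R,v\mathfrak R)$, acting componentwise on d-vectors (pairs of a horizontal vector with $n-1$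 components and a vertical vector with $m-1$ components). All these operators are considered on their natural domains, i.e. wherever each occurring $D^{-1}$ is applied to a total derivative. An operator $P$ from covector fields to vector fields is called Hamiltonian if it is single-valued, linear and skew-adjoint (modulo total derivatives) and satisfies the Jacobi identity $\langle L_{P\xi_1}\xi_2,P\xi_3\rangle+\text{cyclic}=0$ for all covector fields $\xi_1,\xi_2,\xi_3$ in its domain, where $\langle\xi,Y\rangle=\int\xi\cdot Y\,dl$ and $L$ is the Lie derivative. A sum of two operators is defined on the intersection of their domains. (1) The d-operators $\mathcal H$, $\mathcal J$, $\mathfrak R$ are N-adapted, i.e. they commute with the projections of d-vectors to their horizontal and to their vertical parts. $\mathcal H$ and $\mathcal J$ are mutually compatible: $\mathcal H$ and $\mathcal J^{-1}$ are Hamiltonian operators, and so is $c_1\mathcal H+c_2\mathcal J^{-1}$ for all $c_1,c_2\in\mathbb R$. Moreover $\mathcal Q=\mathcal H\circ\mathcal J\circ\mathcal H=\mathfrak R\circ\mathcal H$ is a Hamiltonian operator. (2) There are hierarchies of vectors $h\vec e_\perp^{(k)}$, covectors $\vec\varpi^{(k)}$ and Hamiltonian densities $hH^{(k)}$, $k=0,1,2,\dots$,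 which are differential polynomials in $\vec v$ only, with $$h\vec e_\perp^{(0)}=\vec v_l,\quad \vec\varpi^{(0)}=\vec v,\quad hH^{(0)}=\tfrac12|\vec v|^2,\quad h\vec e_\perp^{(k+1)}=h\mathfrak R\big(h\vec e_\perp^{(k)}\big),$$ $$h\vec e_\perp^{(k)}=h\mathcal H\big(\vec\varpi^{(k)}\big),\quad \vec\varpi^{(k+1)}=h\mathcal J\big(h\vec e_\perp^{(k)}\big),\quad \vec\varpi^{(k)}=\delta (hH^{(k)})/\delta\vec v ,$$ all of these expressions being defined, and the vector fields $h\vec e_\perp^{(k)}$ commute pairwise. For every $\vec R\in\mathbb R$ (the constant horizontal scalar curvature), with $hH^{(k,\vec R)}=hH^{(k+1)}-\vec R\,hH^{(k)}$, the evolution equations $$\vec v_\tau=h\vec e_\perp^{(k+1)}-\vec R\,h\vec e_\perp^{(k)}=h\mathcal H\Big(\frac{\delta (hH^{(k,\vec R)})}{\delta\vec v}\Big)=(h\mathcal J)^{-1}\Big(\frac{\delta (hH^{(k+1,\vec R)})}{\delta\vec v}\Big),\qquad k=0,1,2,\dots,$$ are $O(n-1)$-invariant and define pairwise commuting flows. (3)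 The same holds for the vertical field: there are $v\overleftarrow e_\perp^{(k)}$, $\overleftarrow\varpi^{(k)}$, $vH^{(k)}$, differential polynomials in $\overleftarrow v$ only, with the analogous initial terms, relations and commutation, and for every $\overleftarrow S\in\mathbb R$ (the constant vertical scalar curvature), with $vH^{(k,\overleftarrow S)}=vH^{(k+1)}-\overleftarrow S\,vH^{(k)}$, the evolution equations $$\overleftarrow v_\tau=v\overleftarrow e_\perp^{(k+1)}-\overleftarrow S\,v\overleftarrow e_\perp^{(k)}=v\mathcal H\Big(\frac{\delta (vH^{(k,\overleftarrow S)})}{\delta\overleftarrow v}\Big)=(v\mathcal J)^{-1}\Big(\frac{\delta (vH^{(k+1,\overleftarrow S)})}{\delta\overleftarrow v}\Big)$$ are $O(m-1)$-invariant and define pairwise commuting flows. The horizontal flows also commute with the vertical ones. -/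

import Mathlib

open MvPolynomial

noncomputable section

/-! ### Differential polynomials and the formal calculus of variations

`α` indexes the components of the field. The variable `X (a, j)` stands for the `j`-th
derivative of the `a`-th component with respect to the arclength `l`. -/

/-- Differential polynomials in the field components indexed by `α`. -/
abbrev DiffPoly (α : Type) : Type := MvPolynomial (α × ℕ) ℝ

/-- The total derivative `D` along `l`: the derivation with `D v_{a,j} = v_{a,j+1}`. -/
def totalD (α : Type) : Derivation ℝ (DiffPoly α) (DiffPoly α) :=
  mkDerivation ℝ fun p => X (p.1, p.2 + 1)

/-- The (prolonged) evolutionary vector field with characteristic `Q`, that is, the derivative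
of differential polynomials along the evolution equation `v_τ = Q`. -/
def evolve {α : Type} (Q : α → DiffPoly α) : Derivation ℝ (DiffPoly α) (DiffPoly α) :=
  mkDerivation ℝ fun p => (⇑(totalD α))^[p.2] (Q p.1)

/-- The commutator of evolutionary vector fields, in terms of characteristics. -/
def flowBracket {α : Type} (Y Z : α → DiffPoly α) : α → DiffPoly α :=
  fun a => evolve Y (Z a) - evolve Z (Y a)

/-- The functional `∫ f dl` vanishes: `f` is a total derivative. -/
def IntegralZero {α : Type} (f : DiffPoly α) : Prop := ∃ g, totalD α g = f

/-- The variational derivative `δ(∫ f dl)/δ v_a = ∑_j (-D)^j (∂ f / ∂ v_{a,j})`;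
only finitely many terms are nonzero. -/
def varDeriv {α : Type} (f : DiffPoly α) (a : α) : DiffPoly α :=
  ∑ᶠ j : ℕ, (-1 : ℝ) ^ j • (⇑(totalD α))^[j] (pderiv (a, j) f)

/-- `g = D⁻¹ f`: the formal inverse of `D`, with integration constant zero. It is defined
exactly on the total derivatives, and `g` is uniquely determined by `f`. -/
def IsPrimitive {α : Type} (f g : DiffPoly α) : Prop :=
  totalD α g = f ∧ constantCoeff g = 0

/-! ### Nonlocal operators

Since `D⁻¹` is only partially defined, operators are given by their graphs:
`P ξ Y` means that `P` is defined at `ξ`, with value `Y`. -/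

/-- Partially defined operators on `β`-component vectors of differential polynomials. -/
abbrev PartialOp (β α : Type) : Type := (β → DiffPoly α) → (β → DiffPoly α) → Prop

/-- The composition `P ∘ Q` (first `Q`, then `P`). -/
def PartialOp.comp {β α : Type} (P Q : PartialOp β α) : PartialOp β α :=
  fun ξ Y => ∃ η, Q ξ η ∧ P η Y

/-- The inverse operator. -/
def PartialOp.inv {β α : Type} (P : PartialOp β α) : PartialOp β α :=
  fun ξ Y => P Y ξ

/-- The operator `c • P + d • Q`, on the intersection of the domains. -/
def PartialOp.linComb {β α : Type} (c d : ℝ) (P Q : PartialOp β α) : PartialOp β α :=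
  fun ξ Y => ∃ Y₁ Y₂, P ξ Y₁ ∧ Q ξ Y₂ ∧ Y = c • Y₁ + d • Y₂

/-- The operator `J = D + D⁻¹(u ·) u`. -/
def opJ {β α : Type} [Fintype β] (u : β → DiffPoly α) : PartialOp β α :=
  fun e ϖ => ∃ w, IsPrimitive (∑ i, u i * e i) w ∧ ∀ i, ϖ i = totalD α (e i) + w * u i

/-- The operator `H = D + u ⌋ D⁻¹(u ∧)`, where `(A ∧ B)_{ij} = A_i B_j - B_i A_j`
and `(A ⌋ M)_j = ∑_i A_i M_{ij}`. -/
def opH {β α : Type} [Fintype β] (u : β → DiffPoly α) : PartialOp β α :=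
  fun ϖ e => ∃ W : β → β → DiffPoly α,
    (∀ i j, IsPrimitive (u i * ϖ j - ϖ i * u j) (W i j)) ∧
      ∀ j, e j = totalD α (ϖ j) + ∑ i, u i * W i j

/-! ### Hamiltonian operators

Vector fields `Y` and covector fields `ξ` on the space of fields are pairs of
`α`-component vectors of differential polynomials, paired by `⟨ξ, Y⟩ = ∫ ξ · Y dl`. -/

/-- The density `ξ · Y`. -/
def pairing {α : Type} [Fintype α] (ξ Y : α → DiffPoly α) : DiffPoly α := ∑ a, ξ a * Y a

/-- A density of `⟨L_Y ξ, Z⟩`, where `L_Y` is the Lie derivative of covector fields: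
`⟨L_Y ξ, Z⟩ = Y(⟨ξ, Z⟩) - ⟨ξ, [Y, Z]⟩`. -/
def lieDerivPairing {α : Type} [Fintype α] (Y ξ Z : α → DiffPoly α) : DiffPoly α :=
  evolve Y (pairing ξ Z) - pairing ξ (flowBracket Y Z)

/-- `P` is a Hamiltonian operator from covector fields to vector fields: it is single-valued,
linear and skew-adjoint, and satisfies the Jacobi identity
`⟨L_{Pξ₁} ξ₂, Pξ₃⟩ + cyclic = 0` on its whole domain. For variational derivatives
`ξᵢ = δFᵢ/δv` this is the Jacobi identity of the bracket `{F, G} = ∫ δF/δv · P(δG/δv) dl`. -/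
structure IsHamiltonian {α : Type} [Fintype α] (P : PartialOp α α) : Prop where
  single_valued : ∀ ξ Y Z, P ξ Y → P ξ Z → Y = Z
  map_zero : P 0 0
  map_add : ∀ ξ₁ ξ₂ Y₁ Y₂, P ξ₁ Y₁ → P ξ₂ Y₂ → P (ξ₁ + ξ₂) (Y₁ + Y₂)
  map_smul : ∀ (c : ℝ) ξ Y, P ξ Y → P (c • ξ) (c • Y)
  skew : ∀ ξ₁ ξ₂ Y₁ Y₂, P ξ₁ Y₁ → P ξ₂ Y₂ →
    IntegralZero (pairing ξ₁ Y₂ + pairing ξ₂ Y₁)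
  jacobi : ∀ ξ₁ ξ₂ ξ₃ Y₁ Y₂ Y₃, P ξ₁ Y₁ → P ξ₂ Y₂ → P ξ₃ Y₃ →
    IntegralZero (lieDerivPairing Y₁ ξ₂ Y₃ + lieDerivPairing Y₂ ξ₃ Y₁ +
      lieDerivPairing Y₃ ξ₁ Y₂)

/-- A cosymplectic operator `H` and a symplectic operator `J` are compatible: `H` and `J⁻¹`
are Hamiltonian operators, and so are all their linear combinations. -/
def Compatible {α : Type} [Fintype α] (H J : PartialOp α α) : Prop :=
  IsHamiltonian H ∧ IsHamiltonian J.inv ∧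
    ∀ c d : ℝ, IsHamiltonian (PartialOp.linComb c d H J.inv)

/-! ### d-vectors and d-operators

The flow variables are the pair of a horizontal field with `n - 1` components and a vertical
field with `m - 1` components. -/

/-- Indices of the components of d-vectors. -/
abbrev DIdx (n m : ℕ) : Type := Fin (n - 1) ⊕ Fin (m - 1)

/-- d-vectors, with h-part on the left summand and v-part on the right summand. -/
abbrev DVec (n m : ℕ) : Type := DIdx n m → DiffPoly (DIdx n m)

variable {n m : ℕ}

/-- The h-part of a d-vector. -/
def DVec.h (Y : DVec n m) : Fin (n - 1) → DiffPoly (DIdx n m) := fun i => Y (Sum.inl i)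

/-- The v-part of a d-vector. -/
def DVec.v (Y : DVec n m) : Fin (m - 1) → DiffPoly (DIdx n m) := fun i => Y (Sum.inr i)

/-- A horizontal vector as a d-vector. -/
def ofH (Y : Fin (n - 1) → DiffPoly (DIdx n m)) : DVec n m := Sum.elim Y 0

/-- A vertical vector as a d-vector. -/
def ofV (Y : Fin (m - 1) → DiffPoly (DIdx n m)) : DVec n m := Sum.elim 0 Y

/-- The d-vector of flow variables, i.e. the horizontal field and the vertical field. -/
def flowVar (n m : ℕ) : DVec n m := fun a => X (a, 0)

/-- The horizontal operator `hH`. -/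
def hH (n m : ℕ) : PartialOp (Fin (n - 1)) (DIdx n m) := opH (flowVar n m).h

/-- The vertical operator `vH`. -/
def vH (n m : ℕ) : PartialOp (Fin (m - 1)) (DIdx n m) := opH (flowVar n m).v

/-- The horizontal operator `hJ`. -/
def hJ (n m : ℕ) : PartialOp (Fin (n - 1)) (DIdx n m) := opJ (flowVar n m).h

/-- The vertical operator `vJ`. -/
def vJ (n m : ℕ) : PartialOp (Fin (m - 1)) (DIdx n m) := opJ (flowVar n m).v

/-- The horizontal recursion operator `hH ∘ hJ`. -/
def hR (n m : ℕ) : PartialOp (Fin (n - 1)) (DIdx n m) := (hH n m).comp (hJ n m)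

/-- The vertical recursion operator `vH ∘ vJ`. -/
def vR (n m : ℕ) : PartialOp (Fin (m - 1)) (DIdx n m) := (vH n m).comp (vJ n m)

/-- The d-operator `(P, Q)` with h-component `P` and v-component `Q`. -/
def dOp (P : PartialOp (Fin (n - 1)) (DIdx n m)) (Q : PartialOp (Fin (m - 1)) (DIdx n m)) :
    PartialOp (DIdx n m) (DIdx n m) :=
  fun ξ Y => P (DVec.h ξ) (DVec.h Y) ∧ Q (DVec.v ξ) (DVec.v Y)

/-- The d-operator `H = (hH, vH)`. -/
def dH (n m : ℕ) : PartialOp (DIdx n m) (DIdx n m) := dOp (hH n m) (vH n m)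

/-- The d-operator `J = (hJ, vJ)`. -/
def dJ (n m : ℕ) : PartialOp (DIdx n m) (DIdx n m) := dOp (hJ n m) (vJ n m)

/-- The recursion d-operator `(hR, vR)`. -/
def dR (n m : ℕ) : PartialOp (DIdx n m) (DIdx n m) := dOp (hR n m) (vR n m)

/-- An operator on d-vectors is N-adapted if it commutes with the projections of d-vectors to
their h-parts and to their v-parts. -/
def NAdapted (P : PartialOp (DIdx n m) (DIdx n m)) : Prop :=
  ∀ ξ Y : DVec n m, P ξ Y →
    P (ofH (DVec.h ξ)) (ofH (DVec.h Y)) ∧ P (ofV (DVec.v ξ)) (ofV (DVec.v Y))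

/-- Differential polynomials in the horizontal field only. -/
def hPoly (n m : ℕ) : Subalgebra ℝ (DiffPoly (DIdx n m)) := supported ℝ {p | p.1.isLeft}

/-- Differential polynomials in the vertical field only. -/
def vPoly (n m : ℕ) : Subalgebra ℝ (DiffPoly (DIdx n m)) := supported ℝ {p | p.1.isRight}

/-- The horizontal variational derivative. -/
def varDerivH (f : DiffPoly (DIdx n m)) : Fin (n - 1) → DiffPoly (DIdx n m) :=
  fun i => varDeriv f (Sum.inl i)

/-- The vertical variational derivative. -/
def varDerivV (f : DiffPoly (DIdx n m)) : Fin (m - 1) → DiffPoly (DIdx n m) :=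
  fun i => varDeriv f (Sum.inr i)

/-- The effect on differential polynomials of the substitution `v ↦ A v` of the field. -/
def substLinear {α : Type} [Fintype α] (A : Matrix α α ℝ) : DiffPoly α →ₐ[ℝ] DiffPoly α :=
  aeval fun p => ∑ b, A p.1 b • X (b, p.2)

/-- The evolution equation `v_τ = Y` for the d-vector `v` of flow variables is invariant under
`O(n-1)` acting on the horizontal field and `O(m-1)` acting on the vertical field:
`Y[A v] = A (Y[v])` for `A = diag(A₁, A₂)` with orthogonal `A₁`, `A₂`. -/
def OrthogonallyInvariant (Y : DVec n m) : Prop :=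
  ∀ A₁ ∈ Matrix.orthogonalGroup (Fin (n - 1)) ℝ,
    ∀ A₂ ∈ Matrix.orthogonalGroup (Fin (m - 1)) ℝ,
      ∀ a, substLinear (Matrix.fromBlocks A₁ 0 0 A₂) (Y a) =
        ∑ b, Matrix.fromBlocks A₁ 0 0 A₂ a b • Y b

/-- The right-hand side `e^{(k+1)} - R e^{(k)}` of the horizontal evolution equation. -/
def hFlow (e : ℕ → DVec n m) (R : ℝ) (k : ℕ) : Fin (n - 1) → DiffPoly (DIdx n m) :=
  (e (k + 1)).h - R • (e k).h

/-- The right-hand side `e^{(k+1)} - S e^{(k)}` of the vertical evolution equation. -/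
def vFlow (e : ℕ → DVec n m) (S : ℝ) (k : ℕ) : Fin (m - 1) → DiffPoly (DIdx n m) :=
  (e (k + 1)).v - S • (e k).v

/-- The Hamiltonian `F^{(k,R)} = F^{(k+1)} - R F^{(k)}`. -/
def shiftedHam (F : ℕ → DiffPoly (DIdx n m)) (R : ℝ) (k : ℕ) : DiffPoly (DIdx n m) :=
  F (k + 1) - R • F k

end

/-! ### The calculus of differential polynomials -/

section Calculus

variable {α : Type}

/-! The operators are block diagonal and each hierarchy lives on one block, so everything is proved
for a single field `u` with the same formulas and then carried to d-vectors by inclusion of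
polynomial algebras.

Hamiltonian property. The nonlocal terms are kept as explicit data: `HGraph` carries a skew matrix
`W` with `D W = u ∧ ξ`, `JGraph` a scalar `w` with `D w = u · e`. Along a derivation commuting with
`D`, skew-adjointness moves the variation from one covector to another and leaves only terms
trilinear in the graph data (`HGraph.variation`, `JGraph.variation`). In the cyclic sum the terms of
`J` cancel in pairs; those of `H` form a total derivative by `HGraph.cyclic`; the mixed terms do so
by `HGraph.compatible`. These identities also settle linear combinations and `H ∘ J ∘ H`. The
inverse of `J` is single-valued because `w² + |e|²` is conserved on the kernel of `J` and real
polynomials with constant sum of squares are constant (`opJ.injective`).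

The hierarchy. The difficulty is that every `D⁻¹` must meet a total derivative. The recursion is
therefore summed into power series `e`, `ϖ`, `q` in a parameter `X`, and the integrations are
replaced by algebra: the potential of `u ∧ ϖ` is required to be `-X` times the decomposable bivector
`V = κ (e ∧ ϖ)`, where `κ` inverts `1 + X q`, and `q` is fixed by a norm condition. The resulting
equations contain no integration and are solved by contraction (`exists_isResolvent`).
Differentiating the norm condition gives `D q = u · e`, whence `D(-X V) = u ∧ ϖ`: the coefficients
are local solutions of the recursion.

Commutation. Consecutive flows `δ`, `δ'` of the hierarchy, combined as `δ - X δ'` and suitably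
corrected, send the resolvent to a solution of the same linear system (`LinearSystem.of_flow`). Its
scalar and bivector parts have no constant terms, so its vector part vanishes. Comparing
coefficients moves an index from one flow to the other in a commutator, down to the translation
flow.

Gradients. The resolvent is a rank-two bivector of constant norm in a space with two extra
dimensions, moving by infinitesimal isometries that are affine in `u`. The form `tr (M [P, Q])` on
its variations has as derivative the skew part of the Fréchet derivative of `ϖ`
(`exists_derivation_eq_trace`). So `ϖ` is closed, and the homotopy formula for dilations makes it a
variational derivative. Orthogonal invariance follows from equivariance and single-valuedness of the
two operators. -/

@[simp] theorem totalD_X (p : α × ℕ) : totalD α (X p) = X (p.1, p.2 + 1) := by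
  simp [totalD]

theorem iterate_totalD_X (a : α) (j : ℕ) : (⇑(totalD α))^[j] (X (a, 0)) = X (a, j) := by
  induction j with
  | zero => rfl
  | succ j ih => rw [Function.iterate_succ_apply', ih, totalD_X]

@[simp] theorem evolve_X (Q : α → DiffPoly α) (p : α × ℕ) :
    evolve Q (X p) = (⇑(totalD α))^[p.2] (Q p.1) := by
  simp [evolve]

/-- A derivation commutes with another one as soon as it does so on the variables. -/
theorem derivation_comm_of_X {σ : Type*}
    (d₁ d₂ d₃ : Derivation ℝ (MvPolynomial σ ℝ) (MvPolynomial σ ℝ))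
    (h : ∀ i, d₁ (d₂ (X i)) - d₂ (d₁ (X i)) = d₃ (X i)) (f : MvPolynomial σ ℝ) :
    d₁ (d₂ f) - d₂ (d₁ f) = d₃ f := by
  have : ⁅d₁, d₂⁆ = d₃ := derivation_ext fun i => by
    rw [Derivation.commutator_apply]; exact h i
  rw [← this, Derivation.commutator_apply]

theorem evolve_totalD (Q : α → DiffPoly α) (f : DiffPoly α) :
    evolve Q (totalD α f) = totalD α (evolve Q f) := by
  have := derivation_comm_of_X (evolve Q) (totalD α) 0 (fun p => by
    simp [Function.iterate_succ_apply']) f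
  simpa [sub_eq_zero] using this

theorem evolve_iterate_totalD (Q : α → DiffPoly α) (j : ℕ) (f : DiffPoly α) :
    evolve Q ((⇑(totalD α))^[j] f) = (⇑(totalD α))^[j] (evolve Q f) := by
  induction j with
  | zero => rfl
  | succ j ih => rw [Function.iterate_succ_apply', Function.iterate_succ_apply', evolve_totalD, ih]

theorem evolve_comm (Y Z : α → DiffPoly α) (f : DiffPoly α) :
    evolve Y (evolve Z f) - evolve Z (evolve Y f) = evolve (flowBracket Y Z) f :=
  derivation_comm_of_X (evolve Y) (evolve Z) (evolve (flowBracket Y Z)) (fun p => by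
    simp [evolve_iterate_totalD, flowBracket]) f

theorem evolve_totalD_X (f : DiffPoly α) :
    evolve (fun a => totalD α (X (a, 0))) f = totalD α f := by
  have : evolve (fun a => totalD α (X (a, 0))) = totalD α := derivation_ext fun p => by
    rw [evolve_X, ← Function.iterate_succ_apply, iterate_totalD_X, totalD_X]
  rw [this]

theorem evolve_add (Y Z : α → DiffPoly α) (f : DiffPoly α) :
    evolve (Y + Z) f = evolve Y f + evolve Z f := by
  have : evolve (Y + Z) = evolve Y + evolve Z := derivation_ext fun p => by
    simp [iterate_map_add]
  rw [this, Derivation.add_apply]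

theorem evolve_smul (c : ℝ) (Y : α → DiffPoly α) (f : DiffPoly α) :
    evolve (c • Y) f = c • evolve Y f := by
  have : evolve (c • Y) = c • evolve Y := derivation_ext fun p => by
    rw [Derivation.smul_apply, evolve_X, evolve_X, Pi.smul_apply]
    induction p.2 with
    | zero => rfl
    | succ j ih =>
      rw [Function.iterate_succ_apply', Function.iterate_succ_apply', ih, Derivation.map_smul]
  rw [this, Derivation.smul_apply]

theorem evolve_sub (Y Z : α → DiffPoly α) (f : DiffPoly α) :
    evolve (Y - Z) f = evolve Y f - evolve Z f := by
  have := evolve_add (Y - Z) Z f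
  rw [sub_add_cancel] at this
  rw [this, add_sub_cancel_right]

theorem evolve_zero (f : DiffPoly α) : evolve (0 : α → DiffPoly α) f = 0 := by
  simpa using evolve_smul 0 (0 : α → DiffPoly α) f

/-- A derivation of polynomials whose values on the variables have no constant term
produces no constant term. -/
theorem constantCoeff_derivation {σ : Type*}
    (d : Derivation ℝ (MvPolynomial σ ℝ) (MvPolynomial σ ℝ))
    (h : ∀ i, constantCoeff (d (X i)) = 0) (f : MvPolynomial σ ℝ) : constantCoeff (d f) = 0 := by
  induction f using MvPolynomial.induction_on with
  | C a => simp
  | add p q hp hq => simp [hp, hq]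
  | mul_X p i hp => simp [hp, h]

@[simp] theorem constantCoeff_totalD (f : DiffPoly α) : constantCoeff (totalD α f) = 0 :=
  constantCoeff_derivation _ (fun p => by simp) f

theorem constantCoeff_evolve {Y : α → DiffPoly α} (hY : ∀ a, constantCoeff (Y a) = 0)
    (f : DiffPoly α) : constantCoeff (evolve Y f) = 0 :=
  constantCoeff_derivation _ (fun p => by
    rw [evolve_X]
    cases p.2 with
    | zero => exact hY _
    | succ j => rw [Function.iterate_succ_apply', constantCoeff_totalD]) f

/-- The commutator of `∂/∂v_{a,j+1}` with `D` is `∂/∂v_{a,j}`. All bounds on the order of a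
primitive come from this. -/
theorem pderiv_totalD_succ (a : α) (j : ℕ) (f : DiffPoly α) :
    pderiv (a, j + 1) (totalD α f) = pderiv (a, j) f + totalD α (pderiv (a, j + 1) f) := by
  classical
  have := derivation_comm_of_X (pderiv (a, j + 1)) (totalD α) (pderiv (a, j)) (fun p => by
    simp only [totalD_X, pderiv_X, Pi.single_apply, Prod.ext_iff, add_left_inj]
    split_ifs <;> simp) f
  linear_combination this

/-- A differential polynomial has finite order. -/
theorem exists_order (f : DiffPoly α) : ∃ N, ∀ p ∈ f.vars, p.2 < N := by
  refine ⟨f.vars.sup (fun p => p.2) + 1, fun p hp => Nat.lt_succ_of_le ?_⟩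
  exact Finset.le_sup (f := fun p : α × ℕ => p.2) hp

theorem pderiv_eq_zero_of_order {f : DiffPoly α} {N : ℕ} (h : ∀ p ∈ f.vars, p.2 < N) (a : α)
    {j : ℕ} (hj : N ≤ j) : pderiv (a, j) f = 0 :=
  pderiv_eq_zero_of_notMem_vars fun hp => absurd (h _ hp) (not_lt.mpr hj)

/-- The order of `f` is smaller than that of `D f`. -/
theorem pderiv_eq_zero_of_pderiv_totalD {f : DiffPoly α} (a : α) (N : ℕ)
    (h : ∀ j, N ≤ j → pderiv (a, j + 1) (totalD α f) = 0) {j : ℕ} (hj : N ≤ j) :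
    pderiv (a, j) f = 0 := by
  obtain ⟨M, hM⟩ := exists_order f
  have key : ∀ i j, N ≤ j → M ≤ j + i → pderiv (a, j) f = 0 := by
    intro i
    induction i with
    | zero => exact fun j _ hMj => pderiv_eq_zero_of_order hM a hMj
    | succ i ih =>
      intro j hj hMj
      have h1 := h j hj
      rw [pderiv_totalD_succ, ih (j + 1) (by omega) (by omega), map_zero, add_zero] at h1
      exact h1
  exact key M j hj (by omega)

theorem eq_C_of_pderiv_eq_zero {σ : Type*} {f : MvPolynomial σ ℝ} (h : ∀ i, pderiv i f = 0) :
    f = C (constantCoeff f) := by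
  classical
  ext s
  rw [coeff_C]
  split_ifs with hs
  · rw [← hs]; rfl
  · obtain ⟨i, hi⟩ : ∃ i, s i ≠ 0 := by
      by_contra! hc
      exact hs (Finsupp.ext fun i => (hc i).symm)
    have h1 := coeff_pderiv f (s - Finsupp.single i 1) (i := i)
    rw [h i, coeff_zero, tsub_add_cancel_of_le (by
      simpa [Finsupp.single_le_iff] using Nat.one_le_iff_ne_zero.mpr hi)] at h1
    have h2 : ((s - Finsupp.single i 1 : σ →₀ ℕ) i : ℝ) + 1 ≠ 0 := by positivity
    exact (mul_eq_zero.mp h1.symm).resolve_right h2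

/-- A polynomial that genuinely contains a highest derivative acquires a higher one under `D`. So
primitives are unique once their constant term is fixed. -/
theorem eq_C_of_totalD_eq_zero {f : DiffPoly α} (h : totalD α f = 0) :
    f = C (constantCoeff f) :=
  eq_C_of_pderiv_eq_zero fun p =>
    pderiv_eq_zero_of_pderiv_totalD p.1 0 (fun j _ => by rw [h, map_zero]) (Nat.zero_le p.2)

theorem eq_zero_of_totalD_eq_zero {f : DiffPoly α} (h : totalD α f = 0)
    (h0 : constantCoeff f = 0) : f = 0 := by
  rw [eq_C_of_totalD_eq_zero h, h0, C_0]

theorem IsPrimitive.unique {f g g' : DiffPoly α} (h : IsPrimitive f g) (h' : IsPrimitive f g') :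
    g = g' :=
  sub_eq_zero.mp (eq_zero_of_totalD_eq_zero (by rw [map_sub, h.1, h'.1, sub_self])
    (by rw [map_sub, h.2, h'.2, sub_self]))

theorem IsPrimitive.add {f f' g g' : DiffPoly α} (h : IsPrimitive f g) (h' : IsPrimitive f' g') :
    IsPrimitive (f + f') (g + g') :=
  ⟨by rw [map_add, h.1, h'.1], by rw [map_add, h.2, h'.2, add_zero]⟩

theorem IsPrimitive.smul {f g : DiffPoly α} (c : ℝ) (h : IsPrimitive f g) :
    IsPrimitive (c • f) (c • g) :=
  ⟨by rw [Derivation.map_smul, h.1], by rw [constantCoeff_smul, h.2, smul_zero]⟩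

theorem IsPrimitive.zero : IsPrimitive (0 : DiffPoly α) 0 := ⟨map_zero _, map_zero _⟩

theorem IsPrimitive.neg {f g : DiffPoly α} (h : IsPrimitive f g) : IsPrimitive (-f) (-g) :=
  ⟨by rw [map_neg, h.1], by rw [map_neg, h.2, neg_zero]⟩

theorem IntegralZero.add {f g : DiffPoly α} (hf : IntegralZero f) (hg : IntegralZero g) :
    IntegralZero (f + g) := by
  obtain ⟨a, rfl⟩ := hf
  obtain ⟨b, rfl⟩ := hg
  exact ⟨a + b, map_add _ _ _⟩

theorem integralZero_sum {ι : Type*} (s : Finset ι) {f : ι → DiffPoly α}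
    (h : ∀ i ∈ s, IntegralZero (f i)) : IntegralZero (∑ i ∈ s, f i) := by
  choose! g hg using h
  exact ⟨∑ i ∈ s, g i, by rw [map_sum]; exact Finset.sum_congr rfl hg⟩

theorem IntegralZero.evolve {f : DiffPoly α} (hf : IntegralZero f) (Y : α → DiffPoly α) :
    IntegralZero (evolve Y f) := by
  obtain ⟨a, rfl⟩ := hf
  exact ⟨_root_.evolve Y a, (evolve_totalD Y a).symm⟩

/-- The pairing of functions modulo total derivatives is nondegenerate. -/
theorem eq_zero_of_forall_integralZero [Nonempty α] {g : DiffPoly α}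
    (h : ∀ f, IntegralZero (f * g)) : g = 0 := by
  obtain ⟨a⟩ := ‹Nonempty α›
  obtain ⟨N, hN⟩ := exists_order g
  have hg : ∀ j, N ≤ j → pderiv (a, j) g = 0 := fun j hj => pderiv_eq_zero_of_order hN a hj
  -- With `g` free of `v_{a,j}` for `j ≥ N`, a primitive `F` of `v_{a,N+1}² g` is free of `v_{a,j}`
  -- for `j ≥ N + 1`, and its derivative in `v_{a,N}` is `2 v_{a,N+1} g`. Differentiating once more
  -- in `v_{a,N+1}` gives both `2 g` and zero.
  obtain ⟨F, hF⟩ := h (X (a, N + 1) ^ 2)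
  have h1 : ∀ j, N + 1 ≤ j → pderiv (a, j) F = 0 := fun j hj =>
    pderiv_eq_zero_of_pderiv_totalD a (N + 1) (fun j hj => by
      rw [hF, pderiv_mul, hg _ (by omega), pderiv_pow, pderiv_X_of_ne (by simp; omega)]
      simp) hj
  have h2 : pderiv (a, N) F = 2 * X (a, N + 1) * g := by
    have := pderiv_totalD_succ a N F
    rw [h1 _ le_rfl, map_zero, add_zero, hF, pderiv_mul, hg _ (by omega), pderiv_pow,
      pderiv_X_self] at this
    rw [← this]; push_cast; ring
  have h3 : pderiv (a, N + 1) (pderiv (a, N) F) = 2 * g := by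
    rw [h2, pderiv_mul, hg _ (by omega), pderiv_mul, pderiv_X_self]
    have : pderiv (a, N + 1) (2 : DiffPoly α) = 0 := pderiv_C (a := (2 : ℝ))
    rw [this]; ring
  have h4 : pderiv (a, N + 1) (pderiv (a, N) F) = 0 := by
    have : ⁅pderiv (R := ℝ) (a, N + 1), pderiv (a, N)⁆ = 0 := derivation_ext fun p => by
      classical
      rw [Derivation.commutator_apply]
      simp only [pderiv_X, Pi.single_apply, apply_ite, map_zero, Derivation.map_one_eq_zero]
      simp
    have h5 := congrArg (fun d => d F) this
    rw [Derivation.commutator_apply, h1 _ le_rfl, map_zero] at h5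
    simpa using h5
  rw [h3] at h4
  exact (mul_eq_zero.mp h4).resolve_left two_ne_zero

/-- Integration by parts. -/
theorem integralZero_iterate_totalD_mul (j : ℕ) (f g : DiffPoly α) :
    IntegralZero ((⇑(totalD α))^[j] f * g - f * ((-1 : ℝ) ^ j • (⇑(totalD α))^[j] g)) := by
  induction j generalizing g with
  | zero => exact ⟨0, by simp⟩
  | succ j ih =>
    obtain ⟨F, hF⟩ := ih (totalD α g)
    refine ⟨(⇑(totalD α))^[j] f * g - F, ?_⟩
    rw [map_sub, hF, Derivation.leibniz, Function.iterate_succ_apply', pow_succ]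
    rw [← Function.iterate_succ_apply (⇑(totalD α)) j g]
    simp only [smul_eq_mul, mul_neg, mul_one, neg_smul]
    ring

theorem varDeriv_eq_sum {f : DiffPoly α} {N : ℕ} (h : ∀ p ∈ f.vars, p.2 < N) (a : α) :
    varDeriv f a =
      ∑ j ∈ Finset.range N, (-1 : ℝ) ^ j • (⇑(totalD α))^[j] (pderiv (a, j) f) := by
  refine finsum_eq_finsetSum_of_support_subset _ fun j hj => ?_
  by_contra hc
  refine hj ?_
  simp only [Finset.coe_range, Set.mem_Iio, not_lt] at hc
  simp only [pderiv_eq_zero_of_order h a hc, iterate_map_zero, smul_zero]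

theorem derivation_sum_apply {σ ι : Type*} (s : Finset ι)
    (d : ι → Derivation ℝ (MvPolynomial σ ℝ) (MvPolynomial σ ℝ)) (f : MvPolynomial σ ℝ) :
    (∑ i ∈ s, d i) f = ∑ i ∈ s, d i f := by
  classical
  induction s using Finset.induction_on with
  | empty => simp
  | insert a s ha ih => rw [Finset.sum_insert ha, Finset.sum_insert ha, Derivation.add_apply, ih]

theorem evolve_eq_sum [Fintype α] {f : DiffPoly α} {N : ℕ} (h : ∀ p ∈ f.vars, p.2 < N)
    (Y : α → DiffPoly α) :
    evolve Y f = ∑ a, ∑ j ∈ Finset.range N, (⇑(totalD α))^[j] (Y a) * pderiv (a, j) f := by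
  classical
  have : evolve Y f = (∑ a, ∑ j ∈ Finset.range N,
      (⇑(totalD α))^[j] (Y a) • pderiv (R := ℝ) (a, j)) f := by
    refine derivation_eq_of_forall_mem_vars fun p hp => ?_
    have hp' := h p hp
    simp only [evolve_X, derivation_sum_apply, Derivation.smul_apply, pderiv_X, smul_eq_mul]
    rw [Finset.sum_eq_single p.1, Finset.sum_eq_single p.2]
    · simp
    · intro j _ hj
      rw [Pi.single_eq_of_ne (by intro hc; exact hj (congrArg Prod.snd hc).symm), mul_zero]
    · intro hj; simp [hp'] at hj
    · intro b _ hb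
      refine Finset.sum_eq_zero fun j _ => ?_
      rw [Pi.single_eq_of_ne (by intro hc; exact hb (congrArg Prod.fst hc).symm), mul_zero]
    · simp
  rw [this]
  simp [derivation_sum_apply]

/-- The first variation formula. -/
theorem integralZero_evolve_sub_pairing [Fintype α] (f : DiffPoly α) (Y : α → DiffPoly α) :
    IntegralZero (evolve Y f - pairing Y (varDeriv f)) := by
  obtain ⟨N, hN⟩ := exists_order f
  rw [evolve_eq_sum hN, pairing]
  simp only [varDeriv_eq_sum hN, Finset.mul_sum, ← Finset.sum_sub_distrib]
  exact integralZero_sum _ fun a _ => integralZero_sum _ fun j _ =>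
    integralZero_iterate_totalD_mul j _ _

/-- The variational derivative is determined by the first variation formula. -/
theorem eq_zero_of_pairing_integralZero [Fintype α] {g : α → DiffPoly α}
    (h : ∀ Y, IntegralZero (pairing Y g)) : g = 0 := by
  classical
  funext a
  have : Nonempty α := ⟨a⟩
  refine eq_zero_of_forall_integralZero fun f => ?_
  have := h (Pi.single a f)
  rwa [pairing, Finset.sum_eq_single a (by
    intro b _ hb; rw [Pi.single_eq_of_ne hb, zero_mul]) (by simp), Pi.single_eq_same] at this

/-- The flow of dilations of the field. -/
noncomputable abbrev dilation (α : Type) : α → DiffPoly α := fun a => X (a, 0)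

/-- Euler's identity: dilations act on differential polynomials as the degree operator. -/
theorem evolve_dilation_monomial (s : α × ℕ →₀ ℕ) (c : ℝ) :
    evolve (dilation α) (monomial s c) = (s.degree : ℝ) • monomial s c := by
  have hX : evolve (dilation α) = mkDerivation ℝ X := derivation_ext fun p => by
    rw [evolve_X, iterate_totalD_X, mkDerivation_X]
  rw [hX, mkDerivation_monomial, Finsupp.sum, Finsupp.degree_apply, Nat.cast_sum, Finset.sum_smul,
    Finset.smul_sum]
  refine Finset.sum_congr rfl fun i hi => ?_
  rw [smul_eq_mul, X, monomial_mul, tsub_add_cancel_of_le, mul_one, smul_monomial, smul_monomial,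
    smul_eq_mul, smul_eq_mul, mul_comm]
  simpa [Finsupp.single_le_iff] using Nat.one_le_iff_ne_zero.mpr (by simpa using hi)

theorem coeff_evolve_dilation (s : α × ℕ →₀ ℕ) (f : DiffPoly α) :
    coeff s (evolve (dilation α) f) = s.degree * coeff s f := by
  classical
  induction f using MvPolynomial.induction_on' with
  | monomial t c =>
    rw [evolve_dilation_monomial, coeff_smul, coeff_monomial, smul_eq_mul]
    split_ifs with h
    · rw [h]
    · simp
  | add p q hp hq => rw [map_add, coeff_add, hp, hq, coeff_add, mul_add]

theorem eq_zero_of_evolve_dilation_add {f : DiffPoly α} (h : evolve (dilation α) f + f = 0) :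
    f = 0 := by
  ext s
  have := congrArg (coeff s) h
  rw [coeff_add, coeff_evolve_dilation, coeff_zero] at this
  have h2 : (s.degree : ℝ) + 1 ≠ 0 := by positivity
  have h3 : ((s.degree : ℝ) + 1) * coeff s f = 0 := by linarith
  simpa using (mul_eq_zero.mp h3).resolve_left h2

/-- Each monomial is divided by its degree; only degree zero obstructs. -/
theorem exists_evolve_dilation_eq {f : DiffPoly α} (h : constantCoeff f = 0) :
    ∃ g, evolve (dilation α) g = f := by
  refine ⟨∑ s ∈ f.support, monomial s ((s.degree : ℝ)⁻¹ * coeff s f), ?_⟩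
  rw [map_sum]
  conv_rhs => rw [f.as_sum]
  refine Finset.sum_congr rfl fun s hs => ?_
  rw [evolve_dilation_monomial, smul_monomial, smul_eq_mul, ← mul_assoc, mul_inv_cancel₀, one_mul]
  intro hc
  have hs0 : s = 0 := by
    rw [Nat.cast_eq_zero] at hc
    exact (Finsupp.degree_eq_zero_iff s).mp hc
  rw [mem_support_iff, hs0] at hs
  exact hs h

theorem evolve_pairing [Fintype α] (Y ξ Z : α → DiffPoly α) :
    evolve Y (pairing ξ Z) = pairing (fun a => evolve Y (ξ a)) Z +
      pairing ξ (fun a => evolve Y (Z a)) := by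
  simp only [pairing, map_sum, Derivation.leibniz, smul_eq_mul, ← Finset.sum_add_distrib]
  exact Finset.sum_congr rfl fun a _ => by ring

/-- A covector field with self-adjoint Fréchet derivative is a variational derivative: the
homotopy formula. -/
theorem varDeriv_eq_of_closed [Fintype α] {ξ : α → DiffPoly α}
    (hξ : ∀ Y Z : α → DiffPoly α, IntegralZero
      (pairing Y (fun a => evolve Z (ξ a)) - pairing Z (fun a => evolve Y (ξ a))))
    {F : DiffPoly α} (hF : evolve (dilation α) F = pairing (dilation α) ξ) :
    varDeriv F = ξ := by
  have hd : ∀ Y : α → DiffPoly α, (fun a => evolve Y (dilation α a)) = Y := fun Y => by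
    funext a; rw [evolve_X]; rfl
  -- The degree operator plus one kills the difference of the two covectors. Tested against `Y`,
  -- this combines the first variation along `Y` differentiated along the dilation, the first
  -- variation along their commutator, and closedness for that pair of fields.
  have key : (fun a => evolve (dilation α) ((varDeriv F - ξ) a) + (varDeriv F - ξ) a) = 0 := by
    refine eq_zero_of_pairing_integralZero fun Y => ?_
    have h1 := (integralZero_evolve_sub_pairing F Y).evolve (dilation α)
    have h2 := integralZero_evolve_sub_pairing F (flowBracket Y (dilation α))
    have h3 := evolve_comm Y (dilation α) F
    have h4 : pairing (flowBracket Y (dilation α)) (varDeriv F) =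
        pairing Y (varDeriv F) - pairing (fun a => evolve (dilation α) (Y a)) (varDeriv F) := by
      simp only [pairing, ← Finset.sum_sub_distrib]
      refine Finset.sum_congr rfl fun a _ => ?_
      rw [flowBracket, congrFun (hd Y) a, sub_mul]
    have h5 := hξ Y (dilation α)
    rw [map_sub, evolve_pairing] at h1
    rw [hF, evolve_pairing, hd] at h3
    have h6 : pairing Y (fun a => evolve (dilation α) ((varDeriv F - ξ) a) + (varDeriv F - ξ) a) =
        pairing Y (fun a => evolve (dilation α) (varDeriv F a)) -
        pairing Y (fun a => evolve (dilation α) (ξ a)) + (pairing Y (varDeriv F) - pairing Y ξ) := by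
      simp only [pairing, ← Finset.sum_sub_distrib, ← Finset.sum_add_distrib, Pi.sub_apply, map_sub]
      exact Finset.sum_congr rfl fun a _ => by ring
    rw [h6]
    rw [h4, ← h3] at h2
    have h7 := ((h1.add h2).add h5)
    obtain ⟨G, hG⟩ := h7
    exact ⟨-G, by rw [map_neg, hG]; ring⟩
  refine sub_eq_zero.mp (funext fun a => eq_zero_of_evolve_dilation_add (congrFun key a))

end Calculus

/-! ### Graphs of the operators over a differential ring -/

section DifferentialRing

set_option linter.unusedSectionVars false

open Matrix

variable {β A : Type*} [Fintype β] [CommRing A] [Algebra ℝ A]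

/-- A derivation applied to the components of a vector. -/
abbrev Derivation.vec (D : Derivation ℝ A A) (x : β → A) : β → A := fun i => D (x i)

/-- The matrix `(a ∧ b)_{ij} = a_i b_j - b_i a_j`. -/
abbrev wedge (a b : β → A) : Matrix β β A := vecMulVec a b - vecMulVec b a

/-- The bilinear form `∑ x_i W_{ij} y_j`. -/
def bil (W : Matrix β β A) (x y : β → A) : A := x ⬝ᵥ (W *ᵥ y)

/-- `y = D ξ + u ⌋ W` with `W = D⁻¹(u ∧ ξ)`. -/
structure HGraph (D : Derivation ℝ A A) (u ξ : β → A) (W : Matrix β β A) (y : β → A) : Prop where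
  deriv : W.map D = wedge u ξ
  skew : Wᵀ = -W
  eq : y = D.vec ξ + u ᵥ* W

/-- `ξ = D e + w u` with `w = D⁻¹(u · e)`. -/
structure JGraph (D : Derivation ℝ A A) (u e : β → A) (w : A) (ξ : β → A) : Prop where
  deriv : D w = u ⬝ᵥ e
  eq : ξ = D.vec e + w • u

theorem bil_add_left (W : Matrix β β A) (x x' y : β → A) :
    bil W (x + x') y = bil W x y + bil W x' y := add_dotProduct _ _ _

theorem bil_add_right (W : Matrix β β A) (x y y' : β → A) :
    bil W x (y + y') = bil W x y + bil W x y' := by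
  simp [bil, mulVec_add, dotProduct_add]

theorem bil_smul_left (W : Matrix β β A) (c : A) (x y : β → A) :
    bil W (c • x) y = c * bil W x y := smul_dotProduct _ _ _

theorem bil_smul_right (W : Matrix β β A) (c : A) (x y : β → A) :
    bil W x (c • y) = c * bil W x y := by
  simp [bil, mulVec_smul, dotProduct_smul]

theorem bil_wedge (a b x y : β → A) :
    bil (wedge a b) x y = (x ⬝ᵥ a) * (b ⬝ᵥ y) - (x ⬝ᵥ b) * (a ⬝ᵥ y) := by
  simp [bil, wedge, sub_mulVec, dotProduct_sub, vecMulVec_mulVec, mul_comm]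

theorem bil_transpose (W : Matrix β β A) (x y : β → A) : bil Wᵀ x y = bil W y x := by
  rw [bil, mulVec_transpose, dotProduct_comm, ← dotProduct_mulVec, bil]

theorem bil_skew {W : Matrix β β A} (h : Wᵀ = -W) (x y : β → A) : bil W x y = -bil W y x := by
  rw [← bil_transpose, h]
  simp [bil, neg_mulVec]

theorem bil_vecMul_left (W V : Matrix β β A) (x y : β → A) :
    bil W (x ᵥ* V) y = bil (V * W) x y := by
  rw [bil, ← dotProduct_mulVec, mulVec_mulVec, bil]

theorem bil_mul_skew {W V : Matrix β β A} (hW : Wᵀ = -W) (hV : Vᵀ = -V) (x y : β → A) :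
    bil (W * V) x y = bil (V * W) y x := by
  rw [← bil_transpose, transpose_mul, hW, hV, neg_mul_neg]

theorem vecMul_dotProduct (W : Matrix β β A) (x y : β → A) : (x ᵥ* W) ⬝ᵥ y = bil W x y := by
  rw [bil, dotProduct_mulVec]

theorem trace_wedge_mul (a b : β → A) (M : Matrix β β A) :
    trace (wedge a b * M) = bil M b a - bil M a b := by
  rw [wedge, sub_mul, trace_sub, vecMulVec_mul, vecMulVec_mul, trace_vecMulVec, trace_vecMulVec,
    dotProduct_comm, vecMul_dotProduct, dotProduct_comm, vecMul_dotProduct]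

theorem trace_mul_skew {W : Matrix β β A} (hW : Wᵀ = -W) (a b : β → A) :
    trace (wedge a b * W) = 2 * bil W b a := by
  rw [trace_wedge_mul, bil_skew hW a b]; ring

variable (D : Derivation ℝ A A)

theorem Derivation.dotProduct (x y : β → A) :
    D (x ⬝ᵥ y) = D.vec x ⬝ᵥ y + x ⬝ᵥ D.vec y := by
  simp only [_root_.dotProduct, map_sum, Derivation.leibniz, smul_eq_mul,
    ← Finset.sum_add_distrib]
  exact Finset.sum_congr rfl fun i _ => by ring

theorem Derivation.vec_mulVec (W : Matrix β β A) (x : β → A) :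
    D.vec (W *ᵥ x) = W.map D *ᵥ x + W *ᵥ D.vec x := by
  funext i
  exact D.dotProduct (W i) x

theorem Derivation.vec_vecMul (W : Matrix β β A) (x : β → A) :
    D.vec (x ᵥ* W) = D.vec x ᵥ* W + x ᵥ* W.map D := by
  funext i
  exact D.dotProduct x fun j => W j i

theorem Derivation.vec_add (x y : β → A) : D.vec (x + y) = D.vec x + D.vec y :=
  funext fun _ => map_add _ _ _

theorem Derivation.vec_smul (c : A) (x : β → A) : D.vec (c • x) = D c • x + c • D.vec x := by
  funext i
  simp only [Derivation.vec, Pi.smul_apply, Pi.add_apply, smul_eq_mul, Derivation.leibniz]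
  ring

theorem Derivation.bil (W : Matrix β β A) (x y : β → A) :
    D (bil W x y) = _root_.bil W (D.vec x) y + _root_.bil (W.map D) x y +
      _root_.bil W x (D.vec y) := by
  rw [_root_.bil, D.dotProduct, D.vec_mulVec, dotProduct_add, add_assoc]; rfl

theorem Derivation.map_matrix_mul (M N : Matrix β β A) :
    (M * N).map D = M.map D * N + M * N.map D := by
  ext i j
  exact D.dotProduct (M i) fun k => N k j

theorem Derivation.trace (M : Matrix β β A) : D (trace M) = Matrix.trace (M.map D) := by
  simp [Matrix.trace]

theorem Derivation.map_wedge (x y : β → A) :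
    (wedge x y).map D = wedge (D.vec x) y + wedge x (D.vec y) := by
  ext i j
  simp [vecMulVec_apply]
  ring

theorem Derivation.map_comm {δ : Derivation ℝ A A} (hδ : ∀ f, δ (D f) = D (δ f))
    (M : Matrix β β A) : (M.map δ).map D = (M.map D).map δ := by
  ext i j
  exact (hδ _).symm

theorem Derivation.vec_comm {δ : Derivation ℝ A A} (hδ : ∀ f, δ (D f) = D (δ f))
    (x : β → A) : δ.vec (D.vec x) = D.vec (δ.vec x) :=
  funext fun _ => hδ _

theorem Derivation.map_skew {W : Matrix β β A} (h : Wᵀ = -W) : (W.map D)ᵀ = -W.map D := by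
  ext i j
  have := congrFun (congrFun h i) j
  simp only [transpose_apply, map_apply] at this ⊢
  rw [this]
  exact map_neg D _

variable (A) in
/-- One half. -/
noncomputable def half : A := algebraMap ℝ A (1 / 2)

variable (A) in
theorem two_mul_half : 2 * half A = 1 := by
  rw [half, ← map_ofNat (algebraMap ℝ A) 2, ← map_mul]
  norm_num

theorem Derivation.half_mul (f : A) : D (half A * f) = half A * D f := by
  rw [half, Derivation.leibniz, Derivation.map_algebraMap, smul_zero, add_zero, smul_eq_mul]

variable {D} {u : β → A}

theorem HGraph.wedge_bil {ξ y : β → A} {W : Matrix β β A} (h : HGraph D u ξ W y) (x z : β → A) :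
    bil (W.map D) x z = (x ⬝ᵥ u) * (ξ ⬝ᵥ z) - (x ⬝ᵥ ξ) * (u ⬝ᵥ z) := by
  rw [h.deriv, bil_wedge]

/-- Skew-adjointness of `D + u ⌋ D⁻¹(u ∧)`. -/
theorem HGraph.skew_adjoint {ξ y η z : β → A} {W V : Matrix β β A} (h : HGraph D u ξ W y)
    (k : HGraph D u η V z) : ∃ g, D g = ξ ⬝ᵥ z + η ⬝ᵥ y := by
  -- The first term integrates the local part by parts. The trace does so for the nonlocal part; the
  -- half compensates for each entry of a skew matrix being counted twice.
  refine ⟨ξ ⬝ᵥ η - half A * trace (W * V), ?_⟩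
  rw [map_sub, D.half_mul, D.dotProduct, D.trace, D.map_matrix_mul, h.deriv, k.deriv,
    trace_add, trace_mul_skew k.skew, trace_mul_comm, trace_mul_skew h.skew, h.eq, k.eq,
    dotProduct_add, dotProduct_add, dotProduct_comm ξ (u ᵥ* V), dotProduct_comm η (u ᵥ* W),
    vecMul_dotProduct, vecMul_dotProduct, bil_skew k.skew u, bil_skew h.skew u,
    dotProduct_comm η]
  linear_combination (-bil V ξ u - bil W η u) * two_mul_half A

/-- Skew-adjointness of `D + D⁻¹(u ·) u`. -/
theorem JGraph.skew_adjoint {ξ a η b : β → A} {w p : A} (h : JGraph D u a w ξ)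
    (k : JGraph D u b p η) : ∃ g, D g = a ⬝ᵥ η + b ⬝ᵥ ξ := by
  refine ⟨a ⬝ᵥ b + w * p, ?_⟩
  rw [map_add, D.dotProduct, Derivation.leibniz, h.deriv, k.deriv, h.eq, k.eq, dotProduct_add,
    dotProduct_add, dotProduct_smul, dotProduct_smul, dotProduct_comm b, dotProduct_comm b,
    dotProduct_comm a u]
  simp only [smul_eq_mul]
  ring

variable {δ : Derivation ℝ A A} {z : β → A}

/-- Variation of `D + u ⌋ D⁻¹(u ∧)` along a derivation. -/
theorem HGraph.variation (hδ : ∀ f, δ (D f) = D (δ f)) (hz : δ.vec u = z) {ξ a η y : β → A}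
    {W V : Matrix β β A} (h : HGraph D u ξ W a) (k : HGraph D u η V y) :
    ∃ g, D g = ξ ⬝ᵥ δ.vec y + a ⬝ᵥ δ.vec η - bil V z ξ + bil W z η := by
  -- Skew-adjointness for `ξ` and `δ η`, with `δ V` as the potential. Since `D (δ V) = z ∧ η + u ∧ δ
  -- η`, and the outer `u` is varied too, two terms containing `z` survive.
  refine ⟨ξ ⬝ᵥ δ.vec η - half A * trace (W * V.map δ), ?_⟩
  rw [map_sub, D.half_mul, D.dotProduct, D.trace, D.map_matrix_mul, h.deriv, D.map_comm hδ,
    k.deriv, δ.map_wedge, trace_add, trace_mul_skew (δ.map_skew k.skew), trace_mul_comm,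
    add_mul, trace_add, trace_mul_skew h.skew, trace_mul_skew h.skew, h.eq, k.eq, δ.vec_add,
    δ.vec_vecMul, hz, dotProduct_add, dotProduct_add, add_dotProduct,
    dotProduct_comm ξ (z ᵥ* V), dotProduct_comm ξ (u ᵥ* _), vecMul_dotProduct,
    vecMul_dotProduct, vecMul_dotProduct, bil_skew (δ.map_skew k.skew) u, bil_skew h.skew u,
    bil_skew h.skew z, D.vec_comm hδ]
  linear_combination (-bil (V.map δ) ξ u - bil W η z - bil W (δ.vec η) u) * two_mul_half A

/-- Variation of `D + D⁻¹(u ·) u` along a derivation. -/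
theorem JGraph.variation (hδ : ∀ f, δ (D f) = D (δ f)) (hz : δ.vec u = z) {a b ξ η : β → A}
    {w p : A} (h : JGraph D u a w ξ) (k : JGraph D u b p η) :
    ∃ g, D g = b ⬝ᵥ δ.vec ξ + η ⬝ᵥ δ.vec a + p * (z ⬝ᵥ a) - w * (z ⬝ᵥ b) := by
  refine ⟨b ⬝ᵥ δ.vec a + p * δ w, ?_⟩
  rw [map_add, D.dotProduct, Derivation.leibniz, ← hδ, h.deriv, k.deriv, δ.dotProduct, h.eq, k.eq,
    δ.vec_add, δ.vec_smul, hz, D.vec_comm hδ, dotProduct_add, dotProduct_add, add_dotProduct,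
    dotProduct_smul, dotProduct_smul, smul_dotProduct, dotProduct_comm b u, dotProduct_comm b z]
  simp only [smul_eq_mul]
  ring

/-- The trilinear identity behind the Jacobi identity of `D + u ⌋ D⁻¹(u ∧)`. -/
theorem HGraph.cyclic {ξ₁ ξ₂ ξ₃ y₁ y₂ y₃ : β → A} {W₁ W₂ W₃ : Matrix β β A}
    (h₁ : HGraph D u ξ₁ W₁ y₁) (h₂ : HGraph D u ξ₂ W₂ y₂) (h₃ : HGraph D u ξ₃ W₃ y₃) :
    ∃ g, D g = (bil W₁ y₃ ξ₂ - bil W₂ y₃ ξ₁) + (bil W₂ y₁ ξ₃ - bil W₃ y₁ ξ₂) +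
      (bil W₃ y₂ ξ₁ - bil W₁ y₂ ξ₃) := by
  -- Substituting `D ξ = y - u ⌋ W` in the derivative of the bilinear terms leaves expressions
  -- quadratic in the potentials. The trace of the triple product cancels them.
  refine ⟨bil W₁ ξ₃ ξ₂ + bil W₂ ξ₁ ξ₃ + bil W₃ ξ₂ ξ₁ - trace (W₁ * (W₂ * W₃)), ?_⟩
  have t : trace ((W₁ * (W₂ * W₃)).map D) = trace (wedge u ξ₁ * (W₂ * W₃)) +
      trace (wedge u ξ₂ * (W₃ * W₁)) + trace (wedge u ξ₃ * (W₁ * W₂)) := by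
    rw [D.map_matrix_mul, D.map_matrix_mul, h₁.deriv, h₂.deriv, h₃.deriv, trace_add, mul_add,
      trace_add, trace_mul_comm W₁ (wedge u ξ₂ * W₃), mul_assoc, ← mul_assoc W₁ W₂,
      trace_mul_comm (W₁ * W₂), add_assoc]
  rw [map_sub, map_add, map_add, D.trace, t, D.bil, D.bil, D.bil, h₁.wedge_bil, h₂.wedge_bil,
    h₃.wedge_bil, trace_wedge_mul, trace_wedge_mul, trace_wedge_mul, h₁.eq, h₂.eq, h₃.eq]
  simp only [bil_add_left, bil_vecMul_left]
  rw [bil_mul_skew h₂.skew h₃.skew ξ₁, bil_mul_skew h₃.skew h₁.skew ξ₂,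
    bil_mul_skew h₁.skew h₂.skew ξ₃, bil_skew h₁.skew ξ₃, bil_skew h₂.skew ξ₁,
    bil_skew h₃.skew ξ₂, dotProduct_comm ξ₃ ξ₁,
    dotProduct_comm u, dotProduct_comm u, dotProduct_comm u]
  ring

/-- The trilinear identity behind the compatibility of the two operators. -/
theorem HGraph.compatible {b₁ b₂ b₃ ξ₁ ξ₂ ξ₃ a₁ a₂ a₃ : β → A} {W₁ W₂ W₃ : Matrix β β A}
    {w₁ w₂ w₃ : A} (h₁ : HGraph D u ξ₁ W₁ a₁) (h₂ : HGraph D u ξ₂ W₂ a₂)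
    (h₃ : HGraph D u ξ₃ W₃ a₃) (k₁ : JGraph D u b₁ w₁ ξ₁) (k₂ : JGraph D u b₂ w₂ ξ₂)
    (k₃ : JGraph D u b₃ w₃ ξ₃) :
    ∃ g, D g = (bil W₁ b₃ ξ₂ - bil W₂ b₃ ξ₁) + (bil W₂ b₁ ξ₃ - bil W₃ b₁ ξ₂) +
      (bil W₃ b₂ ξ₁ - bil W₁ b₂ ξ₃) + (w₂ * (a₁ ⬝ᵥ b₃) - w₃ * (a₁ ⬝ᵥ b₂)) +
      (w₃ * (a₂ ⬝ᵥ b₁) - w₁ * (a₂ ⬝ᵥ b₃)) + (w₁ * (a₃ ⬝ᵥ b₂) - w₂ * (a₃ ⬝ᵥ b₁)) := by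
  -- The witness of `HGraph.cyclic` with `b` for `ξ`, plus terms pairing the scalar potentials with
  -- `ξ` and `b`. No triple trace is needed, as `D b = ξ - w u` contains no matrix potential.
  refine ⟨bil W₁ b₃ b₂ + bil W₂ b₁ b₃ + bil W₃ b₂ b₁ + (w₂ * (ξ₁ ⬝ᵥ b₃) - w₃ * (ξ₁ ⬝ᵥ b₂)) +
      (w₃ * (ξ₂ ⬝ᵥ b₁) - w₁ * (ξ₂ ⬝ᵥ b₃)) + (w₁ * (ξ₃ ⬝ᵥ b₂) - w₂ * (ξ₃ ⬝ᵥ b₁)), ?_⟩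
  rw [h₁.eq, h₂.eq, h₃.eq]
  simp only [map_add, map_sub, D.bil, D.dotProduct, Derivation.leibniz, h₁.wedge_bil,
    h₂.wedge_bil, h₃.wedge_bil, k₁.deriv, k₂.deriv, k₃.deriv, smul_eq_mul, add_dotProduct,
    vecMul_dotProduct]
  have e₁ : ∀ x, ξ₁ ⬝ᵥ x = D.vec b₁ ⬝ᵥ x + w₁ * (u ⬝ᵥ x) := fun x => by
    rw [k₁.eq, add_dotProduct, smul_dotProduct, smul_eq_mul]
  have e₂ : ∀ x, ξ₂ ⬝ᵥ x = D.vec b₂ ⬝ᵥ x + w₂ * (u ⬝ᵥ x) := fun x => by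
    rw [k₂.eq, add_dotProduct, smul_dotProduct, smul_eq_mul]
  have e₃ : ∀ x, ξ₃ ⬝ᵥ x = D.vec b₃ ⬝ᵥ x + w₃ * (u ⬝ᵥ x) := fun x => by
    rw [k₃.eq, add_dotProduct, smul_dotProduct, smul_eq_mul]
  have f₁ : ∀ M x, bil M x ξ₁ = bil M x (D.vec b₁) + w₁ * bil M x u := fun M x => by
    rw [k₁.eq, bil_add_right, bil_smul_right]
  have f₂ : ∀ M x, bil M x ξ₂ = bil M x (D.vec b₂) + w₂ * bil M x u := fun M x => by
    rw [k₂.eq, bil_add_right, bil_smul_right]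
  have f₃ : ∀ M x, bil M x ξ₃ = bil M x (D.vec b₃) + w₃ * bil M x u := fun M x => by
    rw [k₃.eq, bil_add_right, bil_smul_right]
  rw [dotProduct_comm b₃ ξ₁, dotProduct_comm b₁ ξ₂, dotProduct_comm b₂ ξ₃, dotProduct_comm b₁ u,
    dotProduct_comm b₂ u, dotProduct_comm b₃ u, e₁ (D.vec b₂), e₁ (D.vec b₃), e₂ (D.vec b₁),
    e₂ (D.vec b₃), e₃ (D.vec b₁), e₃ (D.vec b₂)]
  simp only [f₁, f₂, f₃]
  rw [bil_skew h₁.skew u b₂, bil_skew h₁.skew u b₃, bil_skew h₂.skew u b₁, bil_skew h₂.skew u b₃,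
    bil_skew h₃.skew u b₁, bil_skew h₃.skew u b₂, bil_skew h₁.skew (D.vec b₃),
    bil_skew h₂.skew (D.vec b₁), bil_skew h₃.skew (D.vec b₂),
    dotProduct_comm (D.vec b₂) (D.vec b₁), dotProduct_comm (D.vec b₃) (D.vec b₁),
    dotProduct_comm (D.vec b₃) (D.vec b₂)]
  ring

/-! ### Jacobi identities for the two operators, their linear combinations and the composition -/

section Jacobi

variable {δ₁ δ₂ δ₃ : Derivation ℝ A A} {ξ₁ ξ₂ ξ₃ y₁ y₂ y₃ : β → A}

/-- The Jacobi identity of `D + u ⌋ D⁻¹(u ∧)`. -/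
theorem HGraph.jacobi (hδ₁ : ∀ f, δ₁ (D f) = D (δ₁ f)) (hδ₂ : ∀ f, δ₂ (D f) = D (δ₂ f))
    (hδ₃ : ∀ f, δ₃ (D f) = D (δ₃ f)) (hz₁ : δ₁.vec u = y₁) (hz₂ : δ₂.vec u = y₂)
    (hz₃ : δ₃.vec u = y₃) {W₁ W₂ W₃ : Matrix β β A} (h₁ : HGraph D u ξ₁ W₁ y₁)
    (h₂ : HGraph D u ξ₂ W₂ y₂) (h₃ : HGraph D u ξ₃ W₃ y₃) :
    ∃ g, D g = (δ₁.vec ξ₂ ⬝ᵥ y₃ + ξ₂ ⬝ᵥ δ₃.vec y₁) + (δ₂.vec ξ₃ ⬝ᵥ y₁ + ξ₃ ⬝ᵥ δ₁.vec y₂) +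
      (δ₃.vec ξ₁ ⬝ᵥ y₂ + ξ₁ ⬝ᵥ δ₂.vec y₃) := by
  obtain ⟨g₁, e₁⟩ := HGraph.variation hδ₃ hz₃ h₂ h₁
  obtain ⟨g₂, e₂⟩ := HGraph.variation hδ₁ hz₁ h₃ h₂
  obtain ⟨g₃, e₃⟩ := HGraph.variation hδ₂ hz₂ h₁ h₃
  obtain ⟨g₄, e₄⟩ := HGraph.cyclic h₁ h₂ h₃
  refine ⟨g₁ + g₂ + g₃ + g₄, ?_⟩
  simp only [map_add]
  rw [dotProduct_comm _ y₁, dotProduct_comm _ y₂, dotProduct_comm _ y₃]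
  linear_combination e₁ + e₂ + e₃ + e₄

/-- The Jacobi identity of the inverse of `D + D⁻¹(u ·) u`. -/
theorem JGraph.jacobi (hδ₁ : ∀ f, δ₁ (D f) = D (δ₁ f)) (hδ₂ : ∀ f, δ₂ (D f) = D (δ₂ f))
    (hδ₃ : ∀ f, δ₃ (D f) = D (δ₃ f)) (hz₁ : δ₁.vec u = y₁) (hz₂ : δ₂.vec u = y₂)
    (hz₃ : δ₃.vec u = y₃) {w₁ w₂ w₃ : A} (h₁ : JGraph D u y₁ w₁ ξ₁)
    (h₂ : JGraph D u y₂ w₂ ξ₂) (h₃ : JGraph D u y₃ w₃ ξ₃) :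
    ∃ g, D g = (δ₁.vec ξ₂ ⬝ᵥ y₃ + ξ₂ ⬝ᵥ δ₃.vec y₁) + (δ₂.vec ξ₃ ⬝ᵥ y₁ + ξ₃ ⬝ᵥ δ₁.vec y₂) +
      (δ₃.vec ξ₁ ⬝ᵥ y₂ + ξ₁ ⬝ᵥ δ₂.vec y₃) := by
  obtain ⟨g₁, e₁⟩ := JGraph.variation hδ₁ hz₁ h₂ h₃
  obtain ⟨g₂, e₂⟩ := JGraph.variation hδ₂ hz₂ h₃ h₁
  obtain ⟨g₃, e₃⟩ := JGraph.variation hδ₃ hz₃ h₁ h₂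
  -- Each remaining product `wᵢ (yⱼ · yₖ)` occurs twice with opposite signs, so no trilinear
  -- identity is needed.
  refine ⟨g₁ + g₂ + g₃, ?_⟩
  simp only [map_add]
  rw [dotProduct_comm y₂ y₁] at e₂
  rw [dotProduct_comm y₃ y₁, dotProduct_comm y₃ y₂] at e₃
  rw [dotProduct_comm _ y₁, dotProduct_comm _ y₂, dotProduct_comm _ y₃]
  linear_combination e₁ + e₂ + e₃

theorem Derivation.algebraMap_mul (c : ℝ) (f : A) :
    D (algebraMap ℝ A c * f) = algebraMap ℝ A c * D f := by
  rw [Derivation.leibniz, Derivation.map_algebraMap, smul_zero, add_zero, smul_eq_mul]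

theorem Derivation.vec_lin (c d : ℝ) (a b : β → A) :
    D.vec (algebraMap ℝ A c • a + algebraMap ℝ A d • b) =
      algebraMap ℝ A c • D.vec a + algebraMap ℝ A d • D.vec b := by
  rw [D.vec_add, D.vec_smul, D.vec_smul]
  simp

/-- The Jacobi identity of linear combinations of the two operators. -/
theorem jacobi_linComb (hδ₁ : ∀ f, δ₁ (D f) = D (δ₁ f)) (hδ₂ : ∀ f, δ₂ (D f) = D (δ₂ f))
    (hδ₃ : ∀ f, δ₃ (D f) = D (δ₃ f)) (hz₁ : δ₁.vec u = y₁) (hz₂ : δ₂.vec u = y₂)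
    (hz₃ : δ₃.vec u = y₃) (c d : ℝ) {a₁ a₂ a₃ b₁ b₂ b₃ : β → A} {W₁ W₂ W₃ : Matrix β β A}
    {w₁ w₂ w₃ : A} (h₁ : HGraph D u ξ₁ W₁ a₁) (h₂ : HGraph D u ξ₂ W₂ a₂)
    (h₃ : HGraph D u ξ₃ W₃ a₃) (k₁ : JGraph D u b₁ w₁ ξ₁) (k₂ : JGraph D u b₂ w₂ ξ₂)
    (k₃ : JGraph D u b₃ w₃ ξ₃) (hy₁ : y₁ = algebraMap ℝ A c • a₁ + algebraMap ℝ A d • b₁)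
    (hy₂ : y₂ = algebraMap ℝ A c • a₂ + algebraMap ℝ A d • b₂)
    (hy₃ : y₃ = algebraMap ℝ A c • a₃ + algebraMap ℝ A d • b₃) :
    ∃ g, D g = (δ₁.vec ξ₂ ⬝ᵥ y₃ + ξ₂ ⬝ᵥ δ₃.vec y₁) + (δ₂.vec ξ₃ ⬝ᵥ y₁ + ξ₃ ⬝ᵥ δ₁.vec y₂) +
      (δ₃.vec ξ₁ ⬝ᵥ y₂ + ξ₁ ⬝ᵥ δ₂.vec y₃) := by
  obtain ⟨g₁, e₁⟩ := HGraph.variation hδ₃ hz₃ h₂ h₁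
  obtain ⟨g₂, e₂⟩ := HGraph.variation hδ₁ hz₁ h₃ h₂
  obtain ⟨g₃, e₃⟩ := HGraph.variation hδ₂ hz₂ h₁ h₃
  obtain ⟨g₄, e₄⟩ := HGraph.cyclic h₁ h₂ h₃
  obtain ⟨g₅, e₅⟩ := JGraph.variation hδ₁ hz₁ k₂ k₃
  obtain ⟨g₆, e₆⟩ := JGraph.variation hδ₂ hz₂ k₃ k₁
  obtain ⟨g₇, e₇⟩ := JGraph.variation hδ₃ hz₃ k₁ k₂
  obtain ⟨g₈, e₈⟩ := HGraph.compatible h₁ h₂ h₃ k₁ k₂ k₃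
  set γ := algebraMap ℝ A c with hγ
  set κ := algebraMap ℝ A d with hκ
  -- Sorted by powers of the coefficients: the `γ²` terms are `HGraph.cyclic`, the `γ κ` terms are
  -- `HGraph.compatible`, and the `κ²` terms cancel in pairs.
  refine ⟨γ * (g₁ + g₂ + g₃) + γ * (γ * g₄) + κ * (g₅ + g₆ + g₇) + γ * (κ * g₈), ?_⟩
  simp only [map_add, hγ, hκ, Derivation.algebraMap_mul]
  simp only [← hγ, ← hκ]
  rw [hy₁, hy₂, hy₃, hγ, hκ, Derivation.vec_lin, Derivation.vec_lin, Derivation.vec_lin, ← hγ, ← hκ]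
  simp only [hy₁, hy₂, hy₃, bil_add_left, bil_smul_left, add_dotProduct, smul_dotProduct,
    smul_eq_mul] at e₁ e₂ e₃ e₅ e₆ e₇
  simp only [dotProduct_add, dotProduct_smul, smul_eq_mul]
  rw [dotProduct_comm _ a₁, dotProduct_comm _ a₂, dotProduct_comm _ a₃, dotProduct_comm _ b₁,
    dotProduct_comm _ b₂, dotProduct_comm _ b₃]
  rw [dotProduct_comm b₂ b₁] at e₆
  rw [dotProduct_comm b₃ b₁, dotProduct_comm b₃ b₂] at e₇
  linear_combination γ * (e₁ + e₂ + e₃) + γ * γ * e₄ + κ * (e₅ + e₆ + e₇) + γ * κ * e₈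

/-- The Jacobi identity of the composition `H ∘ J ∘ H`. -/
theorem jacobi_comp (hδ₁ : ∀ f, δ₁ (D f) = D (δ₁ f)) (hδ₂ : ∀ f, δ₂ (D f) = D (δ₂ f))
    (hδ₃ : ∀ f, δ₃ (D f) = D (δ₃ f)) (hz₁ : δ₁.vec u = y₁) (hz₂ : δ₂.vec u = y₂)
    (hz₃ : δ₃.vec u = y₃) {a₁ a₂ a₃ η₁ η₂ η₃ : β → A} {W₁ W₂ W₃ V₁ V₂ V₃ : Matrix β β A}
    {p₁ p₂ p₃ : A} (h₁ : HGraph D u ξ₁ W₁ a₁) (h₂ : HGraph D u ξ₂ W₂ a₂)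
    (h₃ : HGraph D u ξ₃ W₃ a₃) (j₁ : JGraph D u a₁ p₁ η₁) (j₂ : JGraph D u a₂ p₂ η₂)
    (j₃ : JGraph D u a₃ p₃ η₃) (k₁ : HGraph D u η₁ V₁ y₁) (k₂ : HGraph D u η₂ V₂ y₂)
    (k₃ : HGraph D u η₃ V₃ y₃) :
    ∃ g, D g = (δ₁.vec ξ₂ ⬝ᵥ y₃ + ξ₂ ⬝ᵥ δ₃.vec y₁) + (δ₂.vec ξ₃ ⬝ᵥ y₁ + ξ₃ ⬝ᵥ δ₁.vec y₂) +
      (δ₃.vec ξ₁ ⬝ᵥ y₂ + ξ₁ ⬝ᵥ δ₂.vec y₃) := by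
  -- The variation is carried through the three factors in turn: the intermediate terms `a' · δ η`
  -- and `η' · δ a` telescope in the alternating sum.
  have variation : ∀ {δ : Derivation ℝ A A}, (∀ f, δ (D f) = D (δ f)) → ∀ {z : β → A},
      δ.vec u = z → ∀ {ξ a η y ξ' a' η' y' : β → A} {W V W' V' : Matrix β β A} {p p' : A},
      HGraph D u ξ W a → JGraph D u a p η → HGraph D u η V y →
      HGraph D u ξ' W' a' → JGraph D u a' p' η' → HGraph D u η' V' y' →
      ∃ g, D g = ξ' ⬝ᵥ δ.vec y + y' ⬝ᵥ δ.vec ξ - bil V z ξ' + bil W' z η - p' * (z ⬝ᵥ a) +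
        p * (z ⬝ᵥ a') - bil W z η' + bil V' z ξ := by
    intro δ hδ z hz ξ a η y ξ' a' η' y' W V W' V' p p' h j k h' j' k'
    obtain ⟨g₁, e₁⟩ := HGraph.variation hδ hz h' k
    obtain ⟨g₂, e₂⟩ := JGraph.variation hδ hz j j'
    obtain ⟨g₃, e₃⟩ := HGraph.variation hδ hz k' h
    exact ⟨g₁ - g₂ + g₃, by rw [map_add, map_sub]; linear_combination e₁ - e₂ + e₃⟩
  obtain ⟨g₁, e₁⟩ := variation hδ₃ hz₃ h₁ j₁ k₁ h₂ j₂ k₂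
  obtain ⟨g₂, e₂⟩ := variation hδ₁ hz₁ h₂ j₂ k₂ h₃ j₃ k₃
  obtain ⟨g₃, e₃⟩ := variation hδ₂ hz₂ h₃ j₃ k₃ h₁ j₁ k₁
  -- The matrix terms mix potentials `W` of `ξ` and `V` of `η`. They are three instances of the
  -- cyclic identity, with one of the `η` replaced by its `ξ`, minus the compatibility identity for
  -- the `η` and `J⁻¹ η = a`.
  obtain ⟨g₄, e₄⟩ := HGraph.cyclic h₁ k₂ k₃
  obtain ⟨g₅, e₅⟩ := HGraph.cyclic k₁ h₂ k₃
  obtain ⟨g₆, e₆⟩ := HGraph.cyclic k₁ k₂ h₃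
  obtain ⟨g₇, e₇⟩ := HGraph.compatible k₁ k₂ k₃ j₁ j₂ j₃
  refine ⟨g₁ + g₂ + g₃ + g₄ + g₅ + g₆ - g₇, ?_⟩
  simp only [map_add, map_sub]
  rw [dotProduct_comm _ y₁, dotProduct_comm _ y₂, dotProduct_comm _ y₃]
  linear_combination e₁ + e₂ + e₃ + e₄ + e₅ + e₆ - e₇

end Jacobi

end DifferentialRing

/-! ### Hamiltonian operators -/

section Operators

open Matrix

variable {α β : Type} [Fintype β]

/-- Skewness of the potential is forced by the normalisation: a primitive with zero constant term is
unique. -/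
theorem isPrimitive_matrix {u ξ : β → DiffPoly α} {W : β → β → DiffPoly α}
    (h : ∀ i j, IsPrimitive (u i * ξ j - ξ i * u j) (W i j)) :
    (of W).map (totalD α) = wedge u ξ ∧ (of W)ᵀ = -of W := by
  constructor
  · ext1 i j
    simp [vecMulVec_apply, (h i j).1]
  · ext1 i j
    refine (h j i).unique (g' := -W i j) ?_
    convert (h i j).neg using 1
    ring

theorem opH.exists_graph {u ξ y : β → DiffPoly α} (h : opH u ξ y) :
    ∃ W, HGraph (totalD α) u ξ W y := by
  obtain ⟨W, hW, hy⟩ := h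
  exact ⟨of W, (isPrimitive_matrix hW).1, (isPrimitive_matrix hW).2, funext hy⟩

theorem opJ.exists_graph {u e ξ : β → DiffPoly α} (h : opJ u e ξ) :
    ∃ w, JGraph (totalD α) u e w ξ := by
  obtain ⟨w, hw, hξ⟩ := h
  exact ⟨w, hw.1, funext hξ⟩

theorem opH.unique {u ξ y z : β → DiffPoly α} (h : opH u ξ y) (h' : opH u ξ z) : y = z := by
  obtain ⟨W, hW, hy⟩ := h
  obtain ⟨V, hV, hz⟩ := h'
  have hWV : ∀ i j, W i j = V i j := fun i j => (hW i j).unique (hV i j)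
  funext j
  simp only [hy j, hz j, hWV]

theorem opH.add {u ξ η y z : β → DiffPoly α} (h : opH u ξ y) (h' : opH u η z) :
    opH u (ξ + η) (y + z) := by
  obtain ⟨W, hW, hy⟩ := h
  obtain ⟨V, hV, hz⟩ := h'
  refine ⟨fun i j => W i j + V i j, fun i j => ?_, fun j => ?_⟩
  · convert (hW i j).add (hV i j) using 1
    simp only [Pi.add_apply]; ring
  · simp only [Pi.add_apply, hy, hz, map_add, mul_add, Finset.sum_add_distrib]; ring

theorem opH.smul {u ξ y : β → DiffPoly α} (c : ℝ) (h : opH u ξ y) : opH u (c • ξ) (c • y) := by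
  obtain ⟨W, hW, hy⟩ := h
  refine ⟨fun i j => c • W i j, fun i j => ?_, fun j => ?_⟩
  · convert (hW i j).smul c using 1
    simp only [Pi.smul_apply, smul_sub, mul_smul_comm, smul_mul_assoc]
  · simp only [Pi.smul_apply, hy, Derivation.map_smul, smul_add, mul_smul_comm, Finset.smul_sum]

theorem opH.zero (u : β → DiffPoly α) : opH u 0 0 :=
  ⟨0, fun i j => by simpa using IsPrimitive.zero, fun j => by simp⟩

theorem opJ.unique {u e y z : β → DiffPoly α} (h : opJ u e y) (h' : opJ u e z) : y = z := by
  obtain ⟨w, hw, hy⟩ := h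
  obtain ⟨w', hw', hz⟩ := h'
  exact funext fun j => by rw [hy, hz, hw.unique hw']

theorem opJ.add {u e f y z : β → DiffPoly α} (h : opJ u e y) (h' : opJ u f z) :
    opJ u (e + f) (y + z) := by
  obtain ⟨w, hw, hy⟩ := h
  obtain ⟨w', hw', hz⟩ := h'
  refine ⟨w + w', ?_, fun j => ?_⟩
  · convert hw.add hw' using 1
    simp only [Pi.add_apply, mul_add, Finset.sum_add_distrib]
  · simp only [Pi.add_apply, hy, hz, map_add]; ring

theorem opJ.smul {u e y : β → DiffPoly α} (c : ℝ) (h : opJ u e y) : opJ u (c • e) (c • y) := by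
  obtain ⟨w, hw, hy⟩ := h
  refine ⟨c • w, ?_, fun j => ?_⟩
  · convert hw.smul c using 1
    simp only [Pi.smul_apply, mul_smul_comm, Finset.smul_sum]
  · simp only [Pi.smul_apply, hy, Derivation.map_smul, smul_add, smul_mul_assoc]

theorem opJ.zero (u : β → DiffPoly α) : opJ u 0 0 :=
  ⟨0, by simpa using IsPrimitive.zero, fun j => by simp⟩

/-- A bounded real polynomial is constant. -/
theorem eq_C_of_bounded {σ : Type*} {f : MvPolynomial σ ℝ} (c : ℝ) (h : ∀ x, |eval x f| ≤ c) :
    f = C (constantCoeff f) := by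
  refine MvPolynomial.funext fun x => ?_
  -- The restriction of `f` to the line through the origin and `x`; a nonconstant polynomial in one
  -- variable is unbounded.
  set P : Polynomial ℝ := aeval (fun i => Polynomial.C (x i) * Polynomial.X) f with hP
  have hev : ∀ t, P.eval t = eval (fun i => x i * t) f := fun t => by
    rw [hP, ← Polynomial.coe_evalRingHom, ← RingHom.coe_coe (aeval _), ← RingHom.comp_apply]
    congr 1
    refine MvPolynomial.ringHom_ext (fun r => ?_) fun i => ?_ <;> simp
  have hdeg : ¬ 0 < P.degree := fun hd => by
    obtain ⟨t, ht⟩ := ((P.abs_tendsto_atTop hd).eventually (Filter.eventually_gt_atTop c)).exists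
    rw [hev] at ht
    exact absurd (h _) (not_le.mpr ht)
  have hc := Polynomial.eq_C_of_degree_le_zero (not_lt.mp hdeg)
  have h1 := hev 1
  have h0 := hev 0
  rw [hc, Polynomial.eval_C] at h1 h0
  simp only [mul_one, mul_zero] at h1 h0
  rw [← h1, h0, eval_C, ← eval_zero]
  rfl

/-- At real points every summand is bounded by the constant. This is where real coefficients matter.
-/
theorem eq_C_of_sum_sq {σ ι : Type*} (s : Finset ι) {f : ι → MvPolynomial σ ℝ} {c : ℝ}
    (h : ∑ i ∈ s, f i ^ 2 = C c) {i : ι} (hi : i ∈ s) : f i = C (constantCoeff (f i)) := by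
  refine eq_C_of_bounded (Real.sqrt c) fun x => Real.abs_le_sqrt ?_
  have := congrArg (eval x) h
  simp only [map_sum, map_pow, eval_C] at this
  rw [← this]
  exact Finset.single_le_sum (f := fun i => eval x (f i) ^ 2) (fun i _ => sq_nonneg _) hi

/-- The operator `D + D⁻¹(u ·) u` is injective. -/
theorem opJ.injective {ι : β → α} (hι : Function.Injective ι) {e : β → DiffPoly α}
    (h : opJ (fun i => X (ι i, 0)) e 0) : e = 0 := by
  classical
  obtain ⟨w, hw, he⟩ := h
  -- On the kernel `D e = -w u` and `D w = u · e`, so `w² + |e|²` is conserved, hence constant, and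
  -- so are `w` and every `e i`. Then `u · e = D w = 0` is linear in the field with constant
  -- coefficients, which must vanish.
  have hD : totalD α (∑ i : Option β, (i.elim w e) ^ 2) = 0 := by
    rw [Fintype.sum_option]
    simp only [Option.elim_none, Option.elim_some, map_add, map_sum, Derivation.leibniz_pow, hw.1,
      smul_eq_mul, nsmul_eq_mul]
    rw [Finset.mul_sum, Finset.mul_sum, ← Finset.sum_add_distrib]
    refine Finset.sum_eq_zero fun i _ => ?_
    have := he i
    rw [Pi.zero_apply] at this
    push_cast
    linear_combination (-2 * e i) * this
  have hc := fun i : Option β => eq_C_of_sum_sq _ (eq_C_of_totalD_eq_zero hD) (Finset.mem_univ i)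
  have h0 : ∑ i, X (ι i, 0) * e i = 0 := by
    rw [← hw.1, show w = C (constantCoeff w) from hc none]
    exact derivation_C _ _
  funext i
  have h1 := congrArg (pderiv (ι i, 0)) h0
  have hci : ∀ j, pderiv (ι i, 0) (e j) = 0 := fun j => by
    rw [show e j = C (constantCoeff (e j)) from hc (some j), pderiv_C]
  rw [map_sum, Finset.sum_eq_single i] at h1
  · simpa [pderiv_mul, hci] using h1
  · intro j _ hj
    rw [pderiv_mul, hci, pderiv_X_of_ne (by simpa using fun h => hj (hι h))]
    simp
  · simp

/-- The requirements on a Hamiltonian operator, for the components in the range of `ι`. -/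
structure IsHamiltonianOn (ι : β → α) (P : PartialOp β α) : Prop where
  single_valued : ∀ ξ Y Z, P ξ Y → P ξ Z → Y = Z
  map_zero : P 0 0
  map_add : ∀ ξ₁ ξ₂ Y₁ Y₂, P ξ₁ Y₁ → P ξ₂ Y₂ → P (ξ₁ + ξ₂) (Y₁ + Y₂)
  map_smul : ∀ (c : ℝ) ξ Y, P ξ Y → P (c • ξ) (c • Y)
  skew : ∀ ξ₁ ξ₂ Y₁ Y₂, P ξ₁ Y₁ → P ξ₂ Y₂ → IntegralZero (ξ₁ ⬝ᵥ Y₂ + ξ₂ ⬝ᵥ Y₁)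
  -- The flows `Z` may move the components outside the range of `ι` arbitrarily: the entries of the
  -- `ξ` and `Y` may depend on those components.
  jacobi : ∀ ξ₁ ξ₂ ξ₃ Y₁ Y₂ Y₃ : β → DiffPoly α, ∀ Z₁ Z₂ Z₃ : α → DiffPoly α,
    P ξ₁ Y₁ → P ξ₂ Y₂ → P ξ₃ Y₃ → Z₁ ∘ ι = Y₁ → Z₂ ∘ ι = Y₂ → Z₃ ∘ ι = Y₃ →
    IntegralZero (((evolve Z₁).vec ξ₂ ⬝ᵥ Y₃ + ξ₂ ⬝ᵥ (evolve Z₃).vec Y₁) +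
      ((evolve Z₂).vec ξ₃ ⬝ᵥ Y₁ + ξ₃ ⬝ᵥ (evolve Z₁).vec Y₂) +
      ((evolve Z₃).vec ξ₁ ⬝ᵥ Y₂ + ξ₁ ⬝ᵥ (evolve Z₂).vec Y₃))

omit [Fintype β] in
theorem evolve_vec_field (ι : β → α) {Z : α → DiffPoly α} {Y : β → DiffPoly α} (h : Z ∘ ι = Y) :
    (evolve Z).vec (fun i => X (ι i, 0)) = Y := by
  rw [← h]
  funext i
  simp [Derivation.vec]

theorem isHamiltonianOn_opH (ι : β → α) : IsHamiltonianOn ι (opH fun i => X (ι i, 0)) where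
  single_valued _ _ _ h h' := h.unique h'
  map_zero := opH.zero _
  map_add _ _ _ _ h h' := h.add h'
  map_smul c _ _ h := h.smul c
  skew _ _ _ _ h h' := by
    obtain ⟨_, h⟩ := h.exists_graph
    obtain ⟨_, h'⟩ := h'.exists_graph
    exact h.skew_adjoint h'
  jacobi _ _ _ _ _ _ _ _ _ h₁ h₂ h₃ hZ₁ hZ₂ hZ₃ := by
    obtain ⟨_, h₁⟩ := h₁.exists_graph
    obtain ⟨_, h₂⟩ := h₂.exists_graph
    obtain ⟨_, h₃⟩ := h₃.exists_graph
    exact HGraph.jacobi (evolve_totalD _) (evolve_totalD _) (evolve_totalD _)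
      (evolve_vec_field ι hZ₁) (evolve_vec_field ι hZ₂) (evolve_vec_field ι hZ₃) h₁ h₂ h₃

theorem isHamiltonianOn_opJ_inv {ι : β → α} (hι : Function.Injective ι) :
    IsHamiltonianOn ι (opJ fun i => X (ι i, 0)).inv where
  single_valued ξ Y Z h h' := by
    have := opJ.add h (opJ.smul (-1) h')
    rw [neg_one_smul, neg_one_smul, add_neg_cancel] at this
    rw [← sub_eq_zero, sub_eq_add_neg, opJ.injective hι this]
  map_zero := opJ.zero _
  map_add _ _ _ _ h h' := opJ.add h h'
  map_smul c _ _ h := opJ.smul c h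
  skew _ _ _ _ h h' := by
    obtain ⟨_, h⟩ := opJ.exists_graph h
    obtain ⟨_, h'⟩ := opJ.exists_graph h'
    rw [dotProduct_comm, add_comm, dotProduct_comm]
    exact h.skew_adjoint h'
  jacobi _ _ _ _ _ _ _ _ _ h₁ h₂ h₃ hZ₁ hZ₂ hZ₃ := by
    obtain ⟨_, h₁⟩ := opJ.exists_graph h₁
    obtain ⟨_, h₂⟩ := opJ.exists_graph h₂
    obtain ⟨_, h₃⟩ := opJ.exists_graph h₃
    exact JGraph.jacobi (evolve_totalD _) (evolve_totalD _) (evolve_totalD _)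
      (evolve_vec_field ι hZ₁) (evolve_vec_field ι hZ₂) (evolve_vec_field ι hZ₃) h₁ h₂ h₃

theorem isHamiltonianOn_linComb {ι : β → α} (hι : Function.Injective ι) (c d : ℝ) :
    IsHamiltonianOn ι (PartialOp.linComb c d (opH fun i => X (ι i, 0))
      (opJ fun i => X (ι i, 0)).inv) where
  single_valued ξ Y Z := by
    rintro ⟨Y₁, Y₂, h₁, h₂, rfl⟩ ⟨Z₁, Z₂, k₁, k₂, rfl⟩
    rw [h₁.unique k₁, (isHamiltonianOn_opJ_inv hι).single_valued _ _ _ h₂ k₂]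
  map_zero := ⟨0, 0, opH.zero _, opJ.zero _, by simp⟩
  map_add _ _ _ _ := by
    rintro ⟨Y₁, Y₂, h₁, h₂, rfl⟩ ⟨Z₁, Z₂, k₁, k₂, rfl⟩
    exact ⟨_, _, h₁.add k₁, opJ.add h₂ k₂, by simp only [smul_add]; abel⟩
  map_smul r _ _ := by
    rintro ⟨Y₁, Y₂, h₁, h₂, rfl⟩
    exact ⟨_, _, h₁.smul r, opJ.smul r h₂, by
      rw [smul_add, smul_comm r c, smul_comm r d]⟩
  skew _ _ _ _ := by
    rintro ⟨Y₁, Y₂, h₁, h₂, rfl⟩ ⟨Z₁, Z₂, k₁, k₂, rfl⟩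
    obtain ⟨f, hf⟩ := (isHamiltonianOn_opH ι).skew _ _ _ _ h₁ k₁
    obtain ⟨g, hg⟩ := (isHamiltonianOn_opJ_inv hι).skew _ _ _ _ h₂ k₂
    refine ⟨c • f + d • g, ?_⟩
    rw [_root_.map_add, Derivation.map_smul, Derivation.map_smul, hf, hg]
    simp only [dotProduct_add, dotProduct_smul, smul_add]
    abel
  jacobi _ _ _ _ _ _ Z₁ Z₂ Z₃ := by
    rintro ⟨a₁, b₁, h₁, k₁, e₁⟩ ⟨a₂, b₂, h₂, k₂, e₂⟩ ⟨a₃, b₃, h₃, k₃, e₃⟩ hZ₁ hZ₂ hZ₃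
    obtain ⟨_, h₁⟩ := h₁.exists_graph
    obtain ⟨_, h₂⟩ := h₂.exists_graph
    obtain ⟨_, h₃⟩ := h₃.exists_graph
    obtain ⟨_, k₁⟩ := opJ.exists_graph k₁
    obtain ⟨_, k₂⟩ := opJ.exists_graph k₂
    obtain ⟨_, k₃⟩ := opJ.exists_graph k₃
    refine jacobi_linComb (evolve_totalD _) (evolve_totalD _) (evolve_totalD _)
      (evolve_vec_field ι hZ₁) (evolve_vec_field ι hZ₂) (evolve_vec_field ι hZ₃) c d
      h₁ h₂ h₃ k₁ k₂ k₃ ?_ ?_ ?_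
    · rw [algebraMap_smul, algebraMap_smul, e₁]
    · rw [algebraMap_smul, algebraMap_smul, e₂]
    · rw [algebraMap_smul, algebraMap_smul, e₃]

theorem isHamiltonianOn_comp (ι : β → α) :
    IsHamiltonianOn ι ((opH fun i => X (ι i, 0)).comp
      ((opJ fun i => X (ι i, 0)).comp (opH fun i => X (ι i, 0)))) where
  single_valued ξ Y Z := by
    rintro ⟨η, ⟨a, h₁, h₂⟩, h₃⟩ ⟨η', ⟨a', k₁, k₂⟩, k₃⟩
    obtain rfl := h₁.unique k₁
    obtain rfl := h₂.unique k₂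
    exact h₃.unique k₃
  map_zero := ⟨0, ⟨0, opH.zero _, opJ.zero _⟩, opH.zero _⟩
  map_add _ _ _ _ := by
    rintro ⟨η, ⟨a, h₁, h₂⟩, h₃⟩ ⟨η', ⟨a', k₁, k₂⟩, k₃⟩
    exact ⟨_, ⟨_, h₁.add k₁, h₂.add k₂⟩, h₃.add k₃⟩
  map_smul c _ _ := by
    rintro ⟨η, ⟨a, h₁, h₂⟩, h₃⟩
    exact ⟨_, ⟨_, h₁.smul c, h₂.smul c⟩, h₃.smul c⟩
  skew _ _ _ _ := by
    rintro ⟨η, ⟨a, h₁, h₂⟩, h₃⟩ ⟨η', ⟨a', k₁, k₂⟩, k₃⟩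
    obtain ⟨_, h₁⟩ := h₁.exists_graph
    obtain ⟨_, k₁⟩ := k₁.exists_graph
    obtain ⟨_, h₂⟩ := h₂.exists_graph
    obtain ⟨_, k₂⟩ := k₂.exists_graph
    obtain ⟨_, h₃⟩ := h₃.exists_graph
    obtain ⟨_, k₃⟩ := k₃.exists_graph
    obtain ⟨f, hf⟩ := h₁.skew_adjoint k₃
    obtain ⟨g, hg⟩ := h₂.skew_adjoint k₂
    obtain ⟨k, hk⟩ := k₁.skew_adjoint h₃
    refine ⟨f - g + k, ?_⟩
    rw [_root_.map_add, map_sub, hf, hg, hk, dotProduct_comm η', dotProduct_comm η]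
    ring
  jacobi _ _ _ _ _ _ Z₁ Z₂ Z₃ := by
    rintro ⟨_, ⟨_, h₁, j₁⟩, k₁⟩ ⟨_, ⟨_, h₂, j₂⟩, k₂⟩ ⟨_, ⟨_, h₃, j₃⟩, k₃⟩ hZ₁ hZ₂ hZ₃
    obtain ⟨_, h₁⟩ := h₁.exists_graph
    obtain ⟨_, h₂⟩ := h₂.exists_graph
    obtain ⟨_, h₃⟩ := h₃.exists_graph
    obtain ⟨_, j₁⟩ := j₁.exists_graph
    obtain ⟨_, j₂⟩ := j₂.exists_graph
    obtain ⟨_, j₃⟩ := j₃.exists_graph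
    obtain ⟨_, k₁⟩ := k₁.exists_graph
    obtain ⟨_, k₂⟩ := k₂.exists_graph
    obtain ⟨_, k₃⟩ := k₃.exists_graph
    exact jacobi_comp (evolve_totalD _) (evolve_totalD _) (evolve_totalD _)
      (evolve_vec_field ι hZ₁) (evolve_vec_field ι hZ₂) (evolve_vec_field ι hZ₃)
      h₁ h₂ h₃ j₁ j₂ j₃ k₁ k₂ k₃

end Operators

/-! ### d-operators -/

section DOperators

open Matrix

variable {n m : ℕ} {P P' : PartialOp (Fin (n - 1)) (DIdx n m)}
  {Q Q' : PartialOp (Fin (m - 1)) (DIdx n m)}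

theorem pairing_eq (ξ Y : DVec n m) : pairing ξ Y = ξ.h ⬝ᵥ Y.h + ξ.v ⬝ᵥ Y.v :=
  Fintype.sum_sum_type _

/-- The derivative of `Z` along `Y` comes once from the Leibniz rule and once from the commutator,
and cancels. What remains splits into blocks. -/
theorem lieDerivPairing_eq (Y ξ Z : DVec n m) : lieDerivPairing Y ξ Z =
    ((evolve Y).vec ξ.h ⬝ᵥ Z.h + ξ.h ⬝ᵥ (evolve Z).vec Y.h) +
      ((evolve Y).vec ξ.v ⬝ᵥ Z.v + ξ.v ⬝ᵥ (evolve Z).vec Y.v) := by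
  have : lieDerivPairing Y ξ Z = pairing (fun a => evolve Y (ξ a)) Z +
      pairing ξ (fun a => evolve Z (Y a)) := by
    rw [lieDerivPairing, evolve_pairing]
    simp only [pairing, flowBracket, mul_sub, Finset.sum_sub_distrib]
    ring
  rw [this, pairing_eq, pairing_eq]
  exact add_add_add_comm _ _ _ _

theorem isHamiltonian_dOp (hP : IsHamiltonianOn Sum.inl P) (hQ : IsHamiltonianOn Sum.inr Q) :
    IsHamiltonian (dOp P Q) where
  single_valued ξ Y Z h h' := by
    have h₁ := hP.single_valued _ _ _ h.1 h'.1
    have h₂ := hQ.single_valued _ _ _ h.2 h'.2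
    funext a
    cases a with
    | inl i => exact congrFun h₁ i
    | inr i => exact congrFun h₂ i
  map_zero := ⟨hP.map_zero, hQ.map_zero⟩
  map_add _ _ _ _ h h' := ⟨hP.map_add _ _ _ _ h.1 h'.1, hQ.map_add _ _ _ _ h.2 h'.2⟩
  map_smul c _ _ h := ⟨hP.map_smul c _ _ h.1, hQ.map_smul c _ _ h.2⟩
  skew _ _ _ _ h h' := by
    obtain ⟨f, hf⟩ := hP.skew _ _ _ _ h.1 h'.1
    obtain ⟨g, hg⟩ := hQ.skew _ _ _ _ h.2 h'.2
    exact ⟨f + g, by rw [map_add, hf, hg, pairing_eq, pairing_eq]; ring⟩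
  jacobi _ _ _ _ _ _ h₁ h₂ h₃ := by
    obtain ⟨f, hf⟩ := hP.jacobi _ _ _ _ _ _ _ _ _ h₁.1 h₂.1 h₃.1 rfl rfl rfl
    obtain ⟨g, hg⟩ := hQ.jacobi _ _ _ _ _ _ _ _ _ h₁.2 h₂.2 h₃.2 rfl rfl rfl
    exact ⟨f + g, by
      rw [map_add, hf, hg, lieDerivPairing_eq, lieDerivPairing_eq, lieDerivPairing_eq]; ring⟩

theorem nAdapted_dOp (hP : P 0 0) (hQ : Q 0 0) : NAdapted (dOp P Q) :=
  fun _ _ h => ⟨⟨h.1, hQ⟩, ⟨hP, h.2⟩⟩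

theorem dOp_comp : (dOp P Q).comp (dOp P' Q') = dOp (P.comp P') (Q.comp Q') := by
  funext ξ Y
  refine propext ⟨fun ⟨η, h, h'⟩ => ⟨⟨_, h.1, h'.1⟩, ⟨_, h.2, h'.2⟩⟩, ?_⟩
  rintro ⟨⟨η, h, h'⟩, ⟨η', k, k'⟩⟩
  exact ⟨Sum.elim η η', ⟨h, k⟩, ⟨h', k'⟩⟩

theorem dOp_linComb (c d : ℝ) :
    PartialOp.linComb c d (dOp P Q) (dOp P' Q') =
      dOp (PartialOp.linComb c d P P') (PartialOp.linComb c d Q Q') := by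
  funext ξ Y
  refine propext ⟨?_, ?_⟩
  · rintro ⟨Y₁, Y₂, h, h', rfl⟩
    exact ⟨⟨_, _, h.1, h'.1, rfl⟩, ⟨_, _, h.2, h'.2, rfl⟩⟩
  · rintro ⟨⟨Y₁, Y₂, h, h', e⟩, ⟨Z₁, Z₂, k, k', e'⟩⟩
    refine ⟨Sum.elim Y₁ Z₁, Sum.elim Y₂ Z₂, ⟨h, k⟩, ⟨h', k'⟩, funext fun a => ?_⟩
    cases a with
    | inl i => exact congrFun e i
    | inr i => exact congrFun e' i

theorem PartialOp.comp_assoc {α β : Type} (P Q R : PartialOp β α) :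
    P.comp (Q.comp R) = (P.comp Q).comp R := by
  funext ξ Y
  exact propext ⟨fun ⟨η, ⟨ζ, h, h'⟩, k⟩ => ⟨ζ, h, η, h', k⟩,
    fun ⟨ζ, h, η, h', k⟩ => ⟨η, ⟨ζ, h, h'⟩, k⟩⟩

theorem compatible_dH_dJ (n m : ℕ) : Compatible (dH n m) (dJ n m) := by
  refine ⟨isHamiltonian_dOp (isHamiltonianOn_opH _) (isHamiltonianOn_opH _),
    isHamiltonian_dOp (isHamiltonianOn_opJ_inv Sum.inl_injective)
      (isHamiltonianOn_opJ_inv Sum.inr_injective), fun c d => ?_⟩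
  have : PartialOp.linComb c d (dH n m) (dJ n m).inv =
      dOp (PartialOp.linComb c d (hH n m) (hJ n m).inv)
        (PartialOp.linComb c d (vH n m) (vJ n m).inv) :=
    dOp_linComb (P' := (hJ n m).inv) (Q' := (vJ n m).inv) c d
  rw [this]
  exact isHamiltonian_dOp (isHamiltonianOn_linComb Sum.inl_injective c d)
    (isHamiltonianOn_linComb Sum.inr_injective c d)

theorem isHamiltonian_comp (n m : ℕ) :
    IsHamiltonian ((dH n m).comp ((dJ n m).comp (dH n m))) := by
  rw [dJ, dH, dOp_comp, dOp_comp]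
  exact isHamiltonian_dOp (isHamiltonianOn_comp _) (isHamiltonianOn_comp _)

theorem comp_eq_dR_comp (n m : ℕ) :
    (dH n m).comp ((dJ n m).comp (dH n m)) = (dR n m).comp (dH n m) := by
  rw [PartialOp.comp_assoc, dR, hR, vR, ← dOp_comp]
  rfl

theorem nAdapted_dH (n m : ℕ) : NAdapted (dH n m) := nAdapted_dOp (opH.zero _) (opH.zero _)

theorem nAdapted_dJ (n m : ℕ) : NAdapted (dJ n m) := nAdapted_dOp (opJ.zero _) (opJ.zero _)

theorem nAdapted_dR (n m : ℕ) : NAdapted (dR n m) :=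
  nAdapted_dOp ⟨0, opJ.zero _, opH.zero _⟩ ⟨0, opJ.zero _, opH.zero _⟩

end DOperators

/-! ### Power series with coefficients in a differential ring -/

section DifferentialPowerSeries

open scoped PowerSeries
open Matrix

variable {β A : Type*} [Fintype β] [CommRing A] [Algebra ℝ A]

/-- The coefficientwise extension of a derivation to power series. -/
noncomputable def Derivation.powerSeries (d : Derivation ℝ A A) : Derivation ℝ A⟦X⟧ A⟦X⟧ where
  toFun f := PowerSeries.mk fun n => d (PowerSeries.coeff n f)
  map_add' f g := by ext n; simp
  map_smul' c f := by
    ext n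
    rw [RingHom.id_apply, PowerSeries.coeff_mk, ← algebraMap_smul A c f, PowerSeries.coeff_smul, smul_eq_mul,
      Derivation.algebraMap_mul, ← algebraMap_smul A c (PowerSeries.mk _), PowerSeries.coeff_smul, PowerSeries.coeff_mk,
      smul_eq_mul]
  map_one_eq_zero' := by
    ext n
    simp only [LinearMap.coe_mk, AddHom.coe_mk, PowerSeries.coeff_mk, PowerSeries.coeff_one, map_zero]
    split_ifs <;> simp
  leibniz' f g := by
    ext n
    simp only [LinearMap.coe_mk, AddHom.coe_mk, PowerSeries.coeff_mk, PowerSeries.coeff_mul, map_sum, Derivation.leibniz,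
      smul_eq_mul, map_add, Finset.sum_add_distrib]
    congr 1
    exact Finset.Nat.sum_antidiagonal_swap (f := fun p =>
      PowerSeries.coeff p.1 g * d (PowerSeries.coeff p.2 f))

variable (d : Derivation ℝ A A)

@[simp] theorem Derivation.coeff_powerSeries (n : ℕ) (f : A⟦X⟧) :
    PowerSeries.coeff n (d.powerSeries f) = d (PowerSeries.coeff n f) :=
  PowerSeries.coeff_mk n fun n => d (PowerSeries.coeff n f)

@[simp] theorem Derivation.powerSeries_X : d.powerSeries (PowerSeries.X : A⟦X⟧) = 0 := by
  ext n
  rw [Derivation.coeff_powerSeries, PowerSeries.coeff_X]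
  split_ifs <;> simp

@[simp] theorem Derivation.powerSeries_C (a : A) :
    d.powerSeries (PowerSeries.C a) = PowerSeries.C (d a) := by
  ext n
  rw [Derivation.coeff_powerSeries, PowerSeries.coeff_C, PowerSeries.coeff_C]
  split_ifs <;> simp

theorem Derivation.powerSeries_X_mul (f : A⟦X⟧) :
    d.powerSeries (PowerSeries.X * f) = PowerSeries.X * d.powerSeries f := by
  simp [Derivation.leibniz]

theorem Derivation.powerSeries_comm {d δ : Derivation ℝ A A} (h : ∀ f, δ (d f) = d (δ f))
    (f : A⟦X⟧) : δ.powerSeries (d.powerSeries f) = d.powerSeries (δ.powerSeries f) := by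
  ext n
  simp [h]

/-- Power series which agree up to the order `n`. -/
def AgreeBelow (n : ℕ) (f g : A⟦X⟧) : Prop := (PowerSeries.X : A⟦X⟧) ^ n ∣ f - g

namespace AgreeBelow

variable {n : ℕ} {f f' g g' : A⟦X⟧}

omit [Algebra ℝ A] in
theorem rfl' : AgreeBelow n f f := by simp [AgreeBelow]

omit [Algebra ℝ A] in
theorem symm (h : AgreeBelow n f g) : AgreeBelow n g f := by
  rw [AgreeBelow, ← neg_sub]; exact h.neg_right

omit [Algebra ℝ A] in
theorem trans (h : AgreeBelow n f g) (h' : AgreeBelow n g g') : AgreeBelow n f g' := by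
  rw [AgreeBelow, ← sub_add_sub_cancel f g g']; exact dvd_add h h'

omit [Algebra ℝ A] in
theorem mono {m : ℕ} (hm : m ≤ n) (h : AgreeBelow n f g) : AgreeBelow m f g :=
  (pow_dvd_pow _ hm).trans h

omit [Algebra ℝ A] in
theorem add (h : AgreeBelow n f g) (h' : AgreeBelow n f' g') :
    AgreeBelow n (f + f') (g + g') := by
  rw [AgreeBelow, add_sub_add_comm]; exact dvd_add h h'

omit [Algebra ℝ A] in
theorem sub (h : AgreeBelow n f g) (h' : AgreeBelow n f' g') :
    AgreeBelow n (f - f') (g - g') := by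
  rw [AgreeBelow, sub_sub_sub_comm]; exact dvd_sub h h'

omit [Algebra ℝ A] in
theorem mul (h : AgreeBelow n f g) (h' : AgreeBelow n f' g') :
    AgreeBelow n (f * f') (g * g') := by
  rw [AgreeBelow, show f * f' - g * g' = f * (f' - g') + (f - g) * g' by ring]
  exact dvd_add (h'.mul_left _) (h.mul_right _)

omit [Algebra ℝ A] in
theorem sum {ι : Type*} (s : Finset ι) {x y : ι → A⟦X⟧} (h : ∀ i, AgreeBelow n (x i) (y i)) :
    AgreeBelow n (∑ i ∈ s, x i) (∑ i ∈ s, y i) := by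
  rw [AgreeBelow, ← Finset.sum_sub_distrib]
  exact Finset.dvd_sum fun i _ => h i

omit [Algebra ℝ A] in
theorem dotProduct {x x' y y' : β → A⟦X⟧} (h : ∀ i, AgreeBelow n (x i) (y i))
    (h' : ∀ i, AgreeBelow n (x' i) (y' i)) : AgreeBelow n (x ⬝ᵥ x') (y ⬝ᵥ y') :=
  sum _ fun i => (h i).mul (h' i)

omit [Algebra ℝ A] in
theorem X_mul (h : AgreeBelow n f g) :
    AgreeBelow (n + 1) (PowerSeries.X * f) (PowerSeries.X * g) := by
  rw [AgreeBelow, ← mul_sub, pow_succ']; exact mul_dvd_mul_left _ h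

omit [Algebra ℝ A] in
theorem coeff_eq (h : AgreeBelow n f g) {k : ℕ} (hk : k < n) : PowerSeries.coeff k f = PowerSeries.coeff k g := by
  have := PowerSeries.X_pow_dvd_iff.mp h k hk
  rwa [map_sub, sub_eq_zero] at this

omit [Algebra ℝ A] in
theorem of_coeff (h : ∀ k < n, PowerSeries.coeff k f = PowerSeries.coeff k g) : AgreeBelow n f g :=
  PowerSeries.X_pow_dvd_iff.mpr fun k hk => by rw [map_sub, h k hk, sub_self]

theorem derivation (d : Derivation ℝ A A) (h : AgreeBelow n f g) :
    AgreeBelow n (d.powerSeries f) (d.powerSeries g) :=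
  of_coeff fun k hk => by simp [h.coeff_eq hk]

omit [Algebra ℝ A] in
/-- The contraction principle for tuples of power series. -/
theorem exists_fixed_point {ι : Type*} (T : (ι → A⟦X⟧) → ι → A⟦X⟧)
    (hT : ∀ n x y, (∀ i, AgreeBelow n (x i) (y i)) → ∀ i, AgreeBelow (n + 1) (T x i) (T y i)) :
    ∃ x, T x = x := by
  set s : ℕ → ι → A⟦X⟧ := fun n => T^[n] 0 with hs
  have hsucc : ∀ n, s (n + 1) = T (s n) := fun n => Function.iterate_succ_apply' _ _ _
  have h1 : ∀ n i, AgreeBelow n (s (n + 1) i) (s n i) := by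
    intro n
    induction n with
    | zero => intro i; simp [AgreeBelow]
    | succ n ih =>
      intro i
      have := hT _ _ _ ih i
      rwa [← hsucc, ← hsucc] at this
  have h2 : ∀ n k i, AgreeBelow n (s (n + k) i) (s n i) := by
    intro n k i
    induction k with
    | zero => exact rfl'
    | succ k ih => exact ((h1 (n + k) i).mono (Nat.le_add_right _ _)).trans ih
  -- Coefficient `k` no longer changes from the iterate `k + 1` on.
  set x : ι → A⟦X⟧ := fun i => PowerSeries.mk fun k => PowerSeries.coeff k (s (k + 1) i) with hx
  have h3 : ∀ n i, AgreeBelow n (x i) (s n i) := fun n i => of_coeff fun k hk => by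
    rw [hx, PowerSeries.coeff_mk]
    obtain ⟨l, rfl⟩ := Nat.exists_eq_add_of_lt hk
    rw [show k + l + 1 = k + 1 + l by ring]
    exact ((h2 (k + 1) l i).coeff_eq (Nat.lt_succ_self k)).symm
  refine ⟨x, funext fun i => ?_⟩
  ext n
  have h4 := hT n x (s n) (h3 n) i
  rw [← hsucc] at h4
  exact (h4.trans (h3 (n + 1) i).symm).coeff_eq (Nat.lt_succ_self n)

end AgreeBelow

/-- The constant vector of power series. -/
noncomputable abbrev constVec (u : β → A) : β → A⟦X⟧ := fun i => PowerSeries.C (u i)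

/-- The generating functions of the hierarchy: `e` of the vector fields, `ϖ` of the covector
fields, `q` of the densities and `-X * V` of the potentials of `u ∧ ϖ`. -/
structure IsResolvent (d : Derivation ℝ A A) (u : β → A) (q κ : A⟦X⟧) (e ϖ : β → A⟦X⟧)
    (V : Matrix β β A⟦X⟧) : Prop where
  unit : (1 + PowerSeries.X * q) * κ = 1
  plucker : V = κ • wedge e ϖ
  -- The constant-norm condition `IsResolvent.norm'` with one factor `X` removed, so that it
  -- determines `q` order by order without integrating.
  norm : 2 * q + PowerSeries.X * (q ^ 2 + e ⬝ᵥ e) - ϖ ⬝ᵥ ϖ -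
    PowerSeries.X ^ 2 * (κ ^ 2 * ((e ⬝ᵥ e) * (ϖ ⬝ᵥ ϖ) - (e ⬝ᵥ ϖ) ^ 2)) = 0
  covector : ϖ = constVec u + (PowerSeries.X : A⟦X⟧) • (d.powerSeries.vec e + q • constVec u)
  vector : e = d.powerSeries.vec ϖ - (PowerSeries.X : A⟦X⟧) • (constVec u ᵥ* V)

/-- Every unknown can be isolated so that the other side involves the unknowns only with a factor
`X`. The system is then a contraction for the `X`-adic metric. -/
theorem exists_isResolvent (u : β → A) : ∃ q κ e ϖ V, IsResolvent d u q κ e ϖ V := by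
  let V : A⟦X⟧ → (β → A⟦X⟧) → (β → A⟦X⟧) → Matrix β β A⟦X⟧ := fun κ e ϖ => κ • wedge e ϖ
  let cov : A⟦X⟧ → (β → A⟦X⟧) → β → A⟦X⟧ := fun q e i =>
    PowerSeries.C (u i) + PowerSeries.X * (d.powerSeries (e i) + q * PowerSeries.C (u i))
  -- `D ϖ` carries no factor `X`, so `ϖ` is replaced by the right side of its own equation to keep
  -- the map contracting. The term `ϖ · ϖ` in `den` is treated in the same way.
  let vct : A⟦X⟧ → A⟦X⟧ → (β → A⟦X⟧) → (β → A⟦X⟧) → β → A⟦X⟧ := fun q κ e ϖ i =>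
    d.powerSeries (cov q e i) - PowerSeries.X * (constVec u ᵥ* V κ e ϖ) i
  let den : A⟦X⟧ → A⟦X⟧ → (β → A⟦X⟧) → (β → A⟦X⟧) → A⟦X⟧ := fun q κ e ϖ =>
    half A⟦X⟧ * (cov q e ⬝ᵥ cov q e - PowerSeries.X * (q ^ 2 + e ⬝ᵥ e) +
      PowerSeries.X * (PowerSeries.X * (κ ^ 2 * ((e ⬝ᵥ e) * (ϖ ⬝ᵥ ϖ) - (e ⬝ᵥ ϖ) ^ 2))))
  let T : (Bool ⊕ β ⊕ β → A⟦X⟧) → Bool ⊕ β ⊕ β → A⟦X⟧ := fun x =>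
    let q := x (.inl true); let κ := x (.inl false)
    let e := fun i => x (.inr (.inl i)); let ϖ := fun i => x (.inr (.inr i))
    Sum.elim (fun b => if b then den q κ e ϖ else 1 - PowerSeries.X * (q * κ))
      (Sum.elim (vct q κ e ϖ) (cov q e))
  obtain ⟨x, hx⟩ := AgreeBelow.exists_fixed_point T (by
    intro n x y h
    set q := x (.inl true) with hq
    set κ := x (.inl false) with hκ
    set e := fun i => x (.inr (.inl i)) with he
    set ϖ := fun i => x (.inr (.inr i)) with hϖ
    set q' := y (.inl true) with hq'
    set κ' := y (.inl false) with hκ'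
    set e' := fun i => y (.inr (.inl i)) with he'
    set ϖ' := fun i => y (.inr (.inr i)) with hϖ'
    have aq : AgreeBelow n q q' := h _
    have aκ : AgreeBelow n κ κ' := h _
    have ae : ∀ i, AgreeBelow n (e i) (e' i) := fun i => h _
    have aϖ : ∀ i, AgreeBelow n (ϖ i) (ϖ' i) := fun i => h _
    have aV : ∀ i j, AgreeBelow n (V κ e ϖ i j) (V κ' e' ϖ' i j) := fun i j =>
      aκ.mul (((ae i).mul (aϖ j)).sub ((aϖ i).mul (ae j)))
    have ac : ∀ i, AgreeBelow (n + 1) (cov q e i) (cov q' e' i) := fun i =>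
      AgreeBelow.rfl'.add (((ae i).derivation d).add (aq.mul .rfl')).X_mul
    have av : ∀ i, AgreeBelow (n + 1) (vct q κ e ϖ i) (vct q' κ' e' ϖ' i) := fun i =>
      ((ac i).derivation d).sub
        (AgreeBelow.dotProduct (fun _ => .rfl') fun j => aV j i).X_mul
    have aee := AgreeBelow.dotProduct ae ae
    have aeϖ := AgreeBelow.dotProduct ae aϖ
    have aϖϖ := AgreeBelow.dotProduct aϖ aϖ
    have ad : AgreeBelow (n + 1) (den q κ e ϖ) (den q' κ' e' ϖ') := by
      simp only [den, pow_two]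
      exact AgreeBelow.rfl'.mul (((AgreeBelow.dotProduct ac ac).sub
        ((aq.mul aq).add aee).X_mul).add ((AgreeBelow.X_mul
          ((aκ.mul aκ).mul ((aee.mul aϖϖ).sub (aeϖ.mul aeϖ)))).mono (Nat.le_succ n)).X_mul)
    rintro ((_ | _) | i | i)
    · exact AgreeBelow.rfl'.sub (aq.mul aκ).X_mul
    · exact ad
    · exact av i
    · exact ac i)
  set q := x (.inl true) with hq
  set κ := x (.inl false) with hκ
  set e := fun i => x (.inr (.inl i)) with he
  set ϖ := fun i => x (.inr (.inr i)) with hϖ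
  have e₁ : den q κ e ϖ = q := congrFun hx (.inl true)
  have e₂ : 1 - PowerSeries.X * (q * κ) = κ := congrFun hx (.inl false)
  have e₃ : (fun i => d.powerSeries (cov q e i) - PowerSeries.X * (constVec u ᵥ* V κ e ϖ) i) = e :=
    funext fun i => congrFun hx (.inr (.inl i))
  have e₄ : cov q e = ϖ := funext fun i => congrFun hx (.inr (.inr i))
  refine ⟨q, κ, e, ϖ, V κ e ϖ, ?_, rfl, ?_, e₄.symm, ?_⟩
  · linear_combination -e₂
  · simp only [den, e₄] at e₁
    linear_combination (-2 : A⟦X⟧) * e₁ + (ϖ ⬝ᵥ ϖ - PowerSeries.X * (q ^ 2 + e ⬝ᵥ e) +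
      PowerSeries.X * (PowerSeries.X * (κ ^ 2 * ((e ⬝ᵥ e) * (ϖ ⬝ᵥ ϖ) - (e ⬝ᵥ ϖ) ^ 2)))) *
      two_mul_half A⟦X⟧
  · rw [e₄] at e₃
    exact e₃.symm

variable {d} {u : β → A} {q κ : A⟦X⟧} {e ϖ : β → A⟦X⟧} {V : Matrix β β A⟦X⟧}

theorem IsResolvent.vecMul (h : IsResolvent d u q κ e ϖ V) :
    constVec u ᵥ* V = κ • ((constVec u ⬝ᵥ e) • ϖ - (constVec u ⬝ᵥ ϖ) • e) := by
  rw [h.plucker, vecMul_smul, wedge, vecMul_sub, vecMul_vecMulVec, vecMul_vecMulVec]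

theorem IsResolvent.norm' (h : IsResolvent d u q κ e ϖ V) :
    (1 + PowerSeries.X * q) ^ 2 + PowerSeries.X ^ 2 * (e ⬝ᵥ e) - PowerSeries.X * (ϖ ⬝ᵥ ϖ) -
      PowerSeries.X ^ 3 * (κ ^ 2 * ((e ⬝ᵥ e) * (ϖ ⬝ᵥ ϖ) - (e ⬝ᵥ ϖ) ^ 2)) = 1 := by
  linear_combination (PowerSeries.X : A⟦X⟧) * h.norm

theorem IsResolvent.deriv_vector (h : IsResolvent d u q κ e ϖ V) :
    (PowerSeries.X : A⟦X⟧) • d.powerSeries.vec e =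
      ϖ - (1 + PowerSeries.X * q) • constVec u := by
  conv_rhs => rw [h.covector]
  rw [add_smul, one_smul, mul_smul, smul_add]
  abel

theorem IsResolvent.deriv_covector (h : IsResolvent d u q κ e ϖ V) :
    d.powerSeries.vec ϖ = e + (PowerSeries.X * κ : A⟦X⟧) •
      ((constVec u ⬝ᵥ e) • ϖ - (constVec u ⬝ᵥ ϖ) • e) := by
  have := h.vector
  rw [h.vecMul, ← mul_smul, eq_sub_iff_add_eq] at this
  exact this.symm

theorem IsResolvent.deriv_unit (h : IsResolvent d u q κ e ϖ V) :
    d.powerSeries κ = -κ ^ 2 * (PowerSeries.X * d.powerSeries q) := by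
  have := congrArg d.powerSeries h.unit
  rw [Derivation.leibniz, map_add, Derivation.powerSeries_X_mul, Derivation.map_one_eq_zero] at this
  simp only [smul_eq_mul, zero_add] at this
  linear_combination κ * this - d.powerSeries κ * h.unit

/-- The density `q` is a primitive of `u · e`. -/
theorem IsResolvent.deriv_density [IsDomain A] (h : IsResolvent d u q κ e ϖ V) :
    d.powerSeries q = constVec u ⬝ᵥ e := by
  have h1 := h.deriv_vector
  have h2 := h.deriv_covector
  have hκ := h.deriv_unit
  have hk := h.unit
  have hn := congrArg d.powerSeries h.norm'
  have hδz : d.powerSeries (PowerSeries.X : A⟦X⟧) = 0 := d.powerSeries_X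
  set δ := d.powerSeries with hδ
  set z : A⟦X⟧ := PowerSeries.X with hz
  set c := constVec u with hc
  have hee : z * δ (e ⬝ᵥ e) = 2 * (e ⬝ᵥ ϖ - (1 + z * q) * (c ⬝ᵥ e)) := by
    rw [δ.dotProduct, dotProduct_comm e, ← two_mul, mul_left_comm, ← smul_eq_mul z,
      ← smul_dotProduct, h1, sub_dotProduct, smul_dotProduct, smul_eq_mul, dotProduct_comm ϖ]
  have hϖϖ : δ (ϖ ⬝ᵥ ϖ) = 2 * (e ⬝ᵥ ϖ +
      z * κ * ((c ⬝ᵥ e) * (ϖ ⬝ᵥ ϖ) - (c ⬝ᵥ ϖ) * (e ⬝ᵥ ϖ))) := by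
    rw [δ.dotProduct, dotProduct_comm ϖ, ← two_mul, h2]
    simp only [add_dotProduct, smul_dotProduct, sub_dotProduct, smul_eq_mul]
  have heϖ : z * δ (e ⬝ᵥ ϖ) = ϖ ⬝ᵥ ϖ - (1 + z * q) * (c ⬝ᵥ ϖ) + z * (e ⬝ᵥ e +
      z * κ * ((c ⬝ᵥ e) * (e ⬝ᵥ ϖ) - (c ⬝ᵥ ϖ) * (e ⬝ᵥ e))) := by
    rw [δ.dotProduct, mul_add, ← smul_eq_mul z, ← smul_dotProduct, h1, h2]
    simp only [sub_dotProduct, smul_dotProduct, dotProduct_add, dotProduct_smul, dotProduct_sub,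
      smul_eq_mul]
  simp only [map_sub, map_add, Derivation.leibniz, Derivation.leibniz_pow, hδz, hκ,
    Derivation.map_one_eq_zero, smul_eq_mul, nsmul_eq_mul, mul_zero, add_zero, zero_add,
    smul_zero] at hn
  push_cast at hn
  set E := e ⬝ᵥ e
  set F := ϖ ⬝ᵥ ϖ
  set G := e ⬝ᵥ ϖ
  -- The derivative of `norm'`, after insertion of the equations for `D e`, `D ϖ` and `D κ`, is a
  -- multiple of the defect `D q - u · e`.
  have key : (2 * (1 + z * q) + 2 * z ^ 3 * κ ^ 3 * (E * F - G ^ 2)) * (z * (δ q - c ⬝ᵥ e)) = 0 := by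
    linear_combination hn - z * hee + z * hϖϖ + z ^ 2 * κ ^ 2 * F * hee +
      z ^ 3 * κ ^ 2 * E * hϖϖ - 2 * z ^ 2 * κ ^ 2 * G * heϖ +
      (-2) * z ^ 2 * κ * ((c ⬝ᵥ e) * F - (c ⬝ᵥ ϖ) * G) * hk
  -- The constant coefficient of this series is `2`, so the factor can be cancelled.
  have hu : 2 * (1 + z * q) + 2 * z ^ 3 * κ ^ 3 * (E * F - G ^ 2) ≠ 0 := fun h0 => by
    have := congrArg PowerSeries.constantCoeff h0
    have h20 : (2 : A) ≠ 0 := fun h => by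
      have := two_mul_half A
      rw [h, zero_mul] at this
      exact zero_ne_one this
    simp [hz] at this
    exact h20 this
  have := (mul_eq_zero.mp ((mul_eq_zero.mp key).resolve_left hu)).resolve_left
    PowerSeries.X_ne_zero
  exact sub_eq_zero.mp this

/-- The bivector `-X * V` is a primitive of `u ∧ ϖ`. -/
theorem IsResolvent.deriv_bivector [IsDomain A] (h : IsResolvent d u q κ e ϖ V) :
    ((-PowerSeries.X : A⟦X⟧) • V).map d.powerSeries = wedge (constVec u) ϖ := by
  ext1 i j
  have h1 := fun i => congrFun h.deriv_vector i
  have h2 := fun i => congrFun h.deriv_covector i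
  have hκ := h.deriv_unit
  rw [h.deriv_density] at hκ
  simp only [Pi.smul_apply, Pi.sub_apply, Pi.add_apply, smul_eq_mul, Derivation.vec] at h1 h2
  have hL : ((-PowerSeries.X : A⟦X⟧) • V).map d.powerSeries i j =
      d.powerSeries (-(PowerSeries.X * (κ * (e i * ϖ j - ϖ i * e j)))) := by
    rw [h.plucker, ← neg_mul]
    rfl
  have hR : wedge (constVec u) ϖ i j = constVec u i * ϖ j - ϖ i * constVec u j := rfl
  rw [hL, hR, map_neg, Derivation.powerSeries_X_mul]
  simp only [Derivation.leibniz, map_sub, smul_eq_mul, h2, hκ]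
  -- `D κ = -κ² X (u · e)` cancels the multiple of `e ∧ ϖ` produced by `D ϖ`; what remains is `κ (1
  -- + X q) u ∧ ϖ = u ∧ ϖ`.
  linear_combination (-κ * ϖ j) * h1 i + κ * ϖ i * h1 j +
    (constVec u i * ϖ j - constVec u j * ϖ i) * h.unit

/-- The potentials of the bivector satisfy the equation of `D + u ⌋ D⁻¹(u ∧)`. -/
theorem IsResolvent.hGraph [IsDomain A] (h : IsResolvent d u q κ e ϖ V) :
    HGraph d.powerSeries (constVec u) ϖ ((-PowerSeries.X : A⟦X⟧) • V) e where
  deriv := h.deriv_bivector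
  skew := by
    rw [h.plucker, transpose_smul, transpose_smul, transpose_sub, transpose_vecMulVec,
      transpose_vecMulVec, ← smul_neg, ← smul_neg, neg_sub]
  eq := by
    conv_lhs => rw [h.vector]
    rw [vecMul_smul, neg_smul, sub_eq_add_neg]

end DifferentialPowerSeries

/-! ### Commutativity of the hierarchy -/

section LinearSystem

set_option linter.unusedSectionVars false

open scoped PowerSeries
open Matrix

variable {β B : Type*} [Fintype β] [CommRing B] [Algebra ℝ B]

/-- The linear system satisfied by the generating functions of the hierarchy. -/
structure LinearSystem (D : Derivation ℝ B B) (z : B) (c : β → B) (p : B) (e ϖ : β → B)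
    (W : Matrix β β B) : Prop where
  scalar : D p = z * (c ⬝ᵥ e)
  vector : z • D.vec e = ϖ - p • c
  covector : D.vec ϖ = e - c ᵥ* W
  bivector : W.map D = wedge c ϖ

theorem wedge_mulVec (a b x : β → B) : wedge a b *ᵥ x = (b ⬝ᵥ x) • a - (a ⬝ᵥ x) • b := by
  rw [wedge, sub_mulVec, vecMulVec_mulVec, vecMulVec_mulVec]
  simp

theorem wedge_mul (a b : β → B) (M : Matrix β β B) :
    wedge a b * M = vecMulVec a (b ᵥ* M) - vecMulVec b (a ᵥ* M) := by
  rw [wedge, sub_mul, vecMulVec_mul, vecMulVec_mul]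

theorem mul_wedge (a b : β → B) (M : Matrix β β B) :
    M * wedge a b = vecMulVec (M *ᵥ a) b - vecMulVec (M *ᵥ b) a := by
  rw [wedge, mul_sub, mul_vecMulVec, mul_vecMulVec]

theorem vecMul_skew {W : Matrix β β B} (h : Wᵀ = -W) (x : β → B) : x ᵥ* W = -(W *ᵥ x) := by
  rw [← mulVec_transpose, h, neg_mulVec]

variable {D δ δ' : Derivation ℝ B B} {z : B} {c : β → B} {p : B} {e ϖ : β → B}
  {W : Matrix β β B}

/-- Variations of a solution of the linear system along two consecutive flows combine to a
solution of the same system. -/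
theorem LinearSystem.of_flow (h : LinearSystem D z c p e ϖ W) (hW : Wᵀ = -W)
    (hz : D z = 0) (hδz : δ z = 0) (hδz' : δ' z = 0) (hδ : ∀ f, δ (D f) = D (δ f))
    (hδ' : ∀ f, δ' (D f) = D (δ' f)) {y y' ϖ' : β → B} {q' : B} {W' : Matrix β β B}
    (hc : δ.vec c = y) (hc' : δ'.vec c = y') (hy : D.vec y = ϖ' - q' • c)
    (hϖ' : D.vec ϖ' = y' - c ᵥ* W') (hq' : D q' = c ⬝ᵥ y) (hDW' : W'.map D = wedge c ϖ')
    (hW' : W'ᵀ = -W') :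
    LinearSystem D z c (δ p - z * δ' p + z ^ 2 * (e ⬝ᵥ ϖ') - z * (ϖ ⬝ᵥ y))
      (δ.vec e - z • δ'.vec e - (p • ϖ' - q' • ϖ + z • (W' *ᵥ e) - W *ᵥ y))
      (δ.vec ϖ - z • δ'.vec ϖ - (p • y - (z * q') • e + z • (W' *ᵥ ϖ - W *ᵥ ϖ')))
      (W.map δ - z • W.map δ' + z • (wedge e y - wedge ϖ ϖ' + (W * W' - W' * W))) := by
  -- Varying the system along `δ - z δ'` leaves source terms with `y` and `y'`. The corrections,
  -- bilinear in `(p, e, ϖ, W)` and the flow data `(q', y, ϖ', W')`, are chosen to absorb them, as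
  -- in a zero-curvature equation. The varied system is prepared first.
  have hDp : ∀ (d : Derivation ℝ B B), (∀ f, d (D f) = D (d f)) → d z = 0 →
      D (d p) = z * (d.vec c ⬝ᵥ e + c ⬝ᵥ d.vec e) := fun d hd hdz => by
    rw [← hd, h.scalar, Derivation.leibniz, hdz, d.dotProduct]; simp
  have hDe : ∀ (d : Derivation ℝ B B), (∀ f, d (D f) = D (d f)) → d z = 0 →
      z • D.vec (d.vec e) = d.vec ϖ - d p • c - p • d.vec c := fun d hd hdz => by
    have := congrArg d.vec h.vector
    rw [d.vec_smul, hdz, zero_smul, zero_add, D.vec_comm hd, sub_eq_add_neg ϖ, d.vec_add] at this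
    rw [this]
    have h2 : d.vec (-(p • c)) = -(d.vec (p • c)) := funext fun i => map_neg d _
    rw [h2, d.vec_smul]
    abel
  have hDϖ : ∀ (d : Derivation ℝ B B), (∀ f, d (D f) = D (d f)) →
      D.vec (d.vec ϖ) = d.vec e - d.vec c ᵥ* W - c ᵥ* W.map d := fun d hd => by
    rw [← D.vec_comm hd, h.covector]
    have h2 : d.vec (e - c ᵥ* W) = d.vec e - d.vec (c ᵥ* W) := funext fun i => map_sub d _ _
    rw [h2, d.vec_vecMul]
    abel
  have hDW : ∀ (d : Derivation ℝ B B), (∀ f, d (D f) = D (d f)) →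
      (W.map d).map D = wedge (d.vec c) ϖ + wedge c (d.vec ϖ) := fun d hd => by
    rw [D.map_comm hd, h.bivector, d.map_wedge]
  have hzD : ∀ f, D (z * f) = z * D f := fun f => by
    rw [Derivation.leibniz, hz, smul_zero, add_zero, smul_eq_mul]
  have hϖ : D.vec ϖ = e + W *ᵥ c := by rw [h.covector, vecMul_skew hW, sub_neg_eq_add]
  rw [vecMul_skew hW', sub_neg_eq_add] at hϖ'
  have e1 : ∀ i, z * D (e i) = ϖ i - p * c i := fun i => congrFun h.vector i
  have e2 : ∀ i, D (ϖ i) = e i + (W *ᵥ c) i := fun i => congrFun hϖ i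
  have e3 : ∀ i, D (y i) = ϖ' i - q' * c i := fun i => congrFun hy i
  have e4 : ∀ i, D (ϖ' i) = y' i + (W' *ᵥ c) i := fun i => congrFun hϖ' i
  have m1 : ∀ i, z * D ((W' *ᵥ e) i) = z * ((ϖ' ⬝ᵥ e) * c i - (c ⬝ᵥ e) * ϖ' i) +
      (W' *ᵥ ϖ) i - p * (W' *ᵥ c) i := fun i => by
    have h1 : z • D.vec (W' *ᵥ e) =
        z • ((ϖ' ⬝ᵥ e) • c - (c ⬝ᵥ e) • ϖ') + (W' *ᵥ ϖ - p • (W' *ᵥ c)) := by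
      rw [D.vec_mulVec, smul_add, ← mulVec_smul W' z, h.vector, hDW', wedge_mulVec, mulVec_sub,
        mulVec_smul]
    rw [show z * D ((W' *ᵥ e) i) = (z • D.vec (W' *ᵥ e)) i from rfl, h1]
    exact (add_sub_assoc _ _ _).symm
  have m3 : ∀ i, D ((W *ᵥ y) i) = (ϖ ⬝ᵥ y) * c i - (c ⬝ᵥ y) * ϖ i +
      ((W *ᵥ ϖ') i - q' * (W *ᵥ c) i) := fun i => by
    have h1 : D.vec (W *ᵥ y) =
        ((ϖ ⬝ᵥ y) • c - (c ⬝ᵥ y) • ϖ) + (W *ᵥ ϖ' - q' • (W *ᵥ c)) := by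
      rw [D.vec_mulVec, hy, h.bivector, wedge_mulVec, mulVec_sub, mulVec_smul]
    exact congrFun h1 i
  have m4 : ∀ i, D ((W' *ᵥ ϖ) i) = (ϖ' ⬝ᵥ ϖ) * c i - (c ⬝ᵥ ϖ) * ϖ' i +
      ((W' *ᵥ e) i + (W' *ᵥ (W *ᵥ c)) i) := fun i => by
    have h1 : D.vec (W' *ᵥ ϖ) =
        ((ϖ' ⬝ᵥ ϖ) • c - (c ⬝ᵥ ϖ) • ϖ') + (W' *ᵥ e + W' *ᵥ (W *ᵥ c)) := by
      rw [D.vec_mulVec, hϖ, hDW', wedge_mulVec, mulVec_add]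
    exact congrFun h1 i
  have m5 : ∀ i, D ((W *ᵥ ϖ') i) = (ϖ ⬝ᵥ ϖ') * c i - (c ⬝ᵥ ϖ') * ϖ i +
      ((W *ᵥ y') i + (W *ᵥ (W' *ᵥ c)) i) := fun i => by
    have h1 : D.vec (W *ᵥ ϖ') =
        ((ϖ ⬝ᵥ ϖ') • c - (c ⬝ᵥ ϖ') • ϖ) + (W *ᵥ y' + W *ᵥ (W' *ᵥ c)) := by
      rw [D.vec_mulVec, hϖ', h.bivector, wedge_mulVec, mulVec_add]
    exact congrFun h1 i
  have m6 : ∀ i j, D ((W * W') i j) = -(c i * (W' *ᵥ ϖ) j) + ϖ i * (W' *ᵥ c) j +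
      ((W *ᵥ c) i * ϖ' j - (W *ᵥ ϖ') i * c j) := fun i j => by
    have h1 : (W * W').map D = vecMulVec c (-(W' *ᵥ ϖ)) - vecMulVec ϖ (-(W' *ᵥ c)) +
        (vecMulVec (W *ᵥ c) ϖ' - vecMulVec (W *ᵥ ϖ') c) := by
      rw [D.map_matrix_mul, h.bivector, hDW', wedge_mul, mul_wedge, vecMul_skew hW',
        vecMul_skew hW']
    refine (congrFun (congrFun h1 i) j).trans ?_
    simp only [Matrix.add_apply, Matrix.sub_apply, vecMulVec_apply, Pi.neg_apply]
    ring
  have m7 : ∀ i j, D ((W' * W) i j) = -(c i * (W *ᵥ ϖ') j) + ϖ' i * (W *ᵥ c) j +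
      ((W' *ᵥ c) i * ϖ j - (W' *ᵥ ϖ) i * c j) := fun i j => by
    have h1 : (W' * W).map D = vecMulVec c (-(W *ᵥ ϖ')) - vecMulVec ϖ' (-(W *ᵥ c)) +
        (vecMulVec (W' *ᵥ c) ϖ - vecMulVec (W' *ᵥ ϖ) c) := by
      rw [D.map_matrix_mul, h.bivector, hDW', wedge_mul, mul_wedge, vecMul_skew hW,
        vecMul_skew hW]
    refine (congrFun (congrFun h1 i) j).trans ?_
    simp only [Matrix.add_apply, Matrix.sub_apply, vecMulVec_apply, Pi.neg_apply]
    ring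
  refine ⟨?_, ?_, ?_, ?_⟩
  · have h1 : z * (D.vec e ⬝ᵥ ϖ') = ϖ ⬝ᵥ ϖ' - p * (c ⬝ᵥ ϖ') := by
      rw [← smul_eq_mul, ← smul_dotProduct, h.vector, sub_dotProduct, smul_dotProduct, smul_eq_mul]
    have h2 : e ⬝ᵥ (W' *ᵥ c) = -(c ⬝ᵥ (W' *ᵥ e)) := bil_skew hW' e c
    have h3 : (W *ᵥ c) ⬝ᵥ y = -(c ⬝ᵥ (W *ᵥ y)) := by
      rw [dotProduct_comm]; exact bil_skew hW y c
    rw [map_sub, map_add, map_sub, hzD, hzD, pow_two, mul_assoc, hzD, hzD, hDp δ hδ hδz,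
      hDp δ' hδ' hδz', D.dotProduct, D.dotProduct, hϖ, hϖ', hy, hc, hc']
    simp only [dotProduct_add, dotProduct_sub, dotProduct_smul, add_dotProduct, smul_eq_mul, h2, h3]
    rw [dotProduct_comm c ϖ, dotProduct_comm y e, dotProduct_comm y' e]
    linear_combination z * h1
  · funext i
    have h1 : z * D (δ (e i)) = δ (ϖ i) - δ p * c i - p * y i := by
      rw [← hc]; exact congrFun (hDe δ hδ hδz) i
    have h2 : z * D (δ' (e i)) = δ' (ϖ i) - δ' p * c i - p * y' i := by
      rw [← hc']; exact congrFun (hDe δ' hδ' hδz') i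
    simp only [Derivation.vec, Pi.sub_apply, Pi.add_apply, Pi.smul_apply, smul_eq_mul, map_sub,
      map_add, hzD, Derivation.leibniz D p, Derivation.leibniz D q', h.scalar, hq', e2, e4, m3]
    rw [dotProduct_comm e ϖ']
    linear_combination h1 - z * h2 - z * m1 i
  · funext i
    have h1 : D (δ (ϖ i)) = δ (e i) + (W *ᵥ y) i - (c ᵥ* W.map δ) i := by
      have := congrFun (hDϖ δ hδ) i
      rw [hc, vecMul_skew hW, sub_neg_eq_add] at this
      exact this
    have h2 : D (δ' (ϖ i)) = δ' (e i) + (W *ᵥ y') i - (c ᵥ* W.map δ') i := by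
      have := congrFun (hDϖ δ' hδ') i
      rw [hc', vecMul_skew hW, sub_neg_eq_add] at this
      exact this
    have h3 : c ᵥ* (W.map δ - z • W.map δ' + z • (wedge e y - wedge ϖ ϖ' + (W * W' - W' * W))) =
        c ᵥ* W.map δ - z • (c ᵥ* W.map δ') + z • (((c ⬝ᵥ e) • y - (c ⬝ᵥ y) • e) -
          ((c ⬝ᵥ ϖ) • ϖ' - (c ⬝ᵥ ϖ') • ϖ) + (W' *ᵥ (W *ᵥ c) - W *ᵥ (W' *ᵥ c))) := by
      simp only [vecMul_add, vecMul_sub, vecMul_smul, wedge, vecMul_vecMulVec, ← vecMul_vecMul]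
      simp only [vecMul_skew hW, vecMul_skew hW', mulVec_neg, neg_neg]
    rw [h3]
    simp only [Derivation.vec, Pi.sub_apply, Pi.add_apply, Pi.smul_apply, smul_eq_mul, map_sub,
      map_add, hzD, Derivation.leibniz D p, Derivation.leibniz D (z * q'), h.scalar, hq', e3,
      m4, m5, h1, h2]
    rw [dotProduct_comm ϖ' ϖ]
    linear_combination q' * e1 i
  · ext1 i j
    have h1 : D (δ (W i j)) = (y i * ϖ j - ϖ i * y j) + (c i * δ (ϖ j) - δ (ϖ i) * c j) := by
      rw [← hc]; exact congrFun (congrFun (hDW δ hδ) i) j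
    have h2 : D (δ' (W i j)) = (y' i * ϖ j - ϖ i * y' j) + (c i * δ' (ϖ j) - δ' (ϖ i) * c j) := by
      rw [← hc']; exact congrFun (congrFun (hDW δ' hδ') i) j
    have h3 : (W.map δ - z • W.map δ' + z • (wedge e y - wedge ϖ ϖ' + (W * W' - W' * W))) i j =
        δ (W i j) - z * δ' (W i j) + z * ((e i * y j - y i * e j) - (ϖ i * ϖ' j - ϖ' i * ϖ j) +
          ((W * W') i j - (W' * W) i j)) := rfl
    rw [map_apply, h3]
    simp only [wedge, Matrix.sub_apply, vecMulVec_apply, Derivation.vec, Pi.sub_apply,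
      Pi.add_apply, Pi.smul_apply, smul_eq_mul, map_sub, map_add, hzD, Derivation.leibniz, e2, e3,
      e4, m6, m7, h1, h2]
    linear_combination y j * e1 i - y i * e1 j

end LinearSystem

/-! ### Constant terms and uniqueness for the linear system -/

section Field

set_option linter.unusedSectionVars false

open scoped PowerSeries
open Matrix

variable {β : Type} [Fintype β]

/-- The field of flow variables. -/
noncomputable abbrev fieldVar (β : Type) : β → DiffPoly β := fun i => X (i, 0)

/-- The constant terms of the coefficients of a power series. -/
noncomputable abbrev constantTerms : (DiffPoly β)⟦X⟧ →+* ℝ⟦X⟧ := PowerSeries.map constantCoeff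

theorem constantTerms_totalD (f : (DiffPoly β)⟦X⟧) :
    constantTerms ((totalD β).powerSeries f) = 0 := by
  ext n
  simp

theorem constantTerms_evolve {Y : β → DiffPoly β} (hY : ∀ a, constantCoeff (Y a) = 0)
    (f : (DiffPoly β)⟦X⟧) : constantTerms ((evolve Y).powerSeries f) = 0 := by
  ext n
  simp [constantCoeff_evolve hY]

theorem constantTerms_field (i : β) : constantTerms (constVec (fieldVar β) i) = 0 := by
  simp [constVec]

/-- Once the coefficients of `e` below order `n` vanish, the terms with a factor `X` drop out at
order `n`. Successively `D p = 0`, `ϖ = p c`, `D W = c ∧ ϖ` and the covector equation give zero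
there, the constants of integration being excluded by hypothesis. -/
theorem LinearSystem.vector_eq_zero {p : (DiffPoly β)⟦X⟧} {e ϖ : β → (DiffPoly β)⟦X⟧}
    {W : Matrix β β (DiffPoly β)⟦X⟧}
    (h : LinearSystem (totalD β).powerSeries PowerSeries.X (constVec (fieldVar β)) p e ϖ W)
    (hp : constantTerms p = 0) (hW : ∀ i j, constantTerms (W i j) = 0) : e = 0 := by
  have hp' : ∀ n, constantCoeff (PowerSeries.coeff n p) = 0 := fun n => by
    simpa using congrArg (PowerSeries.coeff n) hp
  have hW' : ∀ n i j, constantCoeff (PowerSeries.coeff n (W i j)) = 0 := fun n i j => by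
    simpa using congrArg (PowerSeries.coeff n) (hW i j)
  have key : ∀ n, (PowerSeries.coeff n (PowerSeries.X * (constVec (fieldVar β) ⬝ᵥ e)) = 0 ∧
      ∀ i, PowerSeries.coeff n (PowerSeries.X * (totalD β).powerSeries (e i)) = 0) →
      ∀ i, PowerSeries.coeff n (e i) = 0 := by
    rintro n ⟨h1, h2⟩ i
    have hpn : PowerSeries.coeff n p = 0 := by
      have := congrArg (PowerSeries.coeff n) h.scalar
      rw [Derivation.coeff_powerSeries, h1] at this
      exact eq_zero_of_totalD_eq_zero this (hp' n)
    have hϖn : ∀ i, PowerSeries.coeff n (ϖ i) = 0 := fun i => by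
      have := congrArg (PowerSeries.coeff n) (congrFun h.vector i)
      rw [Pi.smul_apply, smul_eq_mul, h2, Pi.sub_apply, map_sub, Pi.smul_apply, smul_eq_mul,
        PowerSeries.coeff_mul_C, hpn, zero_mul, sub_zero] at this
      exact this.symm
    have hWn : ∀ i j, PowerSeries.coeff n (W i j) = 0 := fun i j => by
      have := congrArg (PowerSeries.coeff n) (congrFun (congrFun h.bivector i) j)
      have h3 : wedge (constVec (fieldVar β)) ϖ i j =
        PowerSeries.C (fieldVar β i) * ϖ j - ϖ i * PowerSeries.C (fieldVar β j) := rfl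
      rw [h3, map_apply, Derivation.coeff_powerSeries, map_sub, PowerSeries.coeff_mul_C,
        PowerSeries.coeff_C_mul, hϖn, hϖn, mul_zero, zero_mul, sub_zero] at this
      exact eq_zero_of_totalD_eq_zero this (hW' n i j)
    have := congrArg (PowerSeries.coeff n) (congrFun h.covector i)
    rw [Pi.sub_apply, map_sub, Derivation.vec, Derivation.coeff_powerSeries, hϖn, map_zero,
      eq_comm, sub_eq_zero] at this
    rw [this, vecMul, dotProduct, map_sum]
    refine Finset.sum_eq_zero fun j _ => ?_
    rw [PowerSeries.coeff_C_mul, hWn, mul_zero]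
  funext i
  ext1 n
  induction n generalizing i with
  | zero => exact key 0 ⟨by simp, fun i => by simp⟩ i
  | succ n ih =>
    refine key _ ⟨?_, fun i => ?_⟩ i
    · rw [PowerSeries.coeff_succ_X_mul, dotProduct, map_sum]
      refine Finset.sum_eq_zero fun j _ => ?_
      rw [PowerSeries.coeff_C_mul, ih j, Pi.zero_apply, map_zero, mul_zero]
    · rw [PowerSeries.coeff_succ_X_mul, Derivation.coeff_powerSeries, ih i, Pi.zero_apply,
        map_zero, map_zero]

variable {q κ : (DiffPoly β)⟦X⟧} {e ϖ : β → (DiffPoly β)⟦X⟧} {V : Matrix β β (DiffPoly β)⟦X⟧}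

theorem IsResolvent.constantTerms_covector
    (h : IsResolvent (totalD β) (fieldVar β) q κ e ϖ V) (i : β) : constantTerms (ϖ i) = 0 := by
  have := congrFun h.covector i
  rw [Pi.add_apply, Pi.smul_apply, Pi.add_apply, Pi.smul_apply] at this
  rw [this, map_add, smul_eq_mul, map_mul, map_add, constantTerms_field, smul_eq_mul, map_mul,
    constantTerms_field, Derivation.vec, constantTerms_totalD]
  simp

theorem IsResolvent.constantTerms_vector
    (h : IsResolvent (totalD β) (fieldVar β) q κ e ϖ V) (i : β) : constantTerms (e i) = 0 := by
  have := congrFun h.vector i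
  rw [Pi.sub_apply, Pi.smul_apply] at this
  rw [this, map_sub, smul_eq_mul, map_mul, Derivation.vec, constantTerms_totalD,
    Matrix.vecMul, _root_.dotProduct, map_sum, Finset.sum_eq_zero fun j _ => by
      rw [map_mul, constantTerms_field, zero_mul]]
  simp

theorem IsResolvent.constantTerms_bivector
    (h : IsResolvent (totalD β) (fieldVar β) q κ e ϖ V) (i j : β) :
    constantTerms (V i j) = 0 := by
  have : V i j = κ * (e i * ϖ j - ϖ i * e j) := by rw [h.plucker]; rfl
  rw [this, map_mul, map_sub, map_mul, map_mul, h.constantTerms_covector,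
    h.constantTerms_covector]
  simp

theorem constantTerms_dotProduct {x y : β → (DiffPoly β)⟦X⟧}
    (hx : ∀ i, constantTerms (x i) = 0) : constantTerms (x ⬝ᵥ y) = 0 := by
  rw [dotProduct, map_sum]
  exact Finset.sum_eq_zero fun i _ => by rw [map_mul, hx, zero_mul]

/-- On constant terms the norm condition becomes `(2 + X q) q = 0`, with a nonzero first factor. -/
theorem IsResolvent.constantTerms_density
    (h : IsResolvent (totalD β) (fieldVar β) q κ e ϖ V) : constantTerms q = 0 := by
  have := congrArg constantTerms h.norm
  rw [map_sub, map_sub, map_add, map_mul, map_mul _ PowerSeries.X, map_add, map_mul,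
    map_mul _ (κ ^ 2), map_sub, map_mul, map_pow, map_pow, map_pow, map_pow,
    constantTerms_dotProduct h.constantTerms_vector,
    constantTerms_dotProduct h.constantTerms_vector,
    constantTerms_dotProduct h.constantTerms_covector] at this
  have h2 : (2 + PowerSeries.X * constantTerms q) * constantTerms q = 0 := by
    rw [PowerSeries.map_X, map_ofNat, map_zero] at this
    linear_combination this
  refine (mul_eq_zero.mp h2).resolve_left fun h0 => ?_
  have := congrArg PowerSeries.constantCoeff h0
  rw [map_add, map_mul, PowerSeries.constantCoeff_X, zero_mul, add_zero, map_ofNat, map_zero] at this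
  exact two_ne_zero this

end Field

/-! ### The variational structure of the hierarchy -/

section RankTwo

set_option linter.unusedSectionVars false

open Matrix

variable {ι B : Type*} [Fintype ι] [CommRing B] [Algebra ℝ B]

theorem bil_self_skew {N : Matrix ι ι B} (h : Nᵀ = -N) (x : ι → B) : bil N x x = 0 := by
  have := bil_skew h x x
  linear_combination half B * this - bil N x x * two_mul_half B

/-- A decomposable bivector has rank two, so compressing a skew form to its plane can only rescale
it. The cubic relation `M³ = z M` rests on this. -/
theorem wedge_mul_mul_wedge {N : Matrix ι ι B} (h : Nᵀ = -N) (r t : ι → B) :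
    wedge r t * N * wedge r t = bil N t r • wedge r t := by
  have e1 : ∀ x y x' y' : ι → B, vecMulVec x y * N * vecMulVec x' y' =
      bil N y x' • vecMulVec x y' := fun x y x' y' => by
    rw [vecMulVec_mul, vecMulVec_mul_vecMulVec, ← dotProduct_mulVec, vecMulVec_smul]; rfl
  simp only [wedge, sub_mul, mul_sub, e1, bil_self_skew h, bil_skew h r t]
  module

/-- A cyclic rearrangement of the derivative of the invariant two-form. -/
theorem trace_two_form {M P Q : Matrix ι ι B} {z : B} (L Y Z : Matrix ι ι B)
    (hP : M * P * M = 0) (hQ : M * Q * M = 0) (hP' : P * (M * M) + M * M * P = z • P)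
    (hQ' : Q * (M * M) + M * M * Q = z • Q) :
    trace ((L * M - M * L) * (P * Q - Q * P) +
      M * ((Y * M - M * Y + (L * P - P * L)) * Q + P * (Z * M - M * Z + (L * Q - Q * L)) -
        ((Z * M - M * Z + (L * Q - Q * L)) * P + Q * (Y * M - M * Y + (L * P - P * L))))) =
      z * trace (Z * P) - z * trace (Y * Q) := by
  -- `L` acts by simultaneous conjugation, so its contribution is the trace of a commutator. The `Y`
  -- and `Z` contributions have the same shape, and cyclicity with the two relations for the
  -- variations evaluates each of them.
  have aux : ∀ {Q : Matrix ι ι B}, M * Q * M = 0 → Q * (M * M) + M * M * Q = z • Q → ∀ Y,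
      trace (M * (Y * M - M * Y) * Q - M * Q * (Y * M - M * Y)) = - (z * trace (Y * Q)) := by
    intro Q h h' Y
    have e1 : trace (M * Y * M * Q) = trace (Y * (M * Q * M)) := by
      rw [mul_assoc, mul_assoc, trace_mul_comm M, mul_assoc, mul_assoc]
    have e2 : trace (M * M * Y * Q) = trace (Y * (Q * (M * M))) := by
      rw [mul_assoc, trace_mul_comm (M * M), mul_assoc]
    have e3 : trace (M * Q * Y * M) = trace (Y * (M * M * Q)) := by
      rw [mul_assoc, trace_mul_comm (M * Q), mul_assoc, mul_assoc]
    have e4 : trace (M * Q * M * Y) = trace (Y * (M * Q * M)) := trace_mul_comm _ _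
    have : M * (Y * M - M * Y) * Q - M * Q * (Y * M - M * Y) =
        M * Y * M * Q - M * M * Y * Q - (M * Q * Y * M - M * Q * M * Y) := by noncomm_ring
    rw [this, trace_sub, trace_sub, trace_sub, e1, e2, e3, e4, h]
    have h2 := congrArg (fun T => trace (Y * T)) h'
    simp only [mul_add, trace_add, Matrix.mul_smul, trace_smul, smul_eq_mul] at h2
    rw [mul_zero, trace_zero]
    linear_combination -h2
  have : (L * M - M * L) * (P * Q - Q * P) +
      M * ((Y * M - M * Y + (L * P - P * L)) * Q + P * (Z * M - M * Z + (L * Q - Q * L)) -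
        ((Z * M - M * Z + (L * Q - Q * L)) * P + Q * (Y * M - M * Y + (L * P - P * L)))) =
      (L * (M * (P * Q - Q * P)) - M * (P * Q - Q * P) * L) +
        (M * (Y * M - M * Y) * Q - M * Q * (Y * M - M * Y)) -
        (M * (Z * M - M * Z) * P - M * P * (Z * M - M * Z)) := by noncomm_ring
  rw [this, trace_sub, trace_add, trace_sub, trace_mul_comm L, sub_self, aux hQ hQ', aux hP hP']
  ring

variable [DecidableEq ι]

theorem Derivation.map_smul_matrix (d : Derivation ℝ B B) (c : B) (M : Matrix ι ι B) :
    (c • M).map d = d c • M + c • M.map d := by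
  ext i j
  simp only [map_apply, Matrix.smul_apply, Matrix.add_apply, smul_eq_mul, Derivation.leibniz]
  ring

theorem Derivation.map_sub_matrix (d : Derivation ℝ B B) (M N : Matrix ι ι B) :
    (M - N).map d = M.map d - N.map d := by
  ext i j
  exact map_sub d _ _

/-- For a bivector of constant norm evolving by infinitesimal isometries, the difference of the
contractions of two variations is a derivative. -/
theorem exists_derivation_eq_trace [IsDomain B] {D δ δ' : Derivation ℝ B B} {z : B} {g : ι → B}
    {S K : Matrix ι ι B} (hz0 : z ≠ 0) (hδz : δ z = 0) (hδz' : δ' z = 0)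
    (hg : D.vec g = 0) (hδg : δ.vec g = 0) (hδg' : δ'.vec g = 0)
    (hδ : ∀ f, δ (D f) = D (δ f)) (hδ' : ∀ f, δ' (D f) = D (δ' f))
    (hskew : Sᵀ = -S)
    (hrank : ∀ N : Matrix ι ι B, Nᵀ = -N → (2 : B) • (S * N * S) = trace (S * N) • S)
    (hnorm : trace (S * diagonal g * (S * diagonal g)) = 2 * z)
    (hD : z • S.map D = K * diagonal g * S - S * diagonal g * K) :
    ∃ Ω, D Ω = trace (K.map δ' * diagonal g * (S.map δ * diagonal g)) -
      trace (K.map δ * diagonal g * (S.map δ' * diagonal g)) := by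
  set G : Matrix ι ι B := diagonal g with hG
  have hGT : Gᵀ = G := diagonal_transpose g
  have two_ne : (2 : B) ≠ 0 := fun h0 => by
    have := two_mul_half B
    rw [h0, zero_mul] at this
    exact zero_ne_one this
  have hmapG : ∀ d : Derivation ℝ B B, d.vec g = 0 → ∀ T : Matrix ι ι B,
      (T * G).map d = T.map d * G := fun d hd T => by
    have : G.map d = 0 := by
      ext i j
      rw [map_apply, hG, diagonal_apply]
      split_ifs
      · exact congrFun hd i
      · exact map_zero d
    rw [d.map_matrix_mul, this, mul_zero, add_zero]
  have hcancel : ∀ T U : Matrix ι ι B, (2 : B) • T = (2 : B) • U → T = U := fun T U h => by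
    ext i j
    exact mul_left_cancel₀ two_ne (congrFun (congrFun h i) j)
  -- The rank-two relation for `N = G S G`, with `tr (M²) = 2 z` for `M = S G`.
  have hM3 : S * G * (S * G) * (S * G) = z • (S * G) := by
    refine hcancel _ _ ?_
    have hN : (G * S * G)ᵀ = -(G * S * G) := by
      rw [transpose_mul, transpose_mul, hGT, hskew, neg_mul, mul_neg, mul_assoc]
    have h1 := congrArg (· * G) (hrank (G * S * G) hN)
    have h2 : S * (G * S * G) = S * G * (S * G) := by noncomm_ring
    simp only [h2, hnorm, Matrix.smul_mul] at h1
    rw [← mul_assoc, h1, mul_smul]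
  -- For a variation `P` of `M`, constancy of the norm gives `tr (M P) = 0`, hence `M P M = 0` by
  -- rank two. Varying `M³ = z M` then gives `P M² + M² P = z P`.
  have facts : ∀ d : Derivation ℝ B B, d z = 0 → d.vec g = 0 →
      S * G * (S.map d * G) * (S * G) = 0 ∧
      S.map d * G * (S * G * (S * G)) + S * G * (S * G) * (S.map d * G) =
        z • (S.map d * G) := fun d hdz hdg => by
    have htr : trace (S * G * (S.map d * G)) = 0 := by
      have h1 := congrArg d hnorm
      rw [d.trace, d.map_matrix_mul, hmapG d hdg, trace_add, trace_mul_comm, ← two_mul,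
        two_mul z, map_add, hdz, add_zero] at h1
      exact (mul_eq_zero.mp h1).resolve_left two_ne
    have h0 : S * G * (S.map d * G) * (S * G) = 0 := by
      refine hcancel _ _ ?_
      have hN : (G * S.map d * G)ᵀ = -(G * S.map d * G) := by
        rw [transpose_mul, transpose_mul, hGT, d.map_skew hskew, neg_mul, mul_neg, mul_assoc]
      have h1 := congrArg (· * G) (hrank (G * S.map d * G) hN)
      have h2 : S * (G * S.map d * G) = S * G * (S.map d * G) := by noncomm_ring
      simp only [h2, htr, Matrix.smul_mul, zero_smul, zero_mul] at h1
      rw [← mul_assoc, h1, smul_zero]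
    refine ⟨h0, ?_⟩
    have h1 := congrArg (fun T => Matrix.map T d) hM3
    simp only [d.map_matrix_mul, d.map_smul_matrix, hdz, zero_smul, zero_add] at h1
    have hG0 : G.map d = 0 := by
      have := hmapG d hdg 1
      rw [one_mul] at this
      rw [this]
      have : (1 : Matrix ι ι B).map d = 0 := by
        ext i j
        rw [map_apply, one_apply]
        split_ifs <;> simp
      rw [this, zero_mul]
    simp only [hG0, mul_zero, add_zero] at h1
    rw [← h1, add_mul, h0]
    noncomm_ring
  obtain ⟨p1, p2⟩ := facts δ hδz hδg
  obtain ⟨q1, q2⟩ := facts δ' hδz' hδg'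
  have hDM : z • (S.map D * G) = K * G * (S * G) - S * G * (K * G) := by
    rw [← Matrix.smul_mul, hD, sub_mul]
    noncomm_ring
  have hDP : ∀ d : Derivation ℝ B B, (∀ f, d (D f) = D (d f)) → d z = 0 → d.vec g = 0 →
      z • ((S.map d).map D * G) = K.map d * G * (S * G) - S * G * (K.map d * G) +
        (K * G * (S.map d * G) - S.map d * G * (K * G)) := fun d hd hdz hdg => by
    have h1 := congrArg (fun T => Matrix.map T d) hDM
    simp only [d.map_smul_matrix, d.map_sub_matrix, hdz, zero_smul, zero_add] at h1
    rw [hmapG d hdg, d.map_matrix_mul (K * G), d.map_matrix_mul (S * G), hmapG d hdg, hmapG d hdg,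
      ← D.map_comm hd] at h1
    rw [h1]
    abel
  have key := trace_two_form (K * G) (K.map δ * G) (K.map δ' * G) p1 q1 p2 q2
  rw [← hDM, ← hDP δ hδ hδz hδg, ← hDP δ' hδ' hδz' hδg'] at key
  -- The form `tr (M [P, Q])`, invariant under conjugation, as for the symplectic form of a
  -- coadjoint orbit.
  refine ⟨trace (S * G * (S.map δ * G * (S.map δ' * G) - S.map δ' * G * (S.map δ * G))), ?_⟩
  -- The evolution equation only gives `z` times the derivative of `M`, so the identity is proved
  -- after multiplication by `z`.
  refine mul_left_cancel₀ hz0 ?_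
  rw [mul_sub z, ← key, ← smul_eq_mul, D.trace, ← trace_smul, D.map_matrix_mul (S * G),
    D.map_sub_matrix, D.map_matrix_mul (S.map δ * G), D.map_matrix_mul (S.map δ' * G), hmapG D hg, hmapG D hg, hmapG D hg]
  congr 1
  simp only [smul_add, smul_sub, Matrix.smul_mul, Matrix.mul_smul, mul_sub, mul_add]

end RankTwo

/-! ### Closedness of the covector fields -/

section Closed

open scoped PowerSeries
open Matrix

variable {β A : Type*} [Fintype β] [CommRing A] [Algebra ℝ A] [IsDomain A]
  {d : Derivation ℝ A A} {u : β → A} {q κ : A⟦X⟧} {e ϖ : β → A⟦X⟧} {V : Matrix β β A⟦X⟧}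

theorem bil_diagonal {ι B : Type*} [Fintype ι] [DecidableEq ι] [CommRing B]
    (W : Matrix ι ι B) (g x y : ι → B) :
    bil (diagonal g * W * diagonal g) x y = bil W (fun i => g i * x i) (fun i => g i * y i) := by
  have h : ∀ y : ι → B, diagonal g *ᵥ y = fun i => g i * y i :=
    fun y => funext fun i => mulVec_diagonal g y i
  have h' : x ᵥ* diagonal g = fun i => g i * x i := funext fun i => by
    rw [vecMul_diagonal, mul_comm]
  rw [bil, ← mulVec_mulVec, ← mulVec_mulVec, dotProduct_mulVec, h, h', bil]

/-- The Fréchet derivatives of the covector fields of the hierarchy are self-adjoint. -/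
theorem IsResolvent.exists_two_form (h : IsResolvent d u q κ e ϖ V) {δ δ' : Derivation ℝ A A}
    (hδ : ∀ f, δ (d f) = d (δ f)) (hδ' : ∀ f, δ' (d f) = d (δ' f)) :
    ∃ Ω, d.powerSeries Ω = 2 * PowerSeries.X ^ 2 *
      (constVec (δ.vec u) ⬝ᵥ δ'.powerSeries.vec ϖ - constVec (δ'.vec u) ⬝ᵥ δ.powerSeries.vec ϖ) := by
  classical
  set z : A⟦X⟧ := PowerSeries.X with hz
  set c := constVec u with hc
  set p : A⟦X⟧ := 1 + z * q with hp
  have hdz : ∀ d : Derivation ℝ A A, d.powerSeries z = 0 := fun d => d.powerSeries_X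
  -- Two extra coordinates make the bivector `κ (r ∧ t)` contain all the data: its entries are `-p`,
  -- `ϖ`, `e` and `V`.
  let r : Bool ⊕ β → A⟦X⟧ := Sum.elim (fun b => if b then p else 0) e
  let t : Bool ⊕ β → A⟦X⟧ := Sum.elim (fun b => if b then 0 else -p) ϖ
  -- `a ∧ b` generates the evolution for the metric `g`. It is affine in the field, which is what
  -- makes the contraction in `htrace` linear in the variation of `u`.
  let a : Bool ⊕ β → A⟦X⟧ := Sum.elim (fun b => if b then 0 else 1) (-c)
  let b : Bool ⊕ β → A⟦X⟧ := Sum.elim (fun b => if b then 1 else 0) 0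
  let g : Bool ⊕ β → A⟦X⟧ := Sum.elim (fun b => if b then 1 else -z) (fun _ => z ^ 2)
  let S : Matrix (Bool ⊕ β) (Bool ⊕ β) A⟦X⟧ := κ • wedge r t
  have hwedge : ∀ x y : Bool ⊕ β → A⟦X⟧, (wedge x y)ᵀ = -wedge x y := fun x y => by
    rw [transpose_sub, transpose_vecMulVec, transpose_vecMulVec, neg_sub]
  have hskew : Sᵀ = -S := by
    rw [transpose_smul, hwedge, smul_neg]
  have hg : ∀ d : Derivation ℝ A A, d.powerSeries.vec g = 0 := fun d => by
    funext i
    rcases i with (_ | _) | i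
    · simp [g, Derivation.vec, hdz]
    · simp [g, Derivation.vec]
    · simp [g, Derivation.vec, hdz]
  have hrank : ∀ N : Matrix (Bool ⊕ β) (Bool ⊕ β) A⟦X⟧, Nᵀ = -N →
      (2 : A⟦X⟧) • (S * N * S) = trace (S * N) • S := fun N hN => by
    rw [Matrix.smul_mul, Matrix.smul_mul, Matrix.mul_smul, wedge_mul_mul_wedge hN, trace_smul,
      trace_mul_skew hN]
    simp only [S, smul_smul, smul_eq_mul]
    congr 1
    ring
  have hGSG : ∀ W : Matrix (Bool ⊕ β) (Bool ⊕ β) A⟦X⟧, Wᵀ = -W →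
      (diagonal g * W * diagonal g)ᵀ = -(diagonal g * W * diagonal g) := fun W hW => by
    rw [transpose_mul, transpose_mul, diagonal_transpose, hW, neg_mul, mul_neg, mul_assoc]
  -- Up to sign, the Gram determinant of `r` and `t` for `g` is `z p²` times the left side of
  -- `norm'`.
  have hnorm : trace (S * diagonal g * (S * diagonal g)) = 2 * z := by
    rw [show S * diagonal g * (S * diagonal g) = S * (diagonal g * S * diagonal g) by noncomm_ring,
      show S * (diagonal g * S * diagonal g) = κ • (wedge r t * (diagonal g * S * diagonal g)) from
        Matrix.smul_mul _ _ _, trace_smul, trace_mul_skew (hGSG S hskew), bil_diagonal]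
    have h1 : ∀ x y, bil S x y = κ * ((x ⬝ᵥ r) * (t ⬝ᵥ y) - (x ⬝ᵥ t) * (r ⬝ᵥ y)) := fun x y => by
      rw [← bil_wedge]
      simp [S, bil, smul_mulVec]
    have e1 : (fun i => g i * t i) ⬝ᵥ r = z ^ 2 * (e ⬝ᵥ ϖ) := by
      simp only [dotProduct, g, t, r, Finset.mul_sum, Fintype.sum_sum_type, Fintype.sum_bool,
        Sum.elim_inl, Sum.elim_inr]
      simp only [if_true, Bool.false_eq_true, if_false, mul_zero, zero_mul, zero_add]
      exact Finset.sum_congr rfl fun _ _ => by ring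
    have e2 : t ⬝ᵥ (fun i => g i * r i) = z ^ 2 * (e ⬝ᵥ ϖ) := by
      simp only [dotProduct, g, t, r, Finset.mul_sum, Fintype.sum_sum_type, Fintype.sum_bool,
        Sum.elim_inl, Sum.elim_inr]
      simp only [if_true, Bool.false_eq_true, if_false, mul_zero, zero_mul, zero_add]
      exact Finset.sum_congr rfl fun _ _ => by ring
    have e3 : (fun i => g i * t i) ⬝ᵥ t = -(z * p ^ 2) + z ^ 2 * (ϖ ⬝ᵥ ϖ) := by
      simp [dotProduct, g, t, Finset.mul_sum, mul_assoc, pow_two]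
    have e4 : r ⬝ᵥ (fun i => g i * r i) = p ^ 2 + z ^ 2 * (e ⬝ᵥ e) := by
      simp [dotProduct, g, r, Finset.mul_sum, mul_left_comm, pow_two]
    rw [h1, e1, e2, e3, e4, smul_eq_mul]
    have hn := h.norm'
    have hk := h.unit
    rw [← hz, ← hp] at hn hk
    linear_combination 2 * κ ^ 2 * z * p ^ 2 * hn + (κ * p + 1) *
      (2 * z + 2 * κ ^ 2 * z ^ 4 * ((e ⬝ᵥ e) * (ϖ ⬝ᵥ ϖ) - (e ⬝ᵥ ϖ) ^ 2)) * hk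
  have hK : ∀ x i, ((wedge a b * diagonal g) *ᵥ x) i =
      (b ⬝ᵥ fun i => g i * x i) * a i - (a ⬝ᵥ fun i => g i * x i) * b i := fun x i => by
    rw [← mulVec_mulVec, wedge_mulVec, show diagonal g *ᵥ x = fun i => g i * x i from
      funext fun i => mulVec_diagonal g x i]
    rfl
  have br : (b ⬝ᵥ fun i => g i * r i) = p := by simp [dotProduct, b, g, r]
  have bt : (b ⬝ᵥ fun i => g i * t i) = 0 := by simp [dotProduct, b, g, t]
  have ar : (a ⬝ᵥ fun i => g i * r i) = -(z ^ 2 * (c ⬝ᵥ e)) := by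
    simp [dotProduct, a, g, r, Finset.mul_sum, mul_left_comm]
  have at' : (a ⬝ᵥ fun i => g i * t i) = z * p - z ^ 2 * (c ⬝ᵥ ϖ) := by
    simp [dotProduct, a, g, t, Finset.mul_sum, mul_left_comm, sub_eq_add_neg]
  have hk : p * κ = 1 := h.unit
  have hq := h.deriv_density
  have hdp : d.powerSeries p = z * (c ⬝ᵥ e) := by
    rw [hp, map_add, Derivation.leibniz, hdz, hq]
    simp [hc]
  have hr : ∀ i, z * d.powerSeries (r i) = ((wedge a b * diagonal g) *ᵥ r) i + t i := by
    intro i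
    rw [hK, br, ar]
    rcases i with (_ | _) | i
    · simp [a, b, r, t]
    · simp only [a, b, r, t, Sum.elim_inl, if_true, hdp]
      ring
    · have := congrFun h.deriv_vector i
      simp only [Pi.smul_apply, Pi.sub_apply, smul_eq_mul, Derivation.vec] at this
      simp only [a, b, r, t, Sum.elim_inr, Pi.neg_apply, Pi.zero_apply]
      linear_combination this
  have ht : ∀ i, z * d.powerSeries (t i) = ((wedge a b * diagonal g) *ᵥ t) i +
      ((z - z ^ 2 * κ * (c ⬝ᵥ ϖ)) * r i + z ^ 2 * κ * (c ⬝ᵥ e) * t i) := by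
    intro i
    rw [hK, bt, at']
    rcases i with (_ | _) | i
    · simp only [a, b, r, t, Sum.elim_inl, Bool.false_eq_true, if_false, map_neg, hdp]
      linear_combination z ^ 2 * (c ⬝ᵥ e) * hk
    · simp only [a, b, r, t, Sum.elim_inl, if_true, map_zero]
      linear_combination z ^ 2 * (c ⬝ᵥ ϖ) * hk
    · have := congrFun h.deriv_covector i
      simp only [Pi.smul_apply, Pi.add_apply, Pi.sub_apply, smul_eq_mul, Derivation.vec] at this
      simp only [a, b, r, t, Sum.elim_inr, Pi.neg_apply, Pi.zero_apply]
      linear_combination z * this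
  -- In the wedge of `r` and `t`, the term `t` of `z D r` and the multiple of `r` in `z D t` drop
  -- out. The remaining multiple of `t` is cancelled by the derivative of `κ`.
  have hD : z • S.map d.powerSeries =
      wedge a b * diagonal g * S - S * diagonal g * wedge a b := by
    have hκ : z * d.powerSeries κ = -κ * (z ^ 2 * κ * (c ⬝ᵥ e)) := by
      rw [h.deriv_unit, hq]
      ring
    have hv : ∀ x, x ᵥ* (diagonal g * wedge a b) = -((wedge a b * diagonal g) *ᵥ x) := fun x => by
      rw [← mulVec_transpose, transpose_mul, hwedge, diagonal_transpose, neg_mul, neg_mulVec]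
    rw [mul_assoc S, show S * (diagonal g * wedge a b) = κ • (wedge r t * (diagonal g * wedge a b))
      from Matrix.smul_mul _ _ _, show wedge a b * diagonal g * S =
      κ • (wedge a b * diagonal g * wedge r t) from Matrix.mul_smul _ _ _, mul_wedge,
      wedge_mul r t, hv, hv]
    ext1 i j
    simp only [S, Matrix.smul_apply, Matrix.sub_apply, vecMulVec_apply, map_apply, wedge,
      smul_eq_mul, Derivation.leibniz, map_sub, Pi.neg_apply]
    simp only [wedge] at hr ht
    linear_combination κ * (t j * hr i - t i * hr j + r i * ht j - r j * ht i) +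
      (r i * t j - t i * r j) * hκ
  -- Only `a` varies, and `b` is the first basis vector, so the trace reads off the row of the
  -- bivector that contains `ϖ`; the metric supplies `z²`.
  have htrace : ∀ δ δ' : Derivation ℝ A A,
      trace ((wedge a b).map δ'.powerSeries * diagonal g * (S.map δ.powerSeries * diagonal g)) =
        -(2 * z ^ 2 * (constVec (δ'.vec u) ⬝ᵥ δ.powerSeries.vec ϖ)) := fun δ δ' => by
    have hb : δ'.powerSeries.vec b = 0 := by
      funext i
      rcases i with (_ | _) | i <;> simp [b, Derivation.vec]
    have ha : δ'.powerSeries.vec a = Sum.elim (0 : Bool → A⟦X⟧) (-constVec (δ'.vec u)) := by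
      funext i
      rcases i with (_ | _) | i
      · simp [a, Derivation.vec]
      · simp [a, Derivation.vec]
      · simp [a, Derivation.vec, hc, constVec, Derivation.powerSeries_C]
    have hS : ∀ i, S.map δ.powerSeries (Sum.inl true) (Sum.inr i) = δ.powerSeries (ϖ i) :=
        fun i => by
      have : S (Sum.inl true) (Sum.inr i) = ϖ i := by
        simp only [S, wedge, Matrix.smul_apply, Matrix.sub_apply, vecMulVec_apply, r, t,
          Sum.elim_inl, Sum.elim_inr, if_true, smul_eq_mul]
        linear_combination ϖ i * hk
      rw [map_apply, this]
    rw [Derivation.map_wedge, hb, ha, show ∀ x : Bool ⊕ β → A⟦X⟧, wedge x 0 = 0 from fun x => by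
      simp [wedge], add_zero, mul_assoc, ← mul_assoc (diagonal g),
      trace_mul_skew (hGSG _ (Derivation.map_skew _ hskew)), bil_diagonal]
    simp only [bil, dotProduct, mulVec, Fintype.sum_sum_type, Fintype.sum_bool, g, b, Sum.elim_inl,
      Sum.elim_inr, if_true, hS, Pi.zero_apply, Pi.neg_apply, Derivation.vec]
    simp only [mul_zero, zero_mul, if_false, Bool.false_eq_true, zero_add, add_zero, one_mul,
      mul_one, Finset.mul_sum, Finset.sum_const_zero, ← Finset.sum_neg_distrib]
    exact Finset.sum_congr rfl fun _ _ => by ring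
  obtain ⟨Ω, hΩ⟩ := exists_derivation_eq_trace (D := d.powerSeries) (δ := δ.powerSeries)
    (δ' := δ'.powerSeries) PowerSeries.X_ne_zero (hdz δ) (hdz δ') (hg d) (hg δ) (hg δ')
    (Derivation.powerSeries_comm hδ) (Derivation.powerSeries_comm hδ') hskew hrank hnorm hD
  refine ⟨Ω, ?_⟩
  rw [hΩ, htrace, htrace]
  ring

/-- The two-form carries a factor `2 X²`, so order `k` is read from its coefficient of order `k +
2`. -/
theorem IsResolvent.exists_variation_symm (h : IsResolvent d u q κ e ϖ V)
    {δ δ' : Derivation ℝ A A} (hδ : ∀ f, δ (d f) = d (δ f)) (hδ' : ∀ f, δ' (d f) = d (δ' f))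
    (k : ℕ) : ∃ ω, d ω = ∑ i, δ (u i) * δ' (PowerSeries.coeff k (ϖ i)) -
      ∑ i, δ' (u i) * δ (PowerSeries.coeff k (ϖ i)) := by
  obtain ⟨Ω, hΩ⟩ := h.exists_two_form hδ hδ'
  refine ⟨half A * PowerSeries.coeff (k + 2) Ω, ?_⟩
  have h1 := congrArg (PowerSeries.coeff (k + 2)) hΩ
  rw [Derivation.coeff_powerSeries, mul_assoc, ← map_ofNat PowerSeries.C 2, PowerSeries.coeff_C_mul,
    mul_comm (PowerSeries.X ^ 2), PowerSeries.coeff_mul_X_pow] at h1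
  simp only [dotProduct, constVec, map_sub, map_sum, PowerSeries.coeff_C_mul, Derivation.vec,
    Derivation.coeff_powerSeries] at h1
  rw [Derivation.half_mul, h1, ← mul_assoc, mul_comm (half A), two_mul_half, one_mul]

end Closed

/-! ### The hierarchy of commuting flows -/

section Hierarchy

open scoped PowerSeries
open Matrix

variable {β : Type} [Fintype β] {q κ : (DiffPoly β)⟦X⟧} {e ϖ : β → (DiffPoly β)⟦X⟧}
  {V : Matrix β β (DiffPoly β)⟦X⟧}

/-- The coefficients of a vector of power series. -/
noncomputable def coeffVec {A : Type*} [CommRing A] (k : ℕ) (x : β → A⟦X⟧) : β → A :=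
  fun i => PowerSeries.coeff k (x i)

/-- The hierarchy of vector fields `e`, covector fields `ϖ` and Hamiltonians `F` generated from
the translation flow by the recursion operator. -/
structure IsHierarchy (e ϖ : ℕ → β → DiffPoly β) (F : ℕ → DiffPoly β) : Prop where
  vector_zero : e 0 = fun i => totalD β (fieldVar β i)
  covector_zero : ϖ 0 = fieldVar β
  hamiltonian_zero : F 0 = (1 / 2 : ℝ) • ∑ i, fieldVar β i ^ 2
  opH : ∀ k, opH (fieldVar β) (ϖ k) (e k)
  opJ : ∀ k, opJ (fieldVar β) (e k) (ϖ (k + 1))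
  gradient : ∀ k, varDeriv (F k) = ϖ k
  commute : ∀ j k, flowBracket (e j) (e k) = 0

namespace IsResolvent

variable (h : IsResolvent (totalD β) (fieldVar β) q κ e ϖ V)
include h

theorem coeffVec_covector_zero : coeffVec 0 ϖ = fieldVar β := by
  funext i
  have := congrArg (PowerSeries.coeff 0) (congrFun h.covector i)
  simpa [coeffVec, constVec] using this

theorem totalD_coeff_density (k : ℕ) :
    totalD β (PowerSeries.coeff k q) = fieldVar β ⬝ᵥ coeffVec k e := by
  have := congrArg (PowerSeries.coeff k) h.deriv_density
  simpa [dotProduct, constVec, coeffVec] using this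

theorem totalD_coeffVec_vector (k : ℕ) (i : β) : totalD β (coeffVec k e i) =
    coeffVec (k + 1) ϖ i - PowerSeries.coeff k q * fieldVar β i := by
  have := congrArg (PowerSeries.coeff (k + 1)) (congrFun h.covector i)
  simp only [Pi.add_apply, Pi.smul_apply, smul_eq_mul, map_add, constVec,
    PowerSeries.coeff_succ_X_mul, PowerSeries.coeff_mul_C, Derivation.vec,
    Derivation.coeff_powerSeries, PowerSeries.coeff_succ_C, zero_add] at this
  exact (sub_eq_iff_eq_add.mpr this).symm

theorem totalD_coeff_bivector (k : ℕ) (i j : β) :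
    totalD β (PowerSeries.coeff k (((-PowerSeries.X : (DiffPoly β)⟦X⟧) • V) i j)) =
      fieldVar β i * coeffVec k ϖ j - coeffVec k ϖ i * fieldVar β j := by
  have := congrArg (PowerSeries.coeff k) (congrFun (congrFun h.deriv_bivector i) j)
  rw [map_apply, Derivation.coeff_powerSeries] at this
  rw [this]
  simp [wedge, vecMulVec_apply, constVec, coeffVec]

theorem totalD_coeffVec_covector (k : ℕ) (i : β) : totalD β (coeffVec k ϖ i) = coeffVec k e i -
    ∑ j, fieldVar β j * PowerSeries.coeff k (((-PowerSeries.X : (DiffPoly β)⟦X⟧) • V) j i) := by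
  have := congrArg (PowerSeries.coeff k) (congrFun h.hGraph.eq i)
  rw [Pi.add_apply, map_add, Derivation.vec, Derivation.coeff_powerSeries, Matrix.vecMul,
    _root_.dotProduct, map_sum] at this
  simp only [constVec, PowerSeries.coeff_C_mul] at this
  exact eq_sub_of_add_eq this.symm

theorem constantTerms_skew (i j : β) :
    constantTerms (((-PowerSeries.X : (DiffPoly β)⟦X⟧) • V) i j) = 0 := by
  rw [Matrix.smul_apply, smul_eq_mul, map_mul, h.constantTerms_bivector, mul_zero]

theorem opJ_coeffVec (k : ℕ) : opJ (fieldVar β) (coeffVec k e) (coeffVec (k + 1) ϖ) := by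
  refine ⟨PowerSeries.coeff k q, ⟨h.totalD_coeff_density k, ?_⟩, fun i => ?_⟩
  · simpa using congrArg (PowerSeries.coeff k) h.constantTerms_density
  · rw [h.totalD_coeffVec_vector, sub_add_cancel]

theorem opH_coeffVec (k : ℕ) : opH (fieldVar β) (coeffVec k ϖ) (coeffVec k e) := by
  refine ⟨fun i j => PowerSeries.coeff k (((-PowerSeries.X : (DiffPoly β)⟦X⟧) • V) i j),
    fun i j => ⟨h.totalD_coeff_bivector k i j, ?_⟩, fun j => ?_⟩
  · simpa only [PowerSeries.coeff_map, map_zero] using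
      congrArg (PowerSeries.coeff k) (h.constantTerms_skew i j)
  · rw [h.totalD_coeffVec_covector, sub_add_cancel]

theorem coeffVec_vector_zero : coeffVec 0 e = fun i => totalD β (fieldVar β i) := by
  funext i
  have := congrArg (PowerSeries.coeff 0) (congrFun h.vector i)
  rw [Pi.sub_apply, map_sub, Pi.smul_apply, smul_eq_mul, PowerSeries.coeff_zero_X_mul, sub_zero,
    Derivation.vec, Derivation.coeff_powerSeries] at this
  rw [coeffVec, this]
  exact congrArg _ (congrFun h.coeffVec_covector_zero i)

theorem constantCoeff_coeffVec (k : ℕ) (i : β) : constantCoeff (coeffVec k e i) = 0 := by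
  have := congrArg (PowerSeries.coeff k) (h.constantTerms_vector i)
  rwa [PowerSeries.coeff_map, map_zero] at this

theorem linearSystem : LinearSystem (totalD β).powerSeries PowerSeries.X (constVec (fieldVar β))
    (1 + PowerSeries.X * q) e ϖ ((-PowerSeries.X : (DiffPoly β)⟦X⟧) • V) where
  scalar := by
    rw [map_add, Derivation.powerSeries_X_mul, h.deriv_density]
    simp
  vector := h.deriv_vector
  covector := by rw [eq_sub_iff_add_eq, ← h.hGraph.eq]
  bivector := h.deriv_bivector

/-- Along the flows `j` and `j + 1`, `LinearSystem.of_flow` yields a solution whose vector part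
vanishes; this is its coefficient of order `k + 1`. The right side is antisymmetric in `j` and `k`.
-/
theorem evolve_sub_evolve (j k : ℕ) (i : β) :
    evolve (coeffVec j e) (coeffVec (k + 1) e i) - evolve (coeffVec (j + 1) e) (coeffVec k e i) =
      (PowerSeries.coeff k q * coeffVec (j + 1) ϖ i - PowerSeries.coeff j q * coeffVec (k + 1) ϖ i) +
      ((∑ l, PowerSeries.coeff (j + 1) (((-PowerSeries.X : (DiffPoly β)⟦X⟧) • V) i l) *
        coeffVec k e l) -
        ∑ l, PowerSeries.coeff (k + 1) (((-PowerSeries.X : (DiffPoly β)⟦X⟧) • V) i l) *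
          coeffVec j e l) := by
  have hWskew := h.hGraph.skew
  have hWconst := h.constantTerms_skew
  have hsys := h.linearSystem
  have hbiv := h.totalD_coeff_bivector (j + 1)
  have hcov := h.totalD_coeffVec_covector (j + 1)
  generalize (-PowerSeries.X : (DiffPoly β)⟦X⟧) • V = W at *
  obtain ⟨W', hW'⟩ : ∃ W' : Matrix β β (DiffPoly β)⟦X⟧, ∀ i l,
    W' i l = PowerSeries.C (PowerSeries.coeff (j + 1) (W i l)) := ⟨_, fun _ _ => rfl⟩
  have hY : ∀ j, (evolve (coeffVec j e)).powerSeries.vec (constVec (fieldVar β)) =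
      constVec (coeffVec j e) := fun j => by
    funext i
    simp [Derivation.vec, constVec]
  have hδ : ∀ j f, (evolve (coeffVec j e)).powerSeries ((totalD β).powerSeries f) =
      (totalD β).powerSeries ((evolve (coeffVec j e)).powerSeries f) := fun j =>
    Derivation.powerSeries_comm (evolve_totalD _)
  have hskew : W'ᵀ = -W' := by
    ext1 i l
    have := congrFun (congrFun hWskew i) l
    rw [transpose_apply, Matrix.neg_apply] at this ⊢
    rw [hW', hW', this, map_neg, map_neg]
  have hflow := hsys.of_flow hWskew (Derivation.powerSeries_X _)
    (Derivation.powerSeries_X _) (Derivation.powerSeries_X _) (hδ j) (hδ (j + 1)) (hY j)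
    (hY (j + 1)) (ϖ' := constVec (coeffVec (j + 1) ϖ)) (q' := PowerSeries.C (PowerSeries.coeff j q))
    (W' := W')
    (by
      funext i
      simp [Derivation.vec, constVec, h.totalD_coeffVec_vector])
    (by
      funext i
      rw [Pi.sub_apply, Matrix.vecMul, _root_.dotProduct]
      simp [Derivation.vec, constVec, hcov, hW'])
    (by
      rw [Derivation.powerSeries_C, h.totalD_coeff_density]
      simp [dotProduct, constVec])
    (by
      ext1 i l
      rw [map_apply, hW', Derivation.powerSeries_C, hbiv]
      simp [wedge, vecMulVec_apply, constVec]) hskew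
  have hev : ∀ j f, constantTerms ((evolve (coeffVec j e)).powerSeries f) = 0 := fun j =>
    constantTerms_evolve (h.constantCoeff_coeffVec j)
  have he := h.constantTerms_vector
  have hϖ := h.constantTerms_covector
  have hz := hflow.vector_eq_zero
    (by
      rw [map_sub, map_add, map_sub, map_mul, map_mul, map_mul, hev, hev,
        constantTerms_dotProduct he, constantTerms_dotProduct hϖ]
      simp)
    (fun i l => by
      have hWW : ∀ M : Matrix β β (DiffPoly β)⟦X⟧, constantTerms ((W * M) i l) = 0 ∧
          constantTerms ((M * W) i l) = 0 := fun M => by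
        simp only [mul_apply, map_sum, map_mul, hWconst, zero_mul, mul_zero,
          Finset.sum_const_zero, and_self]
      have hwedge : ∀ x y : β → (DiffPoly β)⟦X⟧, (∀ i, constantTerms (x i) = 0) →
          constantTerms (wedge x y i l) = 0 := fun x y hx => by
        rw [show wedge x y i l = x i * y l - y i * x l from rfl, map_sub, map_mul, map_mul, hx, hx,
          zero_mul, mul_zero, sub_zero]
      rw [Matrix.add_apply, Matrix.sub_apply, Matrix.smul_apply, Matrix.smul_apply,
        Matrix.add_apply, Matrix.sub_apply, Matrix.sub_apply, map_apply, map_apply, smul_eq_mul,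
        smul_eq_mul, map_add, map_sub, map_mul, map_mul, map_add, map_sub, map_sub, hev, hev,
        hwedge _ _ he, hwedge _ _ hϖ, (hWW W').1, (hWW W').2]
      simp)
  have := congrArg (PowerSeries.coeff (k + 1)) (congrFun hz i)
  simp only [Pi.sub_apply, Pi.add_apply, Pi.smul_apply, smul_eq_mul, map_sub, map_add,
    PowerSeries.coeff_succ_X_mul, Derivation.vec, Derivation.coeff_powerSeries, constVec,
    PowerSeries.coeff_mul_C, PowerSeries.coeff_C_mul, PowerSeries.coeff_one, mulVec, dotProduct,
    map_sum, hW', Pi.zero_apply, map_zero, add_eq_zero, one_ne_zero, and_false, if_false,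
    zero_add] at this
  simp only [coeffVec] at this ⊢
  linear_combination this

/-- By that antisymmetry the commutator for `(j + 1, k)` equals the one for `(j, k + 1)`. At `j = 0`
the flow is translation, which commutes with every evolutionary field. -/
theorem flowBracket_coeffVec (j k : ℕ) : flowBracket (coeffVec j e) (coeffVec k e) = 0 := by
  induction j generalizing k with
  | zero =>
    funext i
    rw [flowBracket, h.coeffVec_vector_zero, evolve_totalD_X, evolve_totalD]
    simp
  | succ j ih =>
    rw [← ih (k + 1)]
    funext i
    have h1 := h.evolve_sub_evolve j k i
    have h2 := h.evolve_sub_evolve k j i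
    simp only [flowBracket]
    linear_combination -h1 - h2

/-- The covector fields of the hierarchy are variational derivatives. -/
theorem exists_varDeriv_eq (k : ℕ) : ∃ F, (k = 0 → F = (1 / 2 : ℝ) • ∑ i, fieldVar β i ^ 2) ∧
    varDeriv F = coeffVec k ϖ := by
  obtain ⟨F, hF⟩ : ∃ F, (k = 0 → F = (1 / 2 : ℝ) • ∑ i, fieldVar β i ^ 2) ∧
      evolve (dilation β) F = pairing (dilation β) (coeffVec k ϖ) := by
    -- The first Hamiltonian is prescribed and is checked against the homotopy equation directly;
    -- the others come from inverting the degree operator.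
    rcases k with _ | k
    · refine ⟨(1 / 2 : ℝ) • ∑ i, fieldVar β i ^ 2, fun _ => rfl, ?_⟩
      rw [h.coeffVec_covector_zero, Derivation.map_smul, map_sum, pairing, Finset.smul_sum]
      refine Finset.sum_congr rfl fun i _ => ?_
      rw [pow_two, Derivation.leibniz, evolve_X, smul_eq_mul, ← two_smul ℝ, smul_smul]
      simp [dilation]
    · have h0 : constantCoeff (pairing (dilation β) (coeffVec (k + 1) ϖ)) = 0 := by
        simp [pairing, dilation]
      obtain ⟨F, hF⟩ := exists_evolve_dilation_eq h0
      exact ⟨F, fun h => absurd h (Nat.succ_ne_zero k), hF⟩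
  refine ⟨F, hF.1, varDeriv_eq_of_closed (fun Y Z => ?_) hF.2⟩
  obtain ⟨ω, hω⟩ := h.exists_variation_symm (evolve_totalD Y) (evolve_totalD Z) k
  refine ⟨ω, ?_⟩
  rw [hω]
  simp [pairing, coeffVec]

end IsResolvent

theorem exists_hierarchy (β : Type) [Fintype β] :
    ∃ (e ϖ : ℕ → β → DiffPoly β) (F : ℕ → DiffPoly β), IsHierarchy e ϖ F := by
  obtain ⟨q, κ, e, ϖ, V, h⟩ := exists_isResolvent (totalD β) (fieldVar β)
  choose F hF0 hF using h.exists_varDeriv_eq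
  exact ⟨fun k => coeffVec k e, fun k => coeffVec k ϖ, F, ⟨h.coeffVec_vector_zero,
    h.coeffVec_covector_zero, hF0 0 rfl, h.opH_coeffVec, h.opJ_coeffVec, hF,
    h.flowBracket_coeffVec⟩⟩

end Hierarchy

/-! ### Substitutions commuting with the total derivative -/

section Substitution

open Matrix

variable {α α' β : Type}

/-- An algebra homomorphism which commutes with the total derivative and preserves constant
terms. -/
structure IsDifferentialHom (φ : DiffPoly α →ₐ[ℝ] DiffPoly α') : Prop where
  totalD : ∀ f, totalD α' (φ f) = φ (totalD α f)
  constantCoeff : ∀ f, constantCoeff (φ f) = constantCoeff f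

theorem IsDifferentialHom.of_X {φ : DiffPoly α →ₐ[ℝ] DiffPoly α'}
    (hD : ∀ a j, _root_.totalD α' (φ (X (a, j))) = φ (X (a, j + 1)))
    (hc : ∀ p, MvPolynomial.constantCoeff (φ (X p)) = 0) : IsDifferentialHom φ where
  totalD f := by
    induction f using MvPolynomial.induction_on with
    | C a => simp [← algebraMap_eq]
    | add f g hf hg => simp only [map_add, hf, hg]
    | mul_X f p hf => simp only [map_mul, Derivation.leibniz, hf, totalD_X, hD, smul_eq_mul, map_add]
  constantCoeff f := by
    induction f using MvPolynomial.induction_on with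
    | C a => simp [← algebraMap_eq]
    | add f g hf hg => simp only [map_add, hf, hg]
    | mul_X f p hf => simp [hc]

theorem IsDifferentialHom.isPrimitive {φ : DiffPoly α →ₐ[ℝ] DiffPoly α'} (hφ : IsDifferentialHom φ)
    {f g : DiffPoly α} (h : IsPrimitive f g) : IsPrimitive (φ f) (φ g) :=
  ⟨by rw [hφ.totalD, h.1], by rw [hφ.constantCoeff, h.2]⟩

variable [Fintype β]

theorem IsDifferentialHom.opH {φ : DiffPoly α →ₐ[ℝ] DiffPoly α'} (hφ : IsDifferentialHom φ)
    {u ξ y : β → DiffPoly α} (h : opH u ξ y) :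
    _root_.opH (fun i => φ (u i)) (fun i => φ (ξ i)) fun i => φ (y i) := by
  obtain ⟨W, hW, hy⟩ := h
  refine ⟨fun i j => φ (W i j), fun i j => ?_, fun j => ?_⟩
  · simpa only [map_sub, map_mul] using hφ.isPrimitive (hW i j)
  · simp only [hy, map_add, map_sum, map_mul, hφ.totalD]

theorem IsDifferentialHom.opJ {φ : DiffPoly α →ₐ[ℝ] DiffPoly α'} (hφ : IsDifferentialHom φ)
    {u e ξ : β → DiffPoly α} (h : opJ u e ξ) :
    _root_.opJ (fun i => φ (u i)) (fun i => φ (e i)) fun i => φ (ξ i) := by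
  obtain ⟨w, hw, hξ⟩ := h
  refine ⟨φ w, ?_, fun j => ?_⟩
  · simpa only [map_sum, map_mul] using hφ.isPrimitive hw
  · simp only [hξ, map_add, map_mul, hφ.totalD]

end Substitution

/-! ### Orthogonal invariance -/

section Orthogonal

open Matrix

variable {α β : Type} [Fintype β]

theorem isDifferentialHom_substLinear (A : Matrix β β ℝ) : IsDifferentialHom (substLinear A) :=
  .of_X (fun a j => by simp [substLinear]) fun p => by simp [substLinear]

/-- Constant matrices act on vectors of differential polynomials. -/
theorem sum_smul_eq_mulVec (A : Matrix β β ℝ) (y : β → DiffPoly α) (i : β) :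
    ∑ j, A i j • y j = (A.map C *ᵥ y) i := by
  simp [mulVec, dotProduct, smul_eq_C_mul]

theorem totalD_mulVec (A : Matrix β β ℝ) (y : β → DiffPoly α) (i : β) :
    totalD α ((A.map C *ᵥ y) i) = (A.map C *ᵥ fun j => totalD α (y j)) i := by
  simp only [← sum_smul_eq_mulVec, map_sum, Derivation.map_smul]

variable [DecidableEq β] {A : Matrix β β ℝ}

theorem transpose_map_C_mul (hA : A ∈ orthogonalGroup β ℝ) :
    (A.map C : Matrix β β (DiffPoly α))ᵀ * A.map C = 1 := by
  rw [← transpose_map, ← Matrix.map_mul, show Aᵀ * A = 1 from (mem_orthogonalGroup_iff' _ _).mp hA]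
  exact Matrix.map_one _ (map_zero _) (map_one _)

theorem mulVec_dotProduct_mulVec (hA : A ∈ orthogonalGroup β ℝ) (x y : β → DiffPoly α) :
    A.map C *ᵥ x ⬝ᵥ A.map C *ᵥ y = x ⬝ᵥ y := by
  rw [← vecMul_transpose, ← dotProduct_mulVec, mulVec_mulVec, transpose_map_C_mul hA, one_mulVec]

/-- The inner product is preserved, so the same potential serves. -/
theorem opJ.orthogonal (hA : A ∈ orthogonalGroup β ℝ) {u e ξ : β → DiffPoly α} (h : opJ u e ξ) :
    opJ (A.map C *ᵥ u) (A.map C *ᵥ e) (A.map C *ᵥ ξ) := by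
  obtain ⟨w, hw, hξ⟩ := h
  refine ⟨w, ?_, fun i => ?_⟩
  · convert hw using 1
    exact mulVec_dotProduct_mulVec hA u e
  · rw [totalD_mulVec, show ξ = (fun i => totalD α (e i)) + w • u from funext hξ, mulVec_add,
      mulVec_smul]
    rfl

/-- The potential transforms as a bivector, `W ↦ A W Aᵀ`. -/
theorem opH.orthogonal (hA : A ∈ orthogonalGroup β ℝ) {u ξ y : β → DiffPoly α} (h : opH u ξ y) :
    opH (A.map C *ᵥ u) (A.map C *ᵥ ξ) (A.map C *ᵥ y) := by
  obtain ⟨W, hW, hy⟩ := h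
  set B : Matrix β β (DiffPoly α) := A.map C with hB
  have hBW : ∀ i j, (B * of W * Bᵀ) i j = ∑ k, ∑ l, (A j k * A i l) • W l k := fun i j => by
    simp only [mul_apply, hB, map_apply, transpose_apply, of_apply, Finset.sum_mul, smul_eq_C_mul,
      C_mul]
    exact Finset.sum_congr rfl fun _ _ => Finset.sum_congr rfl fun _ _ => by ring
  refine ⟨B * of W * Bᵀ, fun i j => ⟨?_, ?_⟩, fun j => ?_⟩
  · rw [hBW]
    simp only [map_sum, Derivation.map_smul, (hW _ _).1, hB, ← sum_smul_eq_mulVec,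
      Finset.sum_mul_sum]
    rw [Finset.sum_comm]
    simp only [← Finset.sum_sub_distrib, smul_eq_C_mul, C_mul]
    refine Finset.sum_congr rfl fun _ _ => Finset.sum_congr rfl fun _ _ => by ring
  · rw [hBW]
    simp only [map_sum, constantCoeff_smul, (hW _ _).2, smul_zero, Finset.sum_const_zero]
  · have h1 : (B *ᵥ u) ᵥ* (B * of W * Bᵀ) = B *ᵥ (u ᵥ* of W) := by
      rw [← vecMul_transpose B u, vecMul_vecMul, mul_assoc B, ← mul_assoc, transpose_map_C_mul hA,
        one_mul, ← vecMul_vecMul, vecMul_transpose]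
    have h2 : y = (fun i => totalD α (ξ i)) + u ᵥ* of W := funext hy
    rw [totalD_mulVec, h2, mulVec_add, ← h1]
    rfl

end Orthogonal

/-! ### Equivariance of the hierarchy and the flows shifted by a curvature constant -/

section Hierarchy

open Matrix

variable {β : Type} [Fintype β]

/-- Substituting `A v` and applying `A` both turn the graphs of `H` and `J` for `v` into those for
`A v`. They agree on the initial covector, and single-valuedness propagates the agreement. -/
theorem IsHierarchy.substLinear [DecidableEq β] {e ϖ : ℕ → β → DiffPoly β} {F : ℕ → DiffPoly β}
    (h : IsHierarchy e ϖ F) {A : Matrix β β ℝ} (hA : A ∈ orthogonalGroup β ℝ) (k : ℕ) :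
    (fun i => substLinear A (e k i)) = A.map C *ᵥ e k := by
  have hu : (fun i => _root_.substLinear A (fieldVar β i)) = A.map C *ᵥ fieldVar β := by
    funext i
    simp [_root_.substLinear, ← sum_smul_eq_mulVec]
  have hA' := isDifferentialHom_substLinear A
  have hH : ∀ k, (fun i => _root_.substLinear A (ϖ k i)) = A.map C *ᵥ ϖ k →
      (fun i => _root_.substLinear A (e k i)) = A.map C *ᵥ e k := fun k hk => by
    have := hA'.opH (h.opH k)
    rw [hu, hk] at this
    exact this.unique ((h.opH k).orthogonal hA)
  suffices ∀ k, (fun i => _root_.substLinear A (ϖ k i)) = A.map C *ᵥ ϖ k from hH k (this k)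
  intro k
  induction k with
  | zero => rw [h.covector_zero, hu]
  | succ k ih =>
    have := hA'.opJ (h.opJ k)
    rw [hu, hH k ih] at this
    exact opJ.unique this ((h.opJ k).orthogonal hA)

theorem varDeriv_sub_smul {α : Type} (f g : DiffPoly α) (R : ℝ) (a : α) :
    varDeriv (f - R • g) a = varDeriv f a - R • varDeriv g a := by
  classical
  obtain ⟨N, hN⟩ := exists_order f
  obtain ⟨M, hM⟩ := exists_order g
  obtain ⟨L, hL⟩ := exists_order (f - R • g)
  rw [varDeriv_eq_sum (N := max L (max N M)) (fun p hp => lt_max_of_lt_left (hL p hp)),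
    varDeriv_eq_sum (N := max L (max N M))
      (fun p hp => lt_max_of_lt_right (lt_max_of_lt_left (hN p hp))),
    varDeriv_eq_sum (N := max L (max N M))
      (fun p hp => lt_max_of_lt_right (lt_max_of_lt_right (hM p hp))), Finset.smul_sum,
    ← Finset.sum_sub_distrib]
  refine Finset.sum_congr rfl fun j _ => ?_
  have hs : ∀ (c : ℝ) (x : DiffPoly α), (⇑(totalD α))^[j] (c • x) = c • (⇑(totalD α))^[j] x :=
    fun c x => (Function.Commute.iterate_left (g := (c • · : DiffPoly α → DiffPoly α))
      (fun x => Derivation.map_smul _ c x) j) x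
  rw [map_sub, Derivation.map_smul, iterate_map_sub, hs, smul_sub, smul_comm]

theorem flowBracket_sub_smul {α : Type} {Y Z Y' Z' : α → DiffPoly α} (R : ℝ)
    (h₁ : flowBracket Y Z = 0) (h₂ : flowBracket Y Z' = 0) (h₃ : flowBracket Y' Z = 0)
    (h₄ : flowBracket Y' Z' = 0) : flowBracket (Y - R • Y') (Z - R • Z') = 0 := by
  funext a
  have h₁ := congrFun h₁ a
  have h₂ := congrFun h₂ a
  have h₃ := congrFun h₃ a
  have h₄ := congrFun h₄ a
  simp only [flowBracket, Pi.zero_apply, Pi.sub_apply, Pi.smul_apply, evolve_sub, evolve_smul,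
    map_sub, Derivation.map_smul] at *
  simp only [smul_eq_C_mul]
  linear_combination h₁ - C R * h₂ - C R * h₃ + C R * C R * h₄

/-- The flow `e^{(k+1)} - R e^{(k)}`. -/
noncomputable def shiftedFlow {β : Type} (e : ℕ → β → DiffPoly β) (R : ℝ) (k : ℕ) : β → DiffPoly β :=
  e (k + 1) - R • e k

namespace IsHierarchy

variable {e ϖ : ℕ → β → DiffPoly β} {F : ℕ → DiffPoly β} (h : IsHierarchy e ϖ F) (R : ℝ)
include h

theorem varDeriv_shifted (k : ℕ) : varDeriv (F (k + 1) - R • F k) = ϖ (k + 1) - R • ϖ k := by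
  funext i
  rw [varDeriv_sub_smul, h.gradient, h.gradient]
  rfl

theorem opH_shiftedFlow (k : ℕ) :
    _root_.opH (fieldVar β) (varDeriv (F (k + 1) - R • F k)) (shiftedFlow e R k) := by
  rw [h.varDeriv_shifted, shiftedFlow, sub_eq_add_neg, sub_eq_add_neg, ← neg_smul, ← neg_smul]
  exact (h.opH (k + 1)).add ((h.opH k).smul (-R))

theorem opJ_shiftedFlow (k : ℕ) : _root_.opJ (fieldVar β) (shiftedFlow e R k)
    (varDeriv (F (k + 1 + 1) - R • F (k + 1))) := by
  rw [h.varDeriv_shifted, shiftedFlow, sub_eq_add_neg, sub_eq_add_neg, ← neg_smul, ← neg_smul]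
  exact _root_.opJ.add (h.opJ (k + 1)) (_root_.opJ.smul (-R) (h.opJ k))

theorem flowBracket_shiftedFlow (j k : ℕ) :
    flowBracket (shiftedFlow e R j) (shiftedFlow e R k) = 0 :=
  flowBracket_sub_smul R (h.commute _ _) (h.commute _ _) (h.commute _ _) (h.commute _ _)

theorem substLinear_shiftedFlow [DecidableEq β] {A : Matrix β β ℝ}
    (hA : A ∈ orthogonalGroup β ℝ) (k : ℕ) (i : β) :
    _root_.substLinear A (shiftedFlow e R k i) = ∑ j, A i j • shiftedFlow e R k j := by
  rw [sum_smul_eq_mulVec, shiftedFlow, mulVec_sub, mulVec_smul, ← h.substLinear hA,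
    ← h.substLinear hA]
  simp

end IsHierarchy

end Hierarchy

/-! ### Differential polynomials in some components of the field -/

section Inclusion

variable {α β : Type}

/-- The inclusion of the differential polynomials in some components of the field. -/
noncomputable def inclusion (ι : β → α) : DiffPoly β →ₐ[ℝ] DiffPoly α := rename (Prod.map ι id)

variable (ι : β → α)

@[simp] theorem inclusion_X (p : β × ℕ) : inclusion ι (X p) = X (ι p.1, p.2) := rename_X _ _

theorem isDifferentialHom_inclusion : IsDifferentialHom (inclusion ι) :=
  .of_X (fun a j => by simp) fun p => by simp

theorem inclusion_fieldVar : (fun i => inclusion ι (fieldVar β i)) = fun i => fieldVar α (ι i) := by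
  simp

theorem totalD_inclusion (f : DiffPoly β) :
    totalD α (inclusion ι f) = inclusion ι (totalD β f) :=
  (isDifferentialHom_inclusion ι).totalD f

theorem iterate_totalD_inclusion (j : ℕ) (f : DiffPoly β) :
    (⇑(totalD α))^[j] (inclusion ι f) = inclusion ι ((⇑(totalD β))^[j] f) := by
  induction j with
  | zero => rfl
  | succ j ih =>
    rw [Function.iterate_succ_apply', ih, totalD_inclusion, Function.iterate_succ_apply']

/-- A polynomial in the selected components sees only those components of a flow. -/
theorem evolve_inclusion {Y : β → DiffPoly β} {Z : α → DiffPoly α}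
    (h : ∀ i, Z (ι i) = inclusion ι (Y i)) (f : DiffPoly β) :
    evolve Z (inclusion ι f) = inclusion ι (evolve Y f) := by
  induction f using MvPolynomial.induction_on with
  | C a => simp [← algebraMap_eq]
  | add f g hf hg => simp only [map_add, hf, hg]
  | mul_X f p hf =>
    simp only [map_mul, Derivation.leibniz, hf, inclusion_X, evolve_X, h, iterate_totalD_inclusion,
      smul_eq_mul, map_add]

theorem evolve_inclusion_eq_zero {Z : α → DiffPoly α} (h : ∀ i, Z (ι i) = 0) (f : DiffPoly β) :
    evolve Z (inclusion ι f) = 0 := by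
  rw [evolve_inclusion ι (Y := 0) (fun i => by rw [h, Pi.zero_apply, map_zero]), evolve_zero,
    map_zero]

theorem inclusion_mem_supported {s : Set (α × ℕ)} (h : ∀ i j, (ι i, j) ∈ s) (f : DiffPoly β) :
    inclusion ι f ∈ supported ℝ s := by
  classical
  refine mem_supported.mpr fun p hp => ?_
  obtain ⟨q, -, rfl⟩ := Finset.mem_image.mp (vars_rename _ f hp)
  exact h _ _

variable {ι}

theorem varDeriv_inclusion (hι : Function.Injective ι) (f : DiffPoly β) (i : β) :
    varDeriv (inclusion ι f) (ι i) = inclusion ι (varDeriv f i) := by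
  have hinj : Function.Injective (inclusion ι) :=
    rename_injective _ (hι.prodMap Function.injective_id)
  have hp : ∀ j, pderiv (ι i, j) (inclusion ι f) = inclusion ι (pderiv (i, j) f) := fun j =>
    pderiv_rename (hι.prodMap Function.injective_id) (i, j) f
  -- Injectivity lets the inclusion pass through the formally infinite sum with no separate bound on
  -- the order.
  refine Eq.symm ((AddMonoidHom.map_finsum_of_injective (inclusion ι : DiffPoly β →+ DiffPoly α)
    hinj _).trans (finsum_congr fun j => ?_))
  rw [hp, iterate_totalD_inclusion]
  exact map_smul (inclusion ι) _ _

end Inclusion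

/-! ### Horizontal and vertical flows as d-vectors -/

section DVectors

open Matrix

variable {n m : ℕ}

theorem flowBracket_ofH_inclusion {Y Z : Fin (n - 1) → DiffPoly (Fin (n - 1))}
    (h : flowBracket Y Z = 0) :
    flowBracket (ofH (m := m) fun i => inclusion Sum.inl (Y i))
      (ofH fun i => inclusion Sum.inl (Z i)) = 0 := by
  funext a
  rcases a with i | i
  · have := congrArg (inclusion (Sum.inl : _ → DIdx n m)) (congrFun h i)
    rw [flowBracket, map_sub, Pi.zero_apply, map_zero,
      ← evolve_inclusion Sum.inl (Z := ofH fun i => inclusion Sum.inl (Y i)) fun _ => rfl,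
      ← evolve_inclusion Sum.inl (Z := ofH fun i => inclusion Sum.inl (Z i)) fun _ => rfl] at this
    exact this
  · simp [flowBracket, ofH]

theorem flowBracket_ofV_inclusion {Y Z : Fin (m - 1) → DiffPoly (Fin (m - 1))}
    (h : flowBracket Y Z = 0) :
    flowBracket (ofV (n := n) fun i => inclusion Sum.inr (Y i))
      (ofV fun i => inclusion Sum.inr (Z i)) = 0 := by
  funext a
  rcases a with i | i
  · simp [flowBracket, ofV]
  · have := congrArg (inclusion (Sum.inr : _ → DIdx n m)) (congrFun h i)
    rw [flowBracket, map_sub, Pi.zero_apply, map_zero,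
      ← evolve_inclusion Sum.inr (Z := ofV fun i => inclusion Sum.inr (Y i)) fun _ => rfl,
      ← evolve_inclusion Sum.inr (Z := ofV fun i => inclusion Sum.inr (Z i)) fun _ => rfl] at this
    exact this

/-- Each flow fixes all the variables on which the characteristic of the other depends. -/
theorem flowBracket_ofH_ofV_inclusion (Y : Fin (n - 1) → DiffPoly (Fin (n - 1)))
    (Z : Fin (m - 1) → DiffPoly (Fin (m - 1))) :
    flowBracket (ofH (m := m) fun i => inclusion Sum.inl (Y i))
      (ofV fun i => inclusion Sum.inr (Z i)) = 0 := by
  funext a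
  rcases a with i | i
  · simp only [flowBracket, ofH, ofV, Sum.elim_inl, Pi.zero_apply, map_zero, zero_sub, neg_eq_zero]
    exact evolve_inclusion_eq_zero _ (fun _ => rfl) _
  · simp only [flowBracket, ofH, ofV, Sum.elim_inr, Pi.zero_apply, map_zero, sub_zero]
    exact evolve_inclusion_eq_zero _ (fun _ => rfl) _

theorem substLinear_inclusion_inl (A₁ : Matrix (Fin (n - 1)) (Fin (n - 1)) ℝ)
    (A₂ : Matrix (Fin (m - 1)) (Fin (m - 1)) ℝ) (f : DiffPoly (Fin (n - 1))) :
    substLinear (fromBlocks A₁ 0 0 A₂) (inclusion Sum.inl f) =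
      inclusion Sum.inl (substLinear A₁ f) := by
  have : (substLinear (fromBlocks A₁ 0 0 A₂)).comp (inclusion Sum.inl) =
      (inclusion Sum.inl).comp (substLinear A₁) := algHom_ext fun p => by simp [substLinear]
  exact DFunLike.congr_fun this f

theorem substLinear_inclusion_inr (A₁ : Matrix (Fin (n - 1)) (Fin (n - 1)) ℝ)
    (A₂ : Matrix (Fin (m - 1)) (Fin (m - 1)) ℝ) (f : DiffPoly (Fin (m - 1))) :
    substLinear (fromBlocks A₁ 0 0 A₂) (inclusion Sum.inr f) =
      inclusion Sum.inr (substLinear A₂ f) := by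
  have : (substLinear (fromBlocks A₁ 0 0 A₂)).comp (inclusion Sum.inr) =
      (inclusion Sum.inr).comp (substLinear A₂) := algHom_ext fun p => by simp [substLinear]
  exact DFunLike.congr_fun this f

theorem orthogonallyInvariant_ofH_inclusion {Y : Fin (n - 1) → DiffPoly (Fin (n - 1))}
    (h : ∀ A ∈ orthogonalGroup (Fin (n - 1)) ℝ, ∀ i, substLinear A (Y i) = ∑ j, A i j • Y j) :
    OrthogonallyInvariant (ofH (m := m) fun i => inclusion Sum.inl (Y i)) := by
  intro A₁ hA₁ A₂ _ a
  rcases a with i | i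
  · simp only [ofH, Sum.elim_inl, substLinear_inclusion_inl, h A₁ hA₁, map_sum, map_smul]
    simp
  · simp [ofH]

theorem orthogonallyInvariant_ofV_inclusion {Y : Fin (m - 1) → DiffPoly (Fin (m - 1))}
    (h : ∀ A ∈ orthogonalGroup (Fin (m - 1)) ℝ, ∀ i, substLinear A (Y i) = ∑ j, A i j • Y j) :
    OrthogonallyInvariant (ofV (n := n) fun i => inclusion Sum.inr (Y i)) := by
  intro A₁ _ A₂ hA₂ a
  rcases a with i | i
  · simp [ofV]
  · simp only [ofV, Sum.elim_inr, substLinear_inclusion_inr, h A₂ hA₂, map_sum, map_smul]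
    simp

end DVectors

/-! ### Assembly of the horizontal and vertical results -/

theorem mainTheorem3 (n m : ℕ) (hn : 1 ≤ n) (hm : 1 ≤ m) :
    -- the d-operators, their compatibility, and the further Hamiltonian operator
    (NAdapted (dH n m) ∧ NAdapted (dJ n m) ∧ NAdapted (dR n m) ∧
      Compatible (dH n m) (dJ n m) ∧
      IsHamiltonian ((dH n m).comp ((dJ n m).comp (dH n m))) ∧
      (dH n m).comp ((dJ n m).comp (dH n m)) = (dR n m).comp (dH n m)) ∧
    -- the hierarchies of vector fields, covector fields and Hamiltonians
    ∃ (e ϖ : ℕ → DVec n m) (hHam vHam : ℕ → DiffPoly (DIdx n m)),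
      (e 0 = (fun a => totalD (DIdx n m) (flowVar n m a)) ∧ ϖ 0 = flowVar n m ∧
        hHam 0 = (1 / 2 : ℝ) • ∑ i, (flowVar n m).h i ^ 2 ∧
        vHam 0 = (1 / 2 : ℝ) • ∑ i, (flowVar n m).v i ^ 2) ∧
      (∀ k, dR n m (e k) (e (k + 1)) ∧ dH n m (ϖ k) (e k) ∧ dJ n m (e k) (ϖ (k + 1))) ∧
      (∀ k, (ϖ k).h = varDerivH (hHam k) ∧ (ϖ k).v = varDerivV (vHam k)) ∧
      -- horizontal objects involve the horizontal field only, and similarly for vertical ones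
      (∀ k, hHam k ∈ hPoly n m ∧ vHam k ∈ vPoly n m ∧
        (∀ i, (e k).h i ∈ hPoly n m ∧ (ϖ k).h i ∈ hPoly n m) ∧
        (∀ i, (e k).v i ∈ vPoly n m ∧ (ϖ k).v i ∈ vPoly n m)) ∧
      -- the vector fields of the hierarchies commute
      (∀ k k', flowBracket (ofH (e k).h) (ofH (e k').h) = 0 ∧
        flowBracket (ofV (e k).v) (ofV (e k').v) = 0) ∧
      -- the flows, for all values of the constant scalar curvatures
      ∀ R S : ℝ,
        (∀ k, hH n m (varDerivH (shiftedHam hHam R k)) (hFlow e R k) ∧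
          (hJ n m).inv (varDerivH (shiftedHam hHam R (k + 1))) (hFlow e R k)) ∧
        (∀ k, vH n m (varDerivV (shiftedHam vHam S k)) (vFlow e S k) ∧
          (vJ n m).inv (varDerivV (shiftedHam vHam S (k + 1))) (vFlow e S k)) ∧
        (∀ k k', flowBracket (ofH (hFlow e R k)) (ofH (hFlow e R k')) = 0 ∧
          flowBracket (ofV (vFlow e S k)) (ofV (vFlow e S k')) = 0 ∧
          flowBracket (ofH (hFlow e R k)) (ofV (vFlow e S k')) = 0) ∧
        (∀ k, OrthogonallyInvariant (ofH (hFlow e R k)) ∧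
          OrthogonallyInvariant (ofV (vFlow e S k))) := by
  obtain ⟨e₁, ϖ₁, F₁, h₁⟩ := exists_hierarchy (Fin (n - 1))
  obtain ⟨e₂, ϖ₂, F₂, h₂⟩ := exists_hierarchy (Fin (m - 1))
  refine ⟨⟨nAdapted_dH n m, nAdapted_dJ n m, nAdapted_dR n m, compatible_dH_dJ n m,
    isHamiltonian_comp n m, comp_eq_dR_comp n m⟩, ?_⟩
  -- The two hierarchies were built over separate polynomial algebras; these inclusions place them
  -- in the common one and give dependence on one field only.
  let φ : DiffPoly (Fin (n - 1)) →ₐ[ℝ] DiffPoly (DIdx n m) := inclusion Sum.inl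
  let ψ : DiffPoly (Fin (m - 1)) →ₐ[ℝ] DiffPoly (DIdx n m) := inclusion Sum.inr
  have hφ : IsDifferentialHom φ := isDifferentialHom_inclusion _
  have hψ : IsDifferentialHom ψ := isDifferentialHom_inclusion _
  have hu : (flowVar n m).h = fun i => φ (fieldVar _ i) := (inclusion_fieldVar Sum.inl).symm
  have hv : (flowVar n m).v = fun i => ψ (fieldVar _ i) := (inclusion_fieldVar Sum.inr).symm
  have gradH : ∀ f, varDerivH (φ f) = fun i => φ (varDeriv f i) := fun f =>
    funext fun i => varDeriv_inclusion Sum.inl_injective f i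
  have gradV : ∀ f, varDerivV (ψ f) = fun i => ψ (varDeriv f i) := fun f =>
    funext fun i => varDeriv_inclusion Sum.inr_injective f i
  have opHH : ∀ {ξ y}, opH (fieldVar _) ξ y → hH n m (fun i => φ (ξ i)) fun i => φ (y i) :=
    fun h => by rw [hH, hu]; exact hφ.opH h
  have opHV : ∀ {ξ y}, opH (fieldVar _) ξ y → vH n m (fun i => ψ (ξ i)) fun i => ψ (y i) :=
    fun h => by rw [vH, hv]; exact hψ.opH h
  have opJH : ∀ {ξ y}, opJ (fieldVar _) ξ y → hJ n m (fun i => φ (ξ i)) fun i => φ (y i) :=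
    fun h => by rw [hJ, hu]; exact hφ.opJ h
  have opJV : ∀ {ξ y}, opJ (fieldVar _) ξ y → vJ n m (fun i => ψ (ξ i)) fun i => ψ (y i) :=
    fun h => by rw [vJ, hv]; exact hψ.opJ h
  have hP : ∀ f, φ f ∈ hPoly n m := inclusion_mem_supported _ fun _ _ => rfl
  have vP : ∀ f, ψ f ∈ vPoly n m := inclusion_mem_supported _ fun _ _ => rfl
  refine ⟨fun k => Sum.elim (fun i => φ (e₁ k i)) fun i => ψ (e₂ k i),
    fun k => Sum.elim (fun i => φ (ϖ₁ k i)) fun i => ψ (ϖ₂ k i),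
    fun k => φ (F₁ k), fun k => ψ (F₂ k), ⟨?_, ?_, ?_, ?_⟩, fun k => ⟨⟨⟨_, opJH (h₁.opJ k),
      opHH (h₁.opH (k + 1))⟩, _, opJV (h₂.opJ k), opHV (h₂.opH (k + 1))⟩,
      ⟨opHH (h₁.opH k), opHV (h₂.opH k)⟩, opJH (h₁.opJ k), opJV (h₂.opJ k)⟩,
    fun k => ⟨?_, ?_⟩, fun k => ⟨hP _, vP _, fun i => ⟨hP _, hP _⟩, fun i => ⟨vP _, vP _⟩⟩,
    fun j k => ⟨flowBracket_ofH_inclusion (h₁.commute j k),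
      flowBracket_ofV_inclusion (h₂.commute j k)⟩, fun R S => ?_⟩
  · funext a
    rcases a with i | i
    · simp [h₁.vector_zero, φ, flowVar]
    · simp [h₂.vector_zero, ψ, flowVar]
  · funext a
    rcases a with i | i
    · simp [h₁.covector_zero, φ, flowVar]
    · simp [h₂.covector_zero, ψ, flowVar]
  · simp [h₁.hamiltonian_zero, φ, hu]
  · simp [h₂.hamiltonian_zero, ψ, hv]
  · rw [gradH, h₁.gradient]; rfl
  · rw [gradV, h₂.gradient]; rfl
  set e : ℕ → DVec n m := fun k => Sum.elim (fun i => φ (e₁ k i)) fun i => ψ (e₂ k i)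
  have flowH : ∀ k, hFlow e R k = fun i => φ (shiftedFlow e₁ R k i) := fun k => by
    funext i
    simp only [shiftedFlow, Pi.sub_apply, Pi.smul_apply, map_sub, map_smul]
    rfl
  have flowV : ∀ k, vFlow e S k = fun i => ψ (shiftedFlow e₂ S k i) := fun k => by
    funext i
    simp only [shiftedFlow, Pi.sub_apply, Pi.smul_apply, map_sub, map_smul]
    rfl
  have hamH : ∀ k, shiftedHam (fun k => φ (F₁ k)) R k = φ (F₁ (k + 1) - R • F₁ k) := fun k => by
    rw [map_sub, map_smul]; rfl
  have hamV : ∀ k, shiftedHam (fun k => ψ (F₂ k)) S k = ψ (F₂ (k + 1) - S • F₂ k) := fun k => by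
    rw [map_sub, map_smul]; rfl
  simp only [flowH, flowV, hamH, hamV, gradH, gradV]
  exact ⟨fun k => ⟨opHH (h₁.opH_shiftedFlow R k), opJH (h₁.opJ_shiftedFlow R k)⟩,
    fun k => ⟨opHV (h₂.opH_shiftedFlow S k), opJV (h₂.opJ_shiftedFlow S k)⟩,
    fun j k => ⟨flowBracket_ofH_inclusion (h₁.flowBracket_shiftedFlow R j k),
      flowBracket_ofV_inclusion (h₂.flowBracket_shiftedFlow S j k),
      flowBracket_ofH_ofV_inclusion _ _⟩,
    fun k => ⟨orthogonallyInvariant_ofH_inclusion fun A hA => h₁.substLinear_shiftedFlow R hA k,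
      orthogonallyInvariant_ofV_inclusion fun A hA => h₂.substLinear_shiftedFlow S hA k⟩⟩
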